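/- Let $a>b>c>0$ and let $\mathbb{E}=\{x^2/a+y^2/b+z^2/c=1\}\subset\mathbb{R}^3$, with inward unit normal $N$. For $\alpha\in(-\pi/2,\pi/2)$, $\alpha\neq0$, let $\mathcal{F}_\alpha=\{\mathcal{F}_\alpha^+,\mathcal{F}_\alpha^-\}$, where the leaves of $\mathcal{F}_\alpha^{\pm}$ are the maximal curves on $\mathbb{E}$ minus its umbilic points that make the constant oriented angle $\pm\alpha$ with the principal foliation of the larger principal curvature with respect to $N$. The umbilic points are $p_1=(x_0,0,z_0)$, $p_2=(-x_0,0,z_0)$, $p_3=(-x_0,0,-z_0)$, $p_4=(x_0,0,-z_0)$ with $x_0=\sqrt{a(a-b)/(a-c)}$, $z_0=\sqrt{c(b-c)/(a-c)}$; they lie on the ellipse $\Sigma_{xz}=\mathbb{E}\cap\{y=0\}$. Put $H(x)=(x-a)(x-b)(x-c)$ and $$s_1(\alpha)=2\int_c^b\sin\alpha\,\sqrt{\frac{u}{H(u)}}\,du,\qquad s_2(\alpha)=2\int_b^a\cos\alpha\,\sqrt{\frac{v}{-H(v)}}\,dv,\qquad \rho(\alpha)=\frac{s_2(\alpha)}{s_1(\alpha)}.$$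 Let $w=a-(a-c)x^2/a$, the elliptic coordinate along $\Sigma_{xz}$ that varies when the other one equals $b$, and give $\Sigma_{xz}$ the length element $\sin|\alpha|\,\sqrt{w/H(w)}\,|dw|$ where $w<b$ and $\cos\alpha\,\sqrt{w/(-H(w))}\,|dw|$ where $w>b$. Then $s_1(|\alpha|)>0$ is the distance along $\Sigma_{xz}$ between the adjacent umbilic points $p_1,p_4$ (and between $p_2,p_3$), $s_2(|\alpha|)>0$ is the one between $p_1,p_2$ (and between $p_3,p_4$), and the total length is $2(s_1(|\alpha|)+s_2(|\alpha|))$. 1. Following leaves through one open half $\{y>0\}$ or $\{y<0\}$ of $\mathbb{E}$ until they return to $\Sigma_{xz}$ (arcs may begin or end at umbilic points; an umbilic point from which no leaf enters the half is fixed) defines a map $\Sigma_{xz}\to\Sigma_{xz}$ for each half. The Poincaré return map is the composition of the two maps: first the one of $\{y>0\}$ for the foliation of angle $|\alpha|$, first the one of $\{y<0\}$ for the foliation of angle $-|\alpha|$. For each of the two foliations it is, for the above length, the counterclockwise ($p_1,p_2,p_3,p_4$) rotation by $2s_2(|\alpha|)$; that is, a rotation with rotation number $$\frac{s_2(|\alpha|)}{s_1(|\alpha|)+s_2(|\alpha|)}=\frac{\rho(|\alpha|)}{1+\rho(|\alpha|)}\pmod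 1.$$ 2. If $\rho(\alpha)$ is irrational, all leaves of $\mathcal{F}_\alpha^+$ and $\mathcal{F}_\alpha^-$ are recurrent: every leaf is contained in its $\omega$-limit set or in its $\alpha$-limit set, and in both unless one of its ends tends to an umbilic point. 3. If $\rho(\alpha)$ is rational, all leaves of $\mathcal{F}_\alpha^+$ and $\mathcal{F}_\alpha^-$, except the umbilic separatrices (leaves with an end that tends to an umbilic point), are closed curves. -/

import Mathlib

open Set Filter Topology

noncomputable section

namespace EllipsoidFoliation

/-- Euclidean three-space. -/
abbrev E3 : Type := EuclideanSpace ℝ (Fin 3)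

/-- The vector product of `ℝ³`. -/
def cross (u v : E3) : E3 :=
  !₂[u 1 * v 2 - u 2 * v 1, u 2 * v 0 - u 0 * v 2, u 0 * v 1 - u 1 * v 0]

/-- The ellipsoid `x²/a + y²/b + z²/c = 1`. -/
def ellipsoid (a b c : ℝ) : Set E3 :=
  {p | p 0 ^ 2 / a + p 1 ^ 2 / b + p 2 ^ 2 / c = 1}

/-- Half the gradient of `x²/a + y²/b + z²/c`. -/
def halfGrad (a b c : ℝ) (p : E3) : E3 := !₂[p 0 / a, p 1 / b, p 2 / c]

/-- The inward unit normal field (it is defined near the ellipsoid, so it can be differentiated). -/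
def normal (a b c : ℝ) (p : E3) : E3 := -(‖halfGrad a b c p‖⁻¹ • halfGrad a b c p)

/-- `w` is tangent to the ellipsoid at its point `p`. -/
def IsTangent (a b c : ℝ) (p w : E3) : Prop := inner ℝ (normal a b c p) w = 0

/-- The shape operator `w ↦ -dN(w)` at `p` (used on tangent vectors). -/
def shape (a b c : ℝ) (p w : E3) : E3 := -(fderiv ℝ (normal a b c) p w)

/-- `e` is a principal direction at `p`, of principal curvature `k`. -/
def IsPrincipal (a b c : ℝ) (p : E3) (k : ℝ) (e : E3) : Prop :=
  IsTangent a b c p e ∧ e ≠ 0 ∧ shape a b c p e = k • e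

/-- Umbilic points: the shape operator is a multiple of the identity of the tangent plane. -/
def IsUmbilic (a b c : ℝ) (p : E3) : Prop :=
  p ∈ ellipsoid a b c ∧ ∃ k : ℝ, ∀ w, IsTangent a b c p w → shape a b c p w = k • w

/-- `e` is a unit vector tangent to the first principal foliation at `p`: its principal curvature
(with respect to the inward normal) is the largest one. At a point that is not umbilic, there are
exactly two such vectors, and they are opposite. -/
def IsFirstPrincipal (a b c : ℝ) (p e : E3) : Prop :=
  ‖e‖ = 1 ∧ ∃ k : ℝ, IsPrincipal a b c p k e ∧ ∀ k' e', IsPrincipal a b c p k' e' → k' ≤ k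

/-- On `I`, the curve `γ` runs with unit speed on the ellipsoid outside the umbilic points and makes
the oriented angle `θ` with the first principal foliation (up to orientation of the curve). -/
def IsAngleCurveOn (a b c θ : ℝ) (γ : ℝ → E3) (I : Set ℝ) : Prop :=
  ∀ t ∈ I, γ t ∈ ellipsoid a b c ∧ ¬ IsUmbilic a b c (γ t) ∧
    ∃ e, IsFirstPrincipal a b c (γ t) e ∧
      HasDerivAt γ (Real.cos θ • e + Real.sin θ • cross (normal a b c (γ t)) e) t

/-- `γ`, on the open interval `I`, is a unit speed parametrization of a leaf (a maximal curve) of the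
foliation whose leaves make the angle `θ` with the first principal foliation. -/
def IsLeaf (a b c θ : ℝ) (γ : ℝ → E3) (I : Set ℝ) : Prop :=
  IsOpen I ∧ I.OrdConnected ∧ I.Nonempty ∧ IsAngleCurveOn a b c θ γ I ∧
    ∀ (γ' : ℝ → E3) (J : Set ℝ), IsOpen J → J.OrdConnected → I ⊆ J → EqOn γ γ' I →
      IsAngleCurveOn a b c θ γ' J → J = I

/-- The filter of the right end of the interval `I`. -/
def rightEnd (I : Set ℝ) : Filter ℝ := ⨅ t ∈ I, 𝓟 (I ∩ Ici t)

/-- The filter of the left end of the interval `I`. -/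
def leftEnd (I : Set ℝ) : Filter ℝ := ⨅ t ∈ I, 𝓟 (I ∩ Iic t)

/-- The curve tends to an umbilic point along the end `l`. -/
def EndsAtUmbilic (a b c : ℝ) (γ : ℝ → E3) (l : Filter ℝ) : Prop :=
  ∃ p, IsUmbilic a b c p ∧ Tendsto γ l (𝓝 p)

/-- Umbilic separatrices: leaves one end of which tends to an umbilic point. -/
def IsUmbilicSeparatrix (a b c : ℝ) (γ : ℝ → E3) (I : Set ℝ) : Prop :=
  EndsAtUmbilic a b c γ (rightEnd I) ∨ EndsAtUmbilic a b c γ (leftEnd I)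

/-- The curve is contained in its limit set (ω- or α-limit set) along the end `l`. -/
def IsRecurrentAlong (γ : ℝ → E3) (I : Set ℝ) (l : Filter ℝ) : Prop :=
  γ '' I ⊆ {q | MapClusterPt q l γ}

/-- Recurrent leaves: the leaf is contained in its ω-limit set or in its α-limit set, and it is
contained in both unless one end of it tends to an umbilic point. -/
def IsRecurrent (a b c : ℝ) (γ : ℝ → E3) (I : Set ℝ) : Prop :=
  (IsRecurrentAlong γ I (rightEnd I) ∨ IsRecurrentAlong γ I (leftEnd I)) ∧
  (IsRecurrentAlong γ I (rightEnd I) ∨ EndsAtUmbilic a b c γ (rightEnd I)) ∧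
  (IsRecurrentAlong γ I (leftEnd I) ∨ EndsAtUmbilic a b c γ (leftEnd I))

/-- Closed leaves. -/
def IsClosedLeaf (γ : ℝ → E3) (I : Set ℝ) : Prop :=
  I = univ ∧ ∃ T : ℝ, 0 < T ∧ Function.Periodic γ T

/-- `H(x) = (x - a)(x - b)(x - c)`. -/
def H (a b c x : ℝ) : ℝ := (x - a) * (x - b) * (x - c)

/-- `s₁(α) = 2 ∫_c^b sin α √(u / H(u)) du` (here `H > 0`). -/
def s₁ (a b c α : ℝ) : ℝ := 2 * ∫ u in c..b, Real.sin α * √(u / H a b c u)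

/-- `s₂(α) = 2 ∫_b^a cos α √(v / (-H(v))) dv` (here `H < 0`). -/
def s₂ (a b c α : ℝ) : ℝ := 2 * ∫ v in b..a, Real.cos α * √(v / (-H a b c v))

/-- `ρ(α) = s₂(α) / s₁(α)`. -/
def rho (a b c α : ℝ) : ℝ := s₂ a b c α / s₁ a b c α

/-- The ellipse in which the plane `y = 0` cuts the ellipsoid. -/
def sigmaXZ (a b c : ℝ) : Set E3 := {p | p ∈ ellipsoid a b c ∧ p 1 = 0}

/-- The point of that ellipse of eccentric angle `φ`. -/
def ellipsePt (a c φ : ℝ) : E3 := !₂[√a * Real.cos φ, 0, √c * Real.sin φ]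

/-- At a point of the ellipse one of the two elliptic coordinates equals `b`; this is the other one
(it equals `a - (a - c) x² / a`), as a function of the eccentric angle. -/
def ellCoord (a c φ : ℝ) : ℝ := c * Real.cos φ ^ 2 + a * Real.sin φ ^ 2

/-- The length element used on the ellipse, as a multiple of `dφ`: it is
`dσ₁ = sin α √(u / H(u)) |du|` on the arcs on which the coordinate `u` lies in `(c, b)`, and
`dσ₂ = cos α √(v / (-H(v))) |dv|` on those on which the coordinate `v` lies in `(b, a)`. -/
def lengthElement (a b c α φ : ℝ) : ℝ :=
  (if ellCoord a c φ < b then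
      Real.sin α * √(ellCoord a c φ / H a b c (ellCoord a c φ))
    else Real.cos α * √(ellCoord a c φ / (-H a b c (ellCoord a c φ)))) *
  |deriv (ellCoord a c) φ|

/-- The points `(± x₀, 0, ± z₀)`, for signs `i, k = ± 1`. -/
def umbilicPt (a b c i k : ℝ) : E3 :=
  !₂[i * √(a * (a - b) / (a - c)), 0, k * √(c * (b - c) / (a - c))]

/-- `χ` is the counterclockwise length coordinate of the ellipse, with origin `p₁ = (x₀, 0, z₀)`,
divided by the total length `2 (s₁ + s₂)`; so the consecutive points `p₁`, `p₂`, `p₃`, `p₄` are at the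
distances `s₂`, `s₁`, `s₂`, and `p₄` is at the distance `s₁` from `p₁`. -/
def IsLengthCoord (a b c α : ℝ) (χ : sigmaXZ a b c → UnitAddCircle) : Prop :=
  (∀ (q r : sigmaXZ a b c) (φ ψ : ℝ), (q : E3) = ellipsePt a c φ → (r : E3) = ellipsePt a c ψ →
    χ r - χ q =
      (((∫ τ in φ..ψ, lengthElement a b c α τ) / (2 * (s₁ a b c α + s₂ a b c α)) : ℝ) :
        UnitAddCircle)) ∧
  (∀ q : sigmaXZ a b c,
    ((q : E3) = umbilicPt a b c 1 1 → χ q = 0) ∧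
    ((q : E3) = umbilicPt a b c (-1) 1 →
      χ q = ((s₂ a b c α / (2 * (s₁ a b c α + s₂ a b c α)) : ℝ) : UnitAddCircle)) ∧
    ((q : E3) = umbilicPt a b c (-1) (-1) →
      χ q = (((s₂ a b c α + s₁ a b c α) / (2 * (s₁ a b c α + s₂ a b c α)) : ℝ) :
        UnitAddCircle)) ∧
    ((q : E3) = umbilicPt a b c 1 (-1) →
      χ q = (((s₂ a b c α + s₁ a b c α + s₂ a b c α) /
        (2 * (s₁ a b c α + s₂ a b c α)) : ℝ) : UnitAddCircle)))

/-- There is an arc of a leaf from `q` to `q'` that runs, between its ends, in the half `y > 0` of the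
ellipsoid if `s = 1`, in the half `y < 0` if `s = -1`. The ends may be umbilic points. -/
def LeafArc (a b c θ s : ℝ) (q q' : E3) : Prop :=
  ∃ (T : ℝ) (γ : ℝ → E3), 0 < T ∧ ContinuousOn γ (Icc 0 T) ∧ γ 0 = q ∧ γ T = q' ∧
    IsAngleCurveOn a b c θ γ (Ioo 0 T) ∧ ∀ t ∈ Ioo 0 T, 0 < s * γ t 1

/-- `σ` is the map of the ellipse to itself that follows the leaves through one half of the ellipsoid
until they meet the ellipse again; an umbilic point from which no leaf runs into that half is fixed. -/
def IsHalfReturn (a b c θ s : ℝ) (σ : sigmaXZ a b c → sigmaXZ a b c) : Prop :=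
  (∀ q q' : sigmaXZ a b c, LeafArc a b c θ s q q' → σ q = q') ∧
  (∀ q : sigmaXZ a b c, (¬ ∃ q' : sigmaXZ a b c, LeafArc a b c θ s q q') →
    IsUmbilic a b c q ∧ σ q = q)

/-- `π` is the Poincaré return map of the foliation on the ellipse: one follows the leaf first through
the half of the ellipsoid given by `s`, then through the other half. -/
def IsPoincareMap (a b c θ s : ℝ) (π : sigmaXZ a b c → sigmaXZ a b c) : Prop :=
  ∃ σ τ : sigmaXZ a b c → sigmaXZ a b c,
    IsHalfReturn a b c θ s σ ∧ IsHalfReturn a b c θ (-s) τ ∧ π = τ ∘ σ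

end EllipsoidFoliation

end

open EllipsoidFoliation

/-! Elliptic coordinates turn the ellipsoid into a flat pillow on which the leaves are straight
lines. Let `u = conf b c p` in `[c, b]` and `v = conf b a q` in `[b, a]` be the confocal parameters
of a point, written with angles `p`, `q`. In these angles the metric is `(v - u) (dX² + dY²)`, where
`dX = √(u / (a - u)) dp` and `dY = √(v / (v - c)) dq` (`norm_sq_ellipticPtP`,
`norm_sq_ellipticPtQ`). The coordinate lines are lines of curvature, with curvatures proportional to
`1/u` and `1/v` (`shape_unitP`, `shape_unitQ`), so the first principal foliation is the horizontal
one. Angles are the Euclidean ones of the `(X, Y)` plane, hence a curve of constant angle `θ` is a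
line of direction `θ` there (`IsAngleCurveOn.exists_eq_lineCurve`).

Put `K₁ = halfPeriod b c a` and `K₂ = halfPeriod b a c`. The covering `flatPt` of the ellipsoid by
the plane is invariant under the translations by `(2 K₁, 0)` and `(0, 2 K₂)` and under `(X, Y) ↦
(-X, -Y)`. The umbilic points are the lattice points `(m K₁, n K₂)`, the ellipse `y = 0` is the grid
through them, and each half of the ellipsoid is an open rectangle of sides `K₁`, `K₂`.

Since `s₁ = 2 sin α K₁` and `s₂ = 2 cos α K₂`, the number `ρ` measures the direction of the lines
against the lattice. If it is irrational, a line meets at most one lattice point, so a leaf has at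
most one umbilic end; along an infinite end Dirichlet approximation brings the line back near each
of its points (`exists_return`). If it is rational, every line closes up, and a leaf without umbilic
end is a whole closed line.

For the return maps, the invariant `sin α X - cos α Y` of the lines is, on the sides of a rectangle,
an affine function of the length coordinate `χ` of the ellipse, with opposite signs on entry and
exit sides. Crossing a half is therefore a reflection `χ ↦ k - χ` (`IsSide.isHalfReturn`), with `k =
0` for `y > 0` and `k = s₂ / (s₁ + s₂)` for `y < 0`, and the two reflections compose to the
rotation. The mirror `y ↦ -y` gives the foliation of the opposite angle. -/

namespace EllipsoidFoliation

/-! ### Increasing primitives and their inverses (changes of time) -/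

/-- The primitive of `f` that vanishes at `0`. -/
noncomputable def prim (f : ℝ → ℝ) (x : ℝ) : ℝ := ∫ t in (0 : ℝ)..x, f t

/-- The inverse function of `prim f`. -/
noncomputable def primInv (f : ℝ → ℝ) : ℝ → ℝ := Function.invFun (prim f)

/-- `f` is continuous and its primitive is an increasing bijection of the line. -/
structure IsClock (f : ℝ → ℝ) : Prop where
  cont : Continuous f
  mono : StrictMono (prim f)
  surj : Function.Surjective (prim f)

@[simp] lemma prim_zero (f : ℝ → ℝ) : prim f 0 = 0 := by simp [prim]

lemma hasDerivAt_prim {f : ℝ → ℝ} (hf : Continuous f) (x : ℝ) : HasDerivAt (prim f) (f x) x :=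
  (hf.integral_hasStrictDerivAt 0 x).hasDerivAt

lemma continuous_prim {f : ℝ → ℝ} (hf : Continuous f) : Continuous (prim f) :=
  continuous_iff_continuousAt.2 fun x => (hasDerivAt_prim hf x).continuousAt

lemma prim_add {f : ℝ → ℝ} (hf : Continuous f) (x y : ℝ) :
    prim f (x + y) = prim f x + prim (fun t => f (x + t)) y := by
  unfold prim
  rw [intervalIntegral.integral_comp_add_left (fun t => f t), add_zero,
    intervalIntegral.integral_add_adjacent_intervals] <;> exact hf.intervalIntegrable _ _

lemma prim_neg (f : ℝ → ℝ) (x : ℝ) : prim f (-x) = -prim (fun t => f (-t)) x := by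
  unfold prim
  rw [intervalIntegral.integral_comp_neg (fun t => f t), neg_zero, intervalIntegral.integral_symm]

/-- A continuous `h ≥ 0` with countable zero set has positive integral over every interval, which
gives strict growth; its periodicity gives unbounded growth. The comparison is needed because the
conformal factor along a line of irrational slope is not periodic and may vanish at umbilic points.
-/
lemma isClock_of_le {f h : ℝ → ℝ} {T : ℝ} (hf : Continuous f) (hh : Continuous h)
    (h0 : ∀ t, 0 ≤ h t) (hle : ∀ t, h t ≤ f t) (hT : 0 < T) (hper : Function.Periodic h T)
    (hc : {t | h t = 0}.Countable) : IsClock f := by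
  have hpos : ∀ x y, x < y → 0 < ∫ t in x..y, h t := by
    intro x y hxy
    refine intervalIntegral.integral_pos hxy hh.continuousOn (fun t _ => h0 t) ?_
    obtain ⟨t, ht, ht'⟩ := (hc.dense_compl ℝ).exists_mem_open isOpen_Ioo (nonempty_Ioo.2 hxy)
    exact ⟨t, Ioo_subset_Icc_self ht', lt_of_le_of_ne (h0 t) (Ne.symm ht)⟩
  have hint : ∀ x y, x ≤ y → ∫ t in x..y, h t ≤ ∫ t in x..y, f t := fun x y hxy =>
    intervalIntegral.integral_mono_on hxy (hh.intervalIntegrable _ _) (hf.intervalIntegrable _ _)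
      fun t _ => hle t
  have hTpos := hpos 0 T hT
  refine ⟨hf, fun x y hxy => ?_, ?_⟩
  · have : prim f y - prim f x = ∫ t in x..y, f t :=
      intervalIntegral.integral_interval_sub_left (hf.intervalIntegrable _ _)
        (hf.intervalIntegrable _ _)
    have h1 := hpos x y hxy
    have h2 := hint x y hxy.le
    linarith
  · refine (continuous_prim hf).surjective ?_ ?_
    · refine tendsto_atTop_mono' _ ?_ (hper.tendsto_atTop_intervalIntegral_of_pos hTpos hT)
      filter_upwards [eventually_ge_atTop 0] with x hx
      exact hint 0 x hx
    · refine tendsto_atBot_mono' _ ?_ (hper.tendsto_atBot_intervalIntegral_of_pos hTpos hT)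
      filter_upwards [eventually_le_atBot 0] with x hx
      have := hint x 0 hx
      unfold prim
      rw [intervalIntegral.integral_symm x 0, intervalIntegral.integral_symm x 0]
      linarith

namespace IsClock

variable {f : ℝ → ℝ} (hf : IsClock f)
include hf

lemma primInv_prim (x : ℝ) : primInv f (prim f x) = x :=
  Function.leftInverse_invFun hf.mono.injective x

lemma prim_primInv (x : ℝ) : prim f (primInv f x) = x :=
  Function.rightInverse_invFun hf.surj x

lemma primInv_eq_iff {x y : ℝ} : primInv f x = y ↔ x = prim f y :=
  ⟨fun h => by rw [← h, hf.prim_primInv], fun h => by rw [h, hf.primInv_prim]⟩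

lemma primInv_zero : primInv f 0 = 0 := by rw [hf.primInv_eq_iff, prim_zero]

lemma primInv_strictMono : StrictMono (primInv f) := fun x y hxy => by
  rw [← hf.mono.lt_iff_lt, hf.prim_primInv, hf.prim_primInv]; exact hxy

lemma primInv_surjective : Function.Surjective (primInv f) := fun x => ⟨_, hf.primInv_prim x⟩

lemma continuous_primInv : Continuous (primInv f) :=
  hf.primInv_strictMono.monotone.continuous_of_surjective hf.primInv_surjective

lemma hasDerivAt_primInv {x : ℝ} (hx : f (primInv f x) ≠ 0) :
    HasDerivAt (primInv f) (f (primInv f x))⁻¹ x :=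
  HasDerivAt.of_local_left_inverse hf.continuous_primInv.continuousAt
    (hasDerivAt_prim hf.cont _) hx (Eventually.of_forall hf.prim_primInv)

lemma comp_add (x : ℝ) : IsClock fun t => f (x + t) := by
  have key : ∀ y, prim (fun t => f (x + t)) y = prim f (x + y) - prim f x := fun y => by
    rw [prim_add hf.cont]; ring
  refine ⟨hf.cont.comp (continuous_const.add continuous_id), fun y z h => ?_, fun y => ?_⟩
  · rw [key, key]
    have := hf.mono (add_lt_add_right h x)
    linarith
  · obtain ⟨z, hz⟩ := hf.surj (y + prim f x)
    exact ⟨z - x, by rw [key]; simp [hz]⟩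

/-- Restarting the clock at the moment `s`: this lets a unit speed curve be based at any of its
points. -/
lemma primInv_add (s r : ℝ) :
    primInv f (s + r) = primInv f s + primInv (fun t => f (primInv f s + t)) r := by
  rw [hf.primInv_eq_iff, prim_add hf.cont, hf.prim_primInv,
    (hf.comp_add _).prim_primInv]

lemma comp_neg : IsClock fun t => f (-t) := by
  have key : ∀ y, prim (fun t => f (-t)) y = -prim f (-y) := fun y => by rw [prim_neg]; simp
  refine ⟨hf.cont.comp continuous_neg, fun y z h => ?_, fun y => ?_⟩
  · rw [key, key]
    have := hf.mono (neg_lt_neg h)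
    linarith
  · obtain ⟨z, hz⟩ := hf.surj (-y)
    exact ⟨-z, by rw [key]; simp [hz]⟩

lemma primInv_comp_neg (s : ℝ) : primInv (fun t => f (-t)) s = -primInv f (-s) := by
  rw [hf.comp_neg.primInv_eq_iff]
  have := prim_neg f (primInv f (-s))
  rw [prim_neg]
  simp [hf.prim_primInv]

end IsClock

lemma prim_periodic_add {f : ℝ → ℝ} {T : ℝ} (hf : Continuous f) (hper : Function.Periodic f T)
    (x : ℝ) : prim f (T + x) = prim f T + prim f x := by
  rw [prim_add hf]
  congr 2
  ext t
  rw [add_comm]; exact hper t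

lemma prim_even {f : ℝ → ℝ} (heven : ∀ t, f (-t) = f t) (x : ℝ) : prim f (-x) = -prim f x := by
  rw [prim_neg]; simp [heven]

/-! ### The normal, the shape operator and the umbilic points -/

/-- The semi-axes are ordered, distinct and positive. -/
structure IsTriaxial (a b c : ℝ) : Prop where
  hab : b < a
  hbc : c < b
  hc : 0 < c

lemma IsTriaxial.ha {a b c : ℝ} (h : IsTriaxial a b c) : 0 < a := by
  linarith [h.hab, h.hbc, h.hc]

lemma IsTriaxial.hb {a b c : ℝ} (h : IsTriaxial a b c) : 0 < b := by
  linarith [h.hbc, h.hc]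

lemma IsTriaxial.hac {a b c : ℝ} (h : IsTriaxial a b c) : 0 < a - c := by
  linarith [h.hab, h.hbc]

lemma inner_eq (u v : E3) : inner ℝ u v = u 0 * v 0 + u 1 * v 1 + u 2 * v 2 := by
  simp [PiLp.inner_apply, Fin.sum_univ_three]; ring

lemma E3.ext {u v : E3} (h0 : u 0 = v 0) (h1 : u 1 = v 1) (h2 : u 2 = v 2) : u = v := by
  ext i; fin_cases i <;> assumption

lemma norm_sq_eq (u : E3) : ‖u‖ ^ 2 = u 0 ^ 2 + u 1 ^ 2 + u 2 ^ 2 := by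
  rw [← real_inner_self_eq_norm_sq, inner_eq]; ring

lemma norm_sq_cross (u v : E3) : ‖cross u v‖ ^ 2 = ‖u‖ ^ 2 * ‖v‖ ^ 2 - (inner ℝ u v) ^ 2 := by
  simp only [norm_sq_eq, inner_eq, cross]; simp; ring

lemma cross_smul_smul (r s : ℝ) (u v : E3) : cross (r • u) (s • v) = (r * s) • cross u v := by
  apply E3.ext <;> simp [cross] <;> ring

section Normal

variable {a b c : ℝ}

@[simp] lemma halfGrad_zero_coord (p : E3) : halfGrad a b c p 0 = p 0 / a := by simp [halfGrad]
@[simp] lemma halfGrad_one_coord (p : E3) : halfGrad a b c p 1 = p 1 / b := by simp [halfGrad]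
@[simp] lemma halfGrad_two_coord (p : E3) : halfGrad a b c p 2 = p 2 / c := by simp [halfGrad]

lemma halfGrad_add_smul (p w : E3) (t : ℝ) :
    halfGrad a b c (p + t • w) = halfGrad a b c p + t • halfGrad a b c w := by
  apply E3.ext <;> simp <;> ring

lemma hasDerivAt_halfGrad (p w : E3) :
    HasDerivAt (fun t : ℝ => halfGrad a b c (p + t • w)) (halfGrad a b c w) 0 := by
  simp only [halfGrad_add_smul]
  simpa using ((hasDerivAt_id (0 : ℝ)).smul_const (halfGrad a b c w)).const_add (halfGrad a b c p)

lemma differentiable_halfGrad : Differentiable ℝ (halfGrad a b c) := by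
  rw [differentiable_euclidean]
  intro i
  fin_cases i <;> simp <;> fun_prop

/-- `halfGrad` is linear, so differentiating `-g / ‖g‖` along the line `p + t w` only needs the
derivative of the norm; the second term comes from it and is normal to the surface. -/
lemma shape_eq {p : E3} (hg : halfGrad a b c p ≠ 0) (w : E3) :
    shape a b c p w = ‖halfGrad a b c p‖⁻¹ • halfGrad a b c w -
      (inner ℝ (halfGrad a b c p) (halfGrad a b c w) * ‖halfGrad a b c p‖⁻¹ ^ 3) •
        halfGrad a b c p := by
  have hdiff : DifferentiableAt ℝ (normal a b c) p := by
    have h1 : DifferentiableAt ℝ (halfGrad a b c) p := differentiable_halfGrad p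
    exact (((h1.norm ℝ hg).inv (norm_ne_zero_iff.2 hg)).smul h1).neg
  have hline : HasDerivAt (fun t : ℝ => p + t • w) w 0 := by
    simpa using ((hasDerivAt_id (0 : ℝ)).smul_const w).const_add p
  have h1 : HasDerivAt (fun t : ℝ => normal a b c (p + t • w)) (fderiv ℝ (normal a b c) p w) 0 :=
    hdiff.hasFDerivAt.comp_hasDerivAt_of_eq (0 : ℝ) hline (by simp)
  have hn : HasDerivAt (fun t : ℝ => ‖halfGrad a b c (p + t • w)‖)
      (inner ℝ (halfGrad a b c p) (halfGrad a b c w) * ‖halfGrad a b c p‖⁻¹) 0 := by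
    have h2 := (hasDerivAt_halfGrad (a := a) (b := b) (c := c) p w).norm_sq.sqrt (by simpa using hg)
    simp only [Real.sqrt_sq (norm_nonneg _)] at h2
    convert h2 using 1
    simp
    field_simp
  have h3 : HasDerivAt (fun t : ℝ => normal a b c (p + t • w))
      (-(‖halfGrad a b c p‖⁻¹ • halfGrad a b c w -
      (inner ℝ (halfGrad a b c p) (halfGrad a b c w) * ‖halfGrad a b c p‖⁻¹ ^ 3) •
        halfGrad a b c p)) 0 := by
    have h4 := ((hn.inv (by simpa using hg)).smul
      (hasDerivAt_halfGrad (a := a) (b := b) (c := c) p w)).neg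
    refine (h4.congr_deriv ?_)
    simp only [zero_smul, add_zero, sub_eq_add_neg, ← neg_smul]
    congr 3
    simp
    field_simp
  rw [shape, h1.unique h3, neg_neg]

lemma halfGrad_ne_zero (h : IsTriaxial a b c) {p : E3} (hp : p ∈ ellipsoid a b c) :
    halfGrad a b c p ≠ 0 := by
  intro h0
  have ha := h.ha
  have hb := h.hb
  have hc := h.hc
  have e0 := congrArg (fun x : E3 => x 0) h0
  have e1 := congrArg (fun x : E3 => x 1) h0
  have e2 := congrArg (fun x : E3 => x 2) h0
  simp [ha.ne', hb.ne', hc.ne'] at e0 e1 e2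
  simp [ellipsoid, e0, e1, e2] at hp

lemma isTangent_iff {p : E3} (hg : halfGrad a b c p ≠ 0) (w : E3) :
    IsTangent a b c p w ↔ inner ℝ (halfGrad a b c p) w = 0 := by
  simp [IsTangent, normal, inner_neg_left, inner_smul_left, hg]

lemma norm_normal {p : E3} (hg : halfGrad a b c p ≠ 0) : ‖normal a b c p‖ = 1 := by
  simp [normal, norm_smul, hg]

end Normal

lemma cross_expansion {n e : E3} (hn : ‖n‖ = 1) (he : ‖e‖ = 1) (hne : inner ℝ n e = 0) (w : E3) :
    w = inner ℝ n w • n + inner ℝ e w • e + inner ℝ (cross n e) w • cross n e := by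
  have hf : ‖cross n e‖ = 1 := by
    have := norm_sq_cross n e
    rw [hn, he, hne] at this
    nlinarith [norm_nonneg (cross n e)]
  have h1 : inner ℝ n (cross n e) = 0 := by simp [inner_eq, cross]; ring
  have h2 : inner ℝ e (cross n e) = 0 := by simp [inner_eq, cross]; ring
  have hon : Orthonormal ℝ ![n, e, cross n e] := by
    constructor
    · intro i; fin_cases i <;> simp [hn, he, hf]
    · intro i j hij
      fin_cases i <;> fin_cases j <;> simp_all [real_inner_comm]
  let B := (basisOfOrthonormalOfCardEqFinrank hon (by simp)).toOrthonormalBasis (by simpa using hon)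
  have := B.sum_repr' w
  rw [Fin.sum_univ_three] at this
  simp [B] at this
  exact this.symm

section

variable {a b c : ℝ}

/-- The normal term of `shape_eq` disappears against tangent vectors: up to the factor
`‖halfGrad‖⁻¹`, the second fundamental form is the diagonal form `1/a, 1/b, 1/c`. -/
lemma inner_shape {p : E3} (hg : halfGrad a b c p ≠ 0) {w' : E3} (w : E3)
    (hw' : IsTangent a b c p w') :
    inner ℝ w' (shape a b c p w) = ‖halfGrad a b c p‖⁻¹ * inner ℝ w' (halfGrad a b c w) := by
  rw [isTangent_iff hg] at hw'
  rw [shape_eq hg, inner_sub_right, inner_smul_right, inner_smul_right,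
    real_inner_comm (halfGrad a b c p) w', hw']
  simp

lemma umbilic_coord_aux (x z w w' i j r n : ℝ) (hn : n ≠ 0) (h1 : n ^ 2 = x ^ 2 + z ^ 2)
    (h2 : x * w + z * w' = 0) (h3 : z ^ 2 * i + x ^ 2 * j = n ^ 2 * r) :
    w * i - (x * (w * i) + z * (w' * j)) / n ^ 2 * x = r * w := by
  rw [sub_eq_iff_eq_add, div_mul_eq_mul_div, ← sub_eq_iff_eq_add', eq_div_iff (pow_ne_zero 2 hn)]
  linear_combination w * i * h1 - x * j * h2 + w * h3

lemma isUmbilic_of_coords (h : IsTriaxial a b c) {p : E3} (hp : p ∈ ellipsoid a b c)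
    (h1 : p 1 = 0) (h0 : p 0 ^ 2 = a * (a - b) / (a - c)) (h2 : p 2 ^ 2 = c * (b - c) / (a - c)) :
    IsUmbilic a b c p := by
  have ha := h.ha
  have hb := h.hb
  have hc := h.hc
  have hac := h.hac
  have hg := halfGrad_ne_zero h hp
  refine ⟨hp, ‖halfGrad a b c p‖⁻¹ * (1 / b), fun w hw => ?_⟩
  rw [isTangent_iff hg, inner_eq] at hw
  simp [h1] at hw
  have hn : ‖halfGrad a b c p‖ ≠ 0 := norm_ne_zero_iff.2 hg
  have hn2 : ‖halfGrad a b c p‖ ^ 2 = (p 0 / a) ^ 2 + (p 2 / c) ^ 2 := by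
    rw [norm_sq_eq]; simp [h1]
  have hrel : (p 2 / c) ^ 2 / a + (p 0 / a) ^ 2 / c = ‖halfGrad a b c p‖ ^ 2 / b := by
    rw [hn2, div_pow, div_pow, h0, h2]
    field_simp
    ring
  have hcoef : inner ℝ (halfGrad a b c p) (halfGrad a b c w) * ‖halfGrad a b c p‖⁻¹ ^ 3 =
      ‖halfGrad a b c p‖⁻¹ * ((p 0 / a * (w 0 / a) + p 2 / c * (w 2 / c)) /
        ‖halfGrad a b c p‖ ^ 2) := by
    rw [inner_eq]; simp [h1]; field_simp
  rw [shape_eq hg, hcoef, mul_smul, mul_smul, ← smul_sub]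
  congr 1
  apply E3.ext
  · simpa [div_eq_mul_inv] using umbilic_coord_aux (p 0 / a) (p 2 / c) (w 0) (w 2) a⁻¹ c⁻¹ b⁻¹
      ‖halfGrad a b c p‖ hn hn2 hw hrel
  · simp [h1]; ring
  · have := umbilic_coord_aux (p 2 / c) (p 0 / a) (w 2) (w 0) c⁻¹ a⁻¹ b⁻¹ ‖halfGrad a b c p‖ hn
      (by rw [hn2, add_comm]) (by linarith) (by rw [add_comm]; exact hrel)
    rw [add_comm (p 2 / c * (w 2 * c⁻¹))] at this
    simpa [div_eq_mul_inv] using this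

/-- At an umbilic point the form `diag(1/a, 1/b, 1/c)` is a multiple `l` of the metric on the
tangent plane. Testing it on the vector products of the gradient with the three axes gives six
equations. As `1/a < 1/b < 1/c`, they exclude `y ≠ 0` and then force `l = 1/b`; the ellipsoid
equation and the ratio of `x²` and `z²` finish. -/
lemma isUmbilic_iff (h : IsTriaxial a b c) {p : E3} (hp : p ∈ ellipsoid a b c) :
    IsUmbilic a b c p ↔ p 1 = 0 ∧ p 0 ^ 2 = a * (a - b) / (a - c) ∧
      p 2 ^ 2 = c * (b - c) / (a - c) := by
  have ha := h.ha
  have hb := h.hb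
  have hc := h.hc
  have hac := h.hac
  have hab := h.hab
  have hbc := h.hbc
  have hg := halfGrad_ne_zero h hp
  have hpe : p 0 ^ 2 / a + p 1 ^ 2 / b + p 2 ^ 2 / c = 1 := hp
  constructor
  · rintro ⟨-, k, hk⟩
    obtain ⟨l, hl⟩ : ∃ l, l = k * ‖halfGrad a b c p‖ := ⟨_, rfl⟩
    have key : ∀ w w' : E3, IsTangent a b c p w → IsTangent a b c p w' →
        inner ℝ w' (halfGrad a b c w) = l * inner ℝ w' w := by
      intro w w' hw hw'
      have h1 := inner_shape hg w hw'
      rw [hk w hw, inner_smul_right] at h1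
      have : ‖halfGrad a b c p‖ ≠ 0 := norm_ne_zero_iff.2 hg
      rw [hl]
      field_simp at h1
      linarith
    obtain ⟨x, hx⟩ : ∃ x, x = p 0 / a := ⟨_, rfl⟩
    obtain ⟨y, hy⟩ : ∃ y, y = p 1 / b := ⟨_, rfl⟩
    obtain ⟨z, hz⟩ : ∃ z, z = p 2 / c := ⟨_, rfl⟩
    have t0 : IsTangent a b c p !₂[0, z, -y] := by
      rw [isTangent_iff hg, inner_eq]; simp [hz, hy]; ring
    have t1 : IsTangent a b c p !₂[-z, 0, x] := by
      rw [isTangent_iff hg, inner_eq]; simp [hz, hx]; ring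
    have t2 : IsTangent a b c p !₂[y, -x, 0] := by
      rw [isTangent_iff hg, inner_eq]; simp [hx, hy]; ring
    have e01 := key _ _ t0 t1
    have e02 := key _ _ t0 t2
    have e12 := key _ _ t1 t2
    have e00 := key _ _ t0 t0
    have e11 := key _ _ t1 t1
    have e22 := key _ _ t2 t2
    simp only [inner_eq] at e01 e02 e12 e00 e11 e22
    simp at e01 e02 e12 e00 e11 e22
    have hia : 1 / a < 1 / b := one_div_lt_one_div_of_lt hb hab
    have hib : 1 / b < 1 / c := one_div_lt_one_div_of_lt hc hbc
    have f01 : (1 / c - l) * (x * y) = 0 := by linear_combination -e01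
    have f02 : (1 / b - l) * (x * z) = 0 := by linear_combination e02
    have f12 : (1 / a - l) * (y * z) = 0 := by linear_combination -e12
    have f00 : (1 / b - l) * z ^ 2 + (1 / c - l) * y ^ 2 = 0 := by linear_combination e00
    have f11 : (1 / a - l) * z ^ 2 + (1 / c - l) * x ^ 2 = 0 := by linear_combination e11
    have f22 : (1 / a - l) * y ^ 2 + (1 / b - l) * x ^ 2 = 0 := by linear_combination e22
    have hy0 : y = 0 := by
      by_contra hy0
      have hy2 : 0 < y ^ 2 := by positivity
      by_cases hx0 : x = 0
      · have : 1 / a - l = 0 := by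
          rw [hx0] at f22
          simpa [hy0] using f22
        nlinarith [sq_nonneg z]
      · have : 1 / c - l = 0 := by simpa [hx0, hy0] using f01
        have hx2 : 0 < x ^ 2 := by positivity
        nlinarith
    have hl' : 1 / b - l = 0 := by
      by_contra hne
      have hz0 : z = 0 := by
        have : (1 / b - l) * z ^ 2 = 0 := by rw [hy0] at f00; linarith
        exact pow_eq_zero_iff two_ne_zero |>.1 ((mul_eq_zero.1 this).resolve_left hne)
      have hx0 : x = 0 := by
        have : (1 / b - l) * x ^ 2 = 0 := by rw [hy0] at f22; linarith
        exact pow_eq_zero_iff two_ne_zero |>.1 ((mul_eq_zero.1 this).resolve_left hne)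
      apply hg
      apply E3.ext <;> simp [← hx, ← hy, ← hz, hx0, hy0, hz0]
    have hp1 : p 1 = 0 := by
      rw [hy0] at hy
      exact (div_eq_zero_iff.1 hy.symm).resolve_right hb.ne'
    have hp0' : p 0 = a * x := by rw [hx]; field_simp
    have hp2' : p 2 = c * z := by rw [hz]; field_simp
    have g1 : a * x ^ 2 + c * z ^ 2 = 1 := by
      rw [← hpe, hp1, hp0', hp2']; field_simp; ring
    have g2 : c * (b - a) * z ^ 2 + a * (b - c) * x ^ 2 = 0 := by
      have hll : l = 1 / b := by linarith
      rw [hll] at f11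
      field_simp at f11
      linear_combination f11
    refine ⟨hp1, ?_, ?_⟩
    · rw [eq_div_iff hac.ne', hp0']
      linear_combination a * (a - b) * g1 + a * g2
    · rw [eq_div_iff hac.ne', hp2']
      linear_combination c * (b - c) * g1 - c * g2
  · rintro ⟨h1, h0, h2⟩
    exact isUmbilic_of_coords h hp h1 h0 h2

lemma setOf_isUmbilic (h : IsTriaxial a b c) :
    {p | IsUmbilic a b c p} = {umbilicPt a b c 1 1, umbilicPt a b c (-1) 1,
      umbilicPt a b c (-1) (-1), umbilicPt a b c 1 (-1)} := by
  have ha := h.ha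
  have hb := h.hb
  have hc := h.hc
  have hac := h.hac
  have hab := sub_pos.2 h.hab
  have hbc := sub_pos.2 h.hbc
  have hX : 0 ≤ a * (a - b) / (a - c) := by positivity
  have hZ : 0 ≤ c * (b - c) / (a - c) := by positivity
  ext p
  have aux : IsUmbilic a b c p ↔ p 1 = 0 ∧ p 0 ^ 2 = a * (a - b) / (a - c) ∧
      p 2 ^ 2 = c * (b - c) / (a - c) := by
    constructor
    · intro hp; exact (isUmbilic_iff h hp.1).1 hp
    · rintro ⟨h1, h0, h2⟩
      refine (isUmbilic_iff h ?_).2 ⟨h1, h0, h2⟩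
      simp only [ellipsoid, mem_ofPred_eq, h1, h0, h2]
      field_simp
      ring
  have sq1 : ∀ {x y : ℝ}, 0 ≤ y → (x ^ 2 = y ↔ x = √y ∨ x = -√y) := fun {x y} hy => by
    rw [← sq_eq_sq_iff_eq_or_eq_neg, Real.sq_sqrt hy]
  simp only [mem_ofPred_eq, mem_insert_iff, mem_singleton_iff]
  rw [aux, sq1 hX, sq1 hZ]
  constructor
  · rintro ⟨h1, h0 | h0, h2 | h2⟩
    · left; apply E3.ext <;> simp [umbilicPt, h0, h1, h2]
    · right; right; right; apply E3.ext <;> simp [umbilicPt, h0, h1, h2]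
    · right; left; apply E3.ext <;> simp [umbilicPt, h0, h1, h2]
    · right; right; left; apply E3.ext <;> simp [umbilicPt, h0, h1, h2]
  · rintro (rfl | rfl | rfl | rfl) <;> simp [umbilicPt]

end

/-! ### Elliptic coordinates and the Liouville form of the metric -/

/-- The confocal parameter running between `b` (at `t = 0`) and `m` (at `t = π / 2`). -/
noncomputable def conf (b m t : ℝ) : ℝ := m * Real.sin t ^ 2 + b * Real.cos t ^ 2

lemma conf_eq_add (b m t : ℝ) : conf b m t = b + (m - b) * Real.sin t ^ 2 := by
  unfold conf; linear_combination b * Real.sin_sq_add_cos_sq t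

lemma conf_eq_add' (b m t : ℝ) : conf b m t = m + (b - m) * Real.cos t ^ 2 := by
  unfold conf; linear_combination m * Real.sin_sq_add_cos_sq t

/-- The factors left in the first and third coordinates once `cos q` and `cos p` are extracted. The
radicands never vanish, so the parametrization stays smooth across the umbilic points. -/
noncomputable def scaleX (a b c p : ℝ) : ℝ := √((a - conf b c p) / (a - c))

noncomputable def scaleZ (a b c q : ℝ) : ℝ := √((conf b a q - c) / (a - c))

/-- Elliptic coordinates, as a double covering of the ellipsoid by a torus, branched over the
umbilic points. -/
noncomputable def ellipticPt (a b c p q : ℝ) : E3 :=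
  -- The minus sign fixes the orientation: with it `cross normal unitP` is `unitQ` and not its
  -- opposite, so that `θ` is the oriented angle in the `(p, q)` plane.
  !₂[√a * Real.cos q * scaleX a b c p, -(√b * Real.sin p * Real.sin q),
    √c * Real.cos p * scaleZ a b c q]

/-- The derivative of `ellipticPt` in the first variable. -/
noncomputable def ellipticPtP (a b c p q : ℝ) : E3 :=
  !₂[√a * Real.cos q * ((b - c) * Real.sin p * Real.cos p / ((a - c) * scaleX a b c p)),
    -(√b * Real.cos p * Real.sin q), -(√c * Real.sin p * scaleZ a b c q)]

/-- The derivative of `ellipticPt` in the second variable. -/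
noncomputable def ellipticPtQ (a b c p q : ℝ) : E3 :=
  !₂[-(√a * Real.sin q * scaleX a b c p), -(√b * Real.sin p * Real.cos q),
    √c * Real.cos p * ((a - b) * Real.sin q * Real.cos q / ((a - c) * scaleZ a b c q))]

/-- The density of the flat coordinate with respect to the elliptic angle. -/
noncomputable def dens (b m k t : ℝ) : ℝ := √(conf b m t / |k - conf b m t|)

/-- The square root of the conformal factor `v - u`. -/
noncomputable def confFactor (a b c p q : ℝ) : ℝ := √(conf b a q - conf b c p)

section

variable {a b c : ℝ} (h : IsTriaxial a b c)
include h

lemma conf_sub_pos (p : ℝ) : 0 < a - conf b c p := by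
  rw [conf_eq_add]
  nlinarith [h.hab, h.hbc, sq_nonneg (Real.sin p)]

lemma conf_sub_pos' (q : ℝ) : 0 < conf b a q - c := by
  rw [conf_eq_add]
  nlinarith [h.hab, h.hbc, sq_nonneg (Real.sin q)]

lemma conf_pos (p : ℝ) : 0 < conf b c p := by
  rw [conf_eq_add']
  nlinarith [h.hc, h.hbc, sq_nonneg (Real.cos p)]

lemma conf_pos' (q : ℝ) : 0 < conf b a q := by linarith [conf_sub_pos' h q, h.hc]

lemma scaleX_pos (p : ℝ) : 0 < scaleX a b c p :=
  Real.sqrt_pos.2 (div_pos (conf_sub_pos h p) h.hac)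

lemma scaleZ_pos (q : ℝ) : 0 < scaleZ a b c q :=
  Real.sqrt_pos.2 (div_pos (conf_sub_pos' h q) h.hac)

lemma scaleX_sq (p : ℝ) : (a - c) * scaleX a b c p ^ 2 = a - conf b c p := by
  rw [scaleX, Real.sq_sqrt (div_pos (conf_sub_pos h p) h.hac).le]
  have := h.hac.ne'
  field_simp

lemma scaleZ_sq (q : ℝ) : (a - c) * scaleZ a b c q ^ 2 = conf b a q - c := by
  rw [scaleZ, Real.sq_sqrt (div_pos (conf_sub_pos' h q) h.hac).le]
  have := h.hac.ne'
  field_simp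

omit h in
lemma conf_sub_conf (p q : ℝ) : conf b a q - conf b c p =
    (a - b) * Real.sin q ^ 2 + (b - c) * Real.sin p ^ 2 := by
  rw [conf_eq_add, conf_eq_add]; ring

lemma conf_le_conf (p q : ℝ) : 0 ≤ conf b a q - conf b c p := by
  rw [conf_sub_conf]
  have := sub_pos.2 h.hab
  have := sub_pos.2 h.hbc
  positivity

lemma confFactor_sq (p q : ℝ) : confFactor a b c p q ^ 2 = conf b a q - conf b c p :=
  Real.sq_sqrt (conf_le_conf h p q)

lemma confFactor_eq_zero_iff (p q : ℝ) :
    confFactor a b c p q = 0 ↔ Real.sin p = 0 ∧ Real.sin q = 0 := by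
  have h1 := sub_pos.2 h.hab
  have h2 := sub_pos.2 h.hbc
  rw [confFactor, Real.sqrt_eq_zero (conf_le_conf h p q), conf_sub_conf,
    add_eq_zero_iff_of_nonneg (by positivity) (by positivity)]
  simp [h1.ne', h2.ne', and_comm]

lemma dens_sq (p : ℝ) : dens b c a p ^ 2 = conf b c p / (a - conf b c p) := by
  rw [dens, abs_of_pos (conf_sub_pos h p),
    Real.sq_sqrt (div_pos (conf_pos h p) (conf_sub_pos h p)).le]

lemma dens_sq' (q : ℝ) : dens b a c q ^ 2 = conf b a q / (conf b a q - c) := by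
  rw [dens, abs_sub_comm, abs_of_pos (conf_sub_pos' h q),
    Real.sq_sqrt (div_pos (conf_pos' h q) (conf_sub_pos' h q)).le]

lemma dens_pos (p : ℝ) : 0 < dens b c a p :=
  Real.sqrt_pos.2 (div_pos (conf_pos h p) (abs_pos.2 (conf_sub_pos h p).ne'))

lemma dens_pos' (q : ℝ) : 0 < dens b a c q := by
  rw [dens, abs_sub_comm]
  exact Real.sqrt_pos.2 (div_pos (conf_pos' h q) (abs_pos.2 (conf_sub_pos' h q).ne'))

lemma halfGrad_ellipticPt (p q : ℝ) : halfGrad a b c (ellipticPt a b c p q) =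
    !₂[Real.cos q * scaleX a b c p / √a, -(Real.sin p * Real.sin q / √b),
      Real.cos p * scaleZ a b c q / √c] := by
  have ha := Real.sqrt_pos.2 h.ha
  have hb := Real.sqrt_pos.2 h.hb
  have hc := Real.sqrt_pos.2 h.hc
  have ha' := Real.sq_sqrt h.ha.le
  have hb' := Real.sq_sqrt h.hb.le
  have hc' := Real.sq_sqrt h.hc.le
  apply E3.ext <;> simp [ellipticPt]
  · rw [div_eq_div_iff h.ha.ne' ha.ne']; linear_combination Real.cos q * scaleX a b c p * ha'
  · rw [neg_div, neg_inj, div_eq_div_iff h.hb.ne' hb.ne']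
    linear_combination Real.sin p * Real.sin q * hb'
  · rw [div_eq_div_iff h.hc.ne' hc.ne']; linear_combination Real.cos p * scaleZ a b c q * hc'

lemma elliptic_relation (p q : ℝ) : Real.cos q ^ 2 * scaleX a b c p ^ 2 +
    Real.sin p ^ 2 * Real.sin q ^ 2 + Real.cos p ^ 2 * scaleZ a b c q ^ 2 = 1 := by
  have hX := scaleX_sq h p
  have hZ := scaleZ_sq h q
  rw [conf_eq_add'] at hX
  rw [conf_eq_add] at hZ
  have h1 := Real.sin_sq_add_cos_sq p
  have h2 := Real.sin_sq_add_cos_sq q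
  refine mul_left_cancel₀ h.hac.ne' ?_
  have e1 : Real.sin p ^ 2 = 1 - Real.cos p ^ 2 := by linarith
  have e2 : Real.cos q ^ 2 = 1 - Real.sin q ^ 2 := by linarith
  rw [e1, e2]
  linear_combination (1 - Real.sin q ^ 2) * hX + Real.cos p ^ 2 * hZ

lemma ellipticPt_mem (p q : ℝ) : ellipticPt a b c p q ∈ ellipsoid a b c := by
  have := elliptic_relation h p q
  simp only [ellipsoid, mem_ofPred_eq, ellipticPt]
  simp [mul_pow, Real.sq_sqrt h.ha.le, Real.sq_sqrt h.hb.le, Real.sq_sqrt h.hc.le]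
  have ha := h.ha.ne'
  have hb := h.hb.ne'
  have hc := h.hc.ne'
  field_simp
  linarith

lemma inner_halfGrad_ellipticPtP (p q : ℝ) :
    inner ℝ (halfGrad a b c (ellipticPt a b c p q)) (ellipticPtP a b c p q) = 0 := by
  have hX := scaleX_pos h p
  have hZ := scaleZ_sq h q
  rw [conf_eq_add] at hZ
  have h2 := Real.sin_sq_add_cos_sq q
  have ha := Real.sqrt_pos.2 h.ha
  have hb := Real.sqrt_pos.2 h.hb
  have hc := Real.sqrt_pos.2 h.hc
  have hac := h.hac
  rw [halfGrad_ellipticPt h, inner_eq]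
  simp [ellipticPtP]
  field_simp
  linear_combination Real.cos p * Real.sin p * ((b - c) * h2 - hZ)

lemma inner_halfGrad_ellipticPtQ (p q : ℝ) :
    inner ℝ (halfGrad a b c (ellipticPt a b c p q)) (ellipticPtQ a b c p q) = 0 := by
  have hZ := scaleZ_pos h q
  have hX := scaleX_sq h p
  rw [conf_eq_add'] at hX
  have h1 := Real.sin_sq_add_cos_sq p
  have ha := Real.sqrt_pos.2 h.ha
  have hb := Real.sqrt_pos.2 h.hb
  have hc := Real.sqrt_pos.2 h.hc
  have hac := h.hac
  rw [halfGrad_ellipticPt h, inner_eq]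
  simp [ellipticPtQ]
  field_simp
  linear_combination Real.cos q * Real.sin q * ((a - c) * h1 - hX)

lemma inner_ellipticPtP_ellipticPtQ (p q : ℝ) :
    inner ℝ (ellipticPtP a b c p q) (ellipticPtQ a b c p q) = 0 := by
  have hX := scaleX_pos h p
  have hZ := scaleZ_pos h q
  have ha := Real.sq_sqrt h.ha.le
  have hb := Real.sq_sqrt h.hb.le
  have hc := Real.sq_sqrt h.hc.le
  have hac := h.hac
  rw [inner_eq]
  simp [ellipticPtP, ellipticPtQ]
  field_simp
  rw [ha, hb, hc]
  ring

lemma inner_halfGrad_self (p q : ℝ) :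
    inner ℝ (halfGrad a b c (ellipticPt a b c p q)) (ellipticPt a b c p q) = 1 := by
  have := ellipticPt_mem h p q
  rw [inner_eq]
  simp only [ellipsoid, mem_ofPred_eq] at this
  simp
  linear_combination this

/-- This and its companion for `q` are the Liouville form of the metric: apart from the common
factor `v - u`, the first coefficient depends on `p` alone and the second on `q` alone, so
integrating the densities gives isothermal coordinates. -/
lemma norm_sq_ellipticPtP (p q : ℝ) : ‖ellipticPtP a b c p q‖ ^ 2 =
    (confFactor a b c p q * dens b c a p) ^ 2 := by
  have hX := scaleX_pos h p
  have hX2 := scaleX_sq h p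
  have hZ2 := scaleZ_sq h q
  have h1 := Real.sin_sq_add_cos_sq p
  have h2 := Real.sin_sq_add_cos_sq q
  have ha := Real.sq_sqrt h.ha.le
  have hb := Real.sq_sqrt h.hb.le
  have hc := Real.sq_sqrt h.hc.le
  have hac := h.hac
  rw [mul_pow, confFactor_sq h, dens_sq h, ← hX2, norm_sq_eq]
  simp [ellipticPtP, mul_pow, div_pow, ha, hb, hc]
  rw [conf_eq_add] at hZ2 ⊢
  rw [conf_eq_add'] at hX2 ⊢
  field_simp
  have e1 : Real.sin p ^ 2 = 1 - Real.cos p ^ 2 := by linarith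
  have e2 : Real.cos q ^ 2 = 1 - Real.sin q ^ 2 := by linarith
  rw [e1, e2]
  generalize Real.sin q ^ 2 = s at *
  generalize Real.cos p ^ 2 = t at *
  generalize scaleX a b c p ^ 2 = X at *
  generalize scaleZ a b c q ^ 2 = Z at *
  grind

lemma norm_sq_ellipticPtQ (p q : ℝ) : ‖ellipticPtQ a b c p q‖ ^ 2 =
    (confFactor a b c p q * dens b a c q) ^ 2 := by
  have hX := scaleZ_pos h q
  have hX2 := scaleX_sq h p
  have hZ2 := scaleZ_sq h q
  have h1 := Real.sin_sq_add_cos_sq p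
  have h2 := Real.sin_sq_add_cos_sq q
  have ha := Real.sq_sqrt h.ha.le
  have hb := Real.sq_sqrt h.hb.le
  have hc := Real.sq_sqrt h.hc.le
  have hac := h.hac
  rw [mul_pow, confFactor_sq h, dens_sq' h, ← hZ2, norm_sq_eq]
  simp [ellipticPtQ, mul_pow, div_pow, ha, hb, hc]
  rw [conf_eq_add] at hZ2 ⊢
  rw [conf_eq_add'] at hX2 ⊢
  field_simp
  have e1 : Real.sin p ^ 2 = 1 - Real.cos p ^ 2 := by linarith
  have e2 : Real.cos q ^ 2 = 1 - Real.sin q ^ 2 := by linarith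
  rw [e1, e2]
  generalize Real.sin q ^ 2 = s at *
  generalize Real.cos p ^ 2 = t at *
  generalize scaleX a b c p ^ 2 = X at *
  generalize scaleZ a b c q ^ 2 = Z at *
  grind

lemma norm_ellipticPtP (p q : ℝ) : ‖ellipticPtP a b c p q‖ =
    confFactor a b c p q * dens b c a p :=
  (pow_left_inj₀ (norm_nonneg _) (mul_nonneg (Real.sqrt_nonneg _) (Real.sqrt_nonneg _))
    two_ne_zero).1 (norm_sq_ellipticPtP h p q)

lemma norm_ellipticPtQ (p q : ℝ) : ‖ellipticPtQ a b c p q‖ =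
    confFactor a b c p q * dens b a c q :=
  (pow_left_inj₀ (norm_nonneg _) (mul_nonneg (Real.sqrt_nonneg _) (Real.sqrt_nonneg _))
    two_ne_zero).1 (norm_sq_ellipticPtQ h p q)

/-- Differentiating the gradient along a coordinate line gives a multiple `1/u` of the velocity, up
to a normal term. This is what makes the coordinate lines principal, by `shape_of_halfGrad`. -/
lemma halfGrad_ellipticPtP (p q : ℝ) : halfGrad a b c (ellipticPtP a b c p q) =
    (conf b c p)⁻¹ • ellipticPtP a b c p q -
      ((b - c) * Real.sin p * Real.cos p / conf b c p) • halfGrad a b c (ellipticPt a b c p q) := by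
  have hX := scaleX_pos h p
  have hX2 := scaleX_sq h p
  have hu := conf_pos h p
  have ha := h.ha
  have hb := h.hb
  have hc := h.hc
  have hac := h.hac
  apply E3.ext
  · simp [ellipticPtP, ellipticPt]
    field_simp
    linear_combination (Real.sin p * Real.cos p * (b - c) * Real.cos q) * hX2
  · simp [ellipticPtP, ellipticPt]
    field_simp
    rw [conf_eq_add]; ring
  · simp [ellipticPtP, ellipticPt]
    field_simp
    rw [conf_eq_add']; ring

lemma halfGrad_ellipticPtQ (p q : ℝ) : halfGrad a b c (ellipticPtQ a b c p q) =
    (conf b a q)⁻¹ • ellipticPtQ a b c p q +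
      ((a - b) * Real.sin q * Real.cos q / conf b a q) • halfGrad a b c (ellipticPt a b c p q) := by
  have hX := scaleZ_pos h q
  have hX2 := scaleZ_sq h q
  have hu := conf_pos' h q
  have ha := h.ha
  have hb := h.hb
  have hc := h.hc
  have hac := h.hac
  apply E3.ext
  · simp [ellipticPtQ, ellipticPt]
    field_simp
    rw [conf_eq_add']; ring
  · simp [ellipticPtQ, ellipticPt]
    field_simp
    rw [conf_eq_add]; ring
  · simp [ellipticPtQ, ellipticPt]
    field_simp
    linear_combination (-Real.sin q * Real.cos q * (a - b) * Real.cos p) * hX2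

lemma cross_halfGrad_ellipticPtP (p q : ℝ) :
    cross (halfGrad a b c (ellipticPt a b c p q)) (ellipticPtP a b c p q) =
      -((conf b c p * scaleZ a b c q / (scaleX a b c p * √a * √b * √c)) •
        ellipticPtQ a b c p q) := by
  have hX := scaleX_pos h p
  have hX2 := scaleX_sq h p
  have hZ := scaleZ_pos h q
  have hac := h.hac
  have ha := Real.sqrt_pos.2 h.ha
  have hb := Real.sqrt_pos.2 h.hb
  have hc := Real.sqrt_pos.2 h.hc
  have ha' := Real.sq_sqrt h.ha.le
  have hb' := Real.sq_sqrt h.hb.le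
  have hc' := Real.sq_sqrt h.hc.le
  rw [halfGrad_ellipticPt h]
  have e1 := Real.sin_sq_add_cos_sq p
  apply E3.ext
  · simp [cross, ellipticPtP, ellipticPtQ]
    field_simp
    rw [hb', hc', conf]; ring
  · simp [cross, ellipticPtP, ellipticPtQ]
    field_simp
    rw [ha', hc']
    rw [conf_eq_add'] at hX2 ⊢
    linear_combination (c * Real.sin p * Real.cos q) * hX2
  · simp [cross, ellipticPtP, ellipticPtQ]
    field_simp
    rw [ha', hb']
    rw [conf_eq_add'] at hX2 ⊢
    generalize scaleX a b c p ^ 2 = X at *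
    grind

end

/-! ### Principal directions in elliptic coordinates -/

/-- The unit vector along the lines of the larger principal curvature. -/
noncomputable def unitP (a b c p q : ℝ) : E3 := ‖ellipticPtP a b c p q‖⁻¹ • ellipticPtP a b c p q

/-- The unit vector along the lines of the smaller principal curvature. -/
noncomputable def unitQ (a b c p q : ℝ) : E3 := ‖ellipticPtQ a b c p q‖⁻¹ • ellipticPtQ a b c p q

section

variable {a b c : ℝ} (h : IsTriaxial a b c)

lemma shape_add (p v w : E3) : shape a b c p (v + w) = shape a b c p v + shape a b c p w := by
  simp [shape, add_comm]

lemma shape_smul (p w : E3) (r : ℝ) : shape a b c p (r • w) = r • shape a b c p w := by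
  simp [shape]

lemma shape_of_halfGrad {p e : E3} (hg : halfGrad a b c p ≠ 0) {r s : ℝ}
    (he : inner ℝ (halfGrad a b c p) e = 0)
    (hD : halfGrad a b c e = r • e + s • halfGrad a b c p) :
    shape a b c p e = (‖halfGrad a b c p‖⁻¹ * r) • e := by
  have hn : ‖halfGrad a b c p‖ ≠ 0 := norm_ne_zero_iff.2 hg
  rw [shape_eq hg, hD, inner_add_right, inner_smul_right, inner_smul_right, he,
    real_inner_self_eq_norm_sq, smul_add, smul_smul, smul_smul]
  have : (r * 0 + s * ‖halfGrad a b c p‖ ^ 2) * ‖halfGrad a b c p‖⁻¹ ^ 3 =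
      ‖halfGrad a b c p‖⁻¹ * s := by field_simp; ring
  rw [this]; abel

include h

lemma ellipticPtP_ne_zero {p q : ℝ} (hF : 0 < confFactor a b c p q) :
    0 < ‖ellipticPtP a b c p q‖ := by
  rw [norm_ellipticPtP h]; exact mul_pos hF (dens_pos h p)

lemma ellipticPtQ_ne_zero {p q : ℝ} (hF : 0 < confFactor a b c p q) :
    0 < ‖ellipticPtQ a b c p q‖ := by
  rw [norm_ellipticPtQ h]; exact mul_pos hF (dens_pos' h q)

lemma norm_unitP {p q : ℝ} (hF : 0 < confFactor a b c p q) : ‖unitP a b c p q‖ = 1 := by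
  rw [unitP, norm_smul, norm_inv, norm_norm, inv_mul_cancel₀ (ellipticPtP_ne_zero h hF).ne']

lemma norm_unitQ {p q : ℝ} (hF : 0 < confFactor a b c p q) : ‖unitQ a b c p q‖ = 1 := by
  rw [unitQ, norm_smul, norm_inv, norm_norm, inv_mul_cancel₀ (ellipticPtQ_ne_zero h hF).ne']

lemma inner_unitP_unitQ (p q : ℝ) : inner ℝ (unitP a b c p q) (unitQ a b c p q) = 0 := by
  rw [unitP, unitQ, inner_smul_left, inner_smul_right, inner_ellipticPtP_ellipticPtQ h]; simp

/-- The vector product is a positive multiple of `ellipticPtQ` and has norm one, so the multiple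
need not be computed. -/
lemma cross_normal_unitP {p q : ℝ} (hF : 0 < confFactor a b c p q) :
    cross (normal a b c (ellipticPt a b c p q)) (unitP a b c p q) = unitQ a b c p q := by
  have hg := halfGrad_ne_zero h (ellipticPt_mem h p q)
  have hgn : 0 < ‖halfGrad a b c (ellipticPt a b c p q)‖ := norm_pos_iff.2 hg
  have hP := ellipticPtP_ne_zero h hF
  have hQ := ellipticPtQ_ne_zero h hF
  have hn : ‖cross (normal a b c (ellipticPt a b c p q)) (unitP a b c p q)‖ = 1 := by
    have h1 := norm_sq_cross (normal a b c (ellipticPt a b c p q)) (unitP a b c p q)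
    have h2 : inner ℝ (normal a b c (ellipticPt a b c p q)) (unitP a b c p q) = 0 := by
      rw [normal, unitP, inner_neg_left, inner_smul_left, inner_smul_right,
        inner_halfGrad_ellipticPtP h]
      simp
    rw [norm_normal hg, norm_unitP h hF, h2] at h1
    nlinarith [norm_nonneg (cross (normal a b c (ellipticPt a b c p q)) (unitP a b c p q))]
  have hu := conf_pos h p
  have hZ := scaleZ_pos h q
  have hX := scaleX_pos h p
  have ha := Real.sqrt_pos.2 h.ha
  have hb := Real.sqrt_pos.2 h.hb
  have hc := Real.sqrt_pos.2 h.hc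
  obtain ⟨r, hr, hrr⟩ : ∃ r : ℝ, 0 < r ∧
      cross (normal a b c (ellipticPt a b c p q)) (unitP a b c p q) =
        r • ellipticPtQ a b c p q := by
    refine ⟨‖halfGrad a b c (ellipticPt a b c p q)‖⁻¹ * ‖ellipticPtP a b c p q‖⁻¹ *
      (conf b c p * scaleZ a b c q / (scaleX a b c p * √a * √b * √c)), by positivity, ?_⟩
    rw [normal, unitP, ← neg_smul, cross_smul_smul, cross_halfGrad_ellipticPtP h, smul_neg,
      smul_smul, ← neg_smul]
    congr 1; ring
  rw [hrr] at hn ⊢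
  rw [norm_smul, Real.norm_of_nonneg hr.le] at hn
  rw [unitQ, eq_inv_of_mul_eq_one_left hn]

lemma shape_unitP (p q : ℝ) : shape a b c (ellipticPt a b c p q) (unitP a b c p q) =
    (‖halfGrad a b c (ellipticPt a b c p q)‖⁻¹ * (conf b c p)⁻¹) • unitP a b c p q := by
  have hg := halfGrad_ne_zero h (ellipticPt_mem h p q)
  rw [unitP, shape_smul, shape_of_halfGrad hg (inner_halfGrad_ellipticPtP h p q)
    ((halfGrad_ellipticPtP h p q).trans (by rw [sub_eq_add_neg, ← neg_smul])), smul_comm]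

lemma shape_unitQ (p q : ℝ) : shape a b c (ellipticPt a b c p q) (unitQ a b c p q) =
    (‖halfGrad a b c (ellipticPt a b c p q)‖⁻¹ * (conf b a q)⁻¹) • unitQ a b c p q := by
  have hg := halfGrad_ne_zero h (ellipticPt_mem h p q)
  rw [unitQ, shape_smul, shape_of_halfGrad hg (inner_halfGrad_ellipticPtQ h p q)
    (halfGrad_ellipticPtQ h p q), smul_comm]

lemma isTangent_unitP (p q : ℝ) :
    IsTangent a b c (ellipticPt a b c p q) (unitP a b c p q) := by
  rw [isTangent_iff (halfGrad_ne_zero h (ellipticPt_mem h p q)), unitP, inner_smul_right,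
    inner_halfGrad_ellipticPtP h, mul_zero]

lemma IsTangent.expansion {p q : ℝ} (hF : 0 < confFactor a b c p q) {w : E3}
    (hw : IsTangent a b c (ellipticPt a b c p q) w) :
    w = inner ℝ (unitP a b c p q) w • unitP a b c p q +
      inner ℝ (unitQ a b c p q) w • unitQ a b c p q := by
  have hg := halfGrad_ne_zero h (ellipticPt_mem h p q)
  have := cross_expansion (norm_normal hg) (norm_unitP h hF) (isTangent_unitP h p q) w
  rw [cross_normal_unitP h hF, show inner ℝ (normal a b c (ellipticPt a b c p q)) w = 0 from hw,
    zero_smul, zero_add] at this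
  exact this

/-- Off the umbilic points `u < v`, so the eigenvalues proportional to `1/u` and `1/v` differ, the
first being the larger; its eigenspace is a line with two unit vectors. -/
lemma isFirstPrincipal_iff {p q : ℝ} (hF : 0 < confFactor a b c p q) (e : E3) :
    IsFirstPrincipal a b c (ellipticPt a b c p q) e ↔
      e = unitP a b c p q ∨ e = -unitP a b c p q := by
  have hg := halfGrad_ne_zero h (ellipticPt_mem h p q)
  have hgn : 0 < ‖halfGrad a b c (ellipticPt a b c p q)‖ := norm_pos_iff.2 hg
  have hP1 := norm_unitP h hF
  have hQ1 := norm_unitQ h hF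
  have hPQ := inner_unitP_unitQ h p q
  have hQP : inner ℝ (unitQ a b c p q) (unitP a b c p q) = 0 := by rw [real_inner_comm]; exact hPQ
  have hP0 : unitP a b c p q ≠ 0 := fun h0 => by simp [h0] at hP1
  set k₁ := ‖halfGrad a b c (ellipticPt a b c p q)‖⁻¹ * (conf b c p)⁻¹ with hk₁
  set k₂ := ‖halfGrad a b c (ellipticPt a b c p q)‖⁻¹ * (conf b a q)⁻¹ with hk₂
  have hlt : k₂ < k₁ := by
    have := confFactor_sq h p q
    have : conf b c p < conf b a q := by nlinarith
    exact mul_lt_mul_of_pos_left (inv_strictAnti₀ (conf_pos h p) this) (inv_pos.2 hgn)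
  have key : ∀ k e', IsPrincipal a b c (ellipticPt a b c p q) k e' →
      (k = k₁ ∧ inner ℝ (unitQ a b c p q) e' = 0) ∨ k = k₂ := by
    rintro k e' ⟨ht, h0, hs⟩
    have hexp := IsTangent.expansion h hF ht
    set x := inner ℝ (unitP a b c p q) e'
    set y := inner ℝ (unitQ a b c p q) e'
    rw [hexp, shape_add, shape_smul, shape_smul, shape_unitP h, shape_unitQ h, ← hk₁, ← hk₂] at hs
    have hx := congrArg (fun w => inner ℝ (unitP a b c p q) w) hs
    have hy := congrArg (fun w => inner ℝ (unitQ a b c p q) w) hs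
    simp [inner_add_right, inner_smul_right, hPQ, hQP, hP1, hQ1] at hx hy
    by_cases hy0 : y = 0
    · left
      refine ⟨?_, hy0⟩
      have hx' : (k - k₁) * x = 0 := by linear_combination -hx
      rcases mul_eq_zero.1 hx' with hx | hx
      · linarith
      · exact absurd (by rw [hexp, hx, hy0]; simp) h0
    · right
      have hy' : (k - k₂) * y = 0 := by linear_combination -hy
      rcases mul_eq_zero.1 hy' with hy | hy
      · linarith
      · exact absurd hy hy0
  have hprin : IsPrincipal a b c (ellipticPt a b c p q) k₁ (unitP a b c p q) :=
    ⟨isTangent_unitP h p q, hP0, shape_unitP h p q⟩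
  constructor
  · rintro ⟨he1, k, hk, hmax⟩
    have hkk : k₁ ≤ k := hmax _ _ hprin
    rcases key k e hk with ⟨-, hy⟩ | hk2
    · have hexp := IsTangent.expansion h hF hk.1
      rw [hy, zero_smul, add_zero] at hexp
      have hn := congrArg norm hexp
      rw [norm_smul, hP1, he1, mul_one, Real.norm_eq_abs] at hn
      rcases eq_or_eq_neg_of_abs_eq hn.symm with hx | hx
      · left; rw [hexp, hx, one_smul]
      · right; rw [hexp, hx, neg_one_smul]
    · linarith
  · intro he
    have hle : ∀ k' e', IsPrincipal a b c (ellipticPt a b c p q) k' e' → k' ≤ k₁ := by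
      intro k' e' hk'
      rcases key k' e' hk' with ⟨h1, -⟩ | h1 <;> linarith
    rcases he with rfl | rfl
    · exact ⟨hP1, k₁, hprin, hle⟩
    · refine ⟨by rw [norm_neg, hP1], k₁, ⟨?_, neg_ne_zero.2 hP0, ?_⟩, hle⟩
      · have := isTangent_unitP h p q
        rw [IsTangent] at this ⊢
        rw [inner_neg_right, this, neg_zero]
      · rw [← neg_one_smul ℝ, shape_smul, shape_unitP h, smul_comm]

lemma isUmbilic_ellipticPt_iff (p q : ℝ) :
    IsUmbilic a b c (ellipticPt a b c p q) ↔ confFactor a b c p q = 0 := by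
  have hac := h.hac
  have hab := sub_pos.2 h.hab
  have hbc := sub_pos.2 h.hbc
  have ha := h.ha
  have hb := h.hb
  have hc := h.hc
  have hX2 := scaleX_sq h p
  have hZ2 := scaleZ_sq h q
  have h1 := Real.sin_sq_add_cos_sq p
  have h2 := Real.sin_sq_add_cos_sq q
  rw [isUmbilic_iff h (ellipticPt_mem h p q), confFactor_eq_zero_iff h]
  simp [ellipticPt, mul_pow, Real.sq_sqrt ha.le, Real.sq_sqrt hc.le, (Real.sqrt_pos.2 hb).ne']
  rw [eq_div_iff hac.ne', eq_div_iff hac.ne', mul_assoc, mul_comm (scaleX a b c p ^ 2), hX2,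
    mul_assoc (c * _), mul_comm (scaleZ a b c q ^ 2), hZ2]
  rw [conf_eq_add] at hX2 ⊢
  rw [conf_eq_add] at hZ2 ⊢
  constructor
  · rintro ⟨h0, hx, hz⟩
    have hx' : a * (Real.cos q ^ 2 * (a - (b + (c - b) * Real.sin p ^ 2))) = a * (a - b) := by
      rw [← hx]; ring
    have hx'' := mul_left_cancel₀ ha.ne' hx'
    rcases h0 with h0 | h0
    · refine ⟨h0, ?_⟩
      rw [h0] at hx''
      have : (a - b) * Real.sin q ^ 2 = 0 := by
        linear_combination (a - b) * h2 - hx''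
      simpa [hab.ne'] using this
    · refine ⟨?_, h0⟩
      rw [h0] at h2
      have : (b - c) * Real.sin p ^ 2 = 0 := by
        linear_combination hx'' - (a - (b + (c - b) * Real.sin p ^ 2)) * h2
      simpa [hbc.ne'] using this
  · rintro ⟨hp, hq⟩
    rw [hp] at h1 ⊢
    rw [hq] at h2 ⊢
    have e1 : Real.cos p ^ 2 = 1 := by linarith
    have e2 : Real.cos q ^ 2 = 1 := by linarith
    rw [e1, e2]
    exact ⟨by simp, by ring, by ring⟩

/-- The two confocal parameters of a point of the ellipsoid, from the squares of its coordinates. -/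
lemma exists_confocal {X Y Z : ℝ} (hX0 : 0 ≤ X) (hY0 : 0 ≤ Y) (hZ0 : 0 ≤ Z) (hsum : X + Y + Z = 1) :
    ∃ u v, c ≤ u ∧ u ≤ b ∧ b ≤ v ∧ v ≤ a ∧ (a - u) * (a - v) = X * ((a - b) * (a - c)) ∧
      (b - u) * (b - v) = -(Y * ((a - b) * (b - c))) ∧
      (u - c) * (v - c) = Z * ((a - c) * (b - c)) := by
  have hac := h.hac
  have hab := sub_pos.2 h.hab
  have hbc := sub_pos.2 h.hbc
  -- `S` is the sum of the roots and `D` the discriminant of the numerator of `X/(a-l) + Y/(b-l) +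
  -- Z/(c-l)`, to which the confocal equation reduces because `X + Y + Z = 1`. The values of this
  -- quadratic at `a`, `b`, `c` locate its roots `u`, `v`.
  obtain ⟨S, hS⟩ : ∃ S, S = X * (b + c) + Y * (a + c) + Z * (a + b) := ⟨_, rfl⟩
  obtain ⟨D, hD⟩ : ∃ D, D = S ^ 2 - 4 * (X * (b * c) + Y * (a * c) + Z * (a * b)) := ⟨_, rfl⟩
  have hYab : 0 ≤ Y * ((a - b) * (b - c)) := by positivity
  have hXab : 0 ≤ X * ((a - b) * (a - c)) := by positivity
  have hZab : 0 ≤ Z * ((a - c) * (b - c)) := by positivity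
  have hYeq : Y = 1 - X - Z := by linarith
  have hD0 : 0 ≤ D := by
    have : D = (S - 2 * b) ^ 2 + 4 * (Y * ((a - b) * (b - c))) := by
      rw [hD, hS, hYeq]; ring
    rw [this]; positivity
  have hsq := Real.sq_sqrt hD0
  have hsn := Real.sqrt_nonneg D
  obtain ⟨u, hu⟩ : ∃ u, u = (S - √D) / 2 := ⟨_, rfl⟩
  obtain ⟨v, hv⟩ : ∃ v, v = (S + √D) / 2 := ⟨_, rfl⟩
  have huv : u ≤ v := by rw [hu, hv]; linarith
  have hquad : ∀ l, (l - u) * (l - v) =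
      X * ((l - b) * (l - c)) + Y * ((l - a) * (l - c)) + Z * ((l - a) * (l - b)) := by
    intro l
    have : (l - u) * (l - v) = l ^ 2 - S * l + (S ^ 2 - √D ^ 2) / 4 := by rw [hu, hv]; ring
    rw [this, hsq, hD, hS, hYeq]; ring
  have qa : (a - u) * (a - v) = X * ((a - b) * (a - c)) := by rw [hquad]; ring
  have qb : (b - u) * (b - v) = -(Y * ((a - b) * (b - c))) := by rw [hquad]; ring
  have qc : (u - c) * (v - c) = Z * ((a - c) * (b - c)) := by
    have := hquad c
    linear_combination this
  have hub : u ≤ b := by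
    by_contra! hlt
    linarith [mul_pos_of_neg_of_neg (sub_neg.2 hlt) (sub_neg.2 (hlt.trans_le huv))]
  have hvb : b ≤ v := by
    by_contra! hlt
    linarith [mul_pos (sub_pos.2 (huv.trans_lt hlt)) (sub_pos.2 hlt)]
  have hcu : c ≤ u := by
    by_contra! hlt
    linarith [mul_neg_of_neg_of_pos (sub_neg.2 hlt) (show 0 < v - c by linarith)]
  have hva : v ≤ a := by
    by_contra! hlt
    linarith [mul_neg_of_pos_of_neg (show 0 < a - u by linarith) (sub_neg.2 hlt)]
  exact ⟨u, v, hcu, hub, hvb, hva, qa, qb, qc⟩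

/-- The parameters `u`, `v` and the signs of the first and third coordinates determine `cos p` and
`cos q`. Only the sign of the second coordinate is left, and it is set by choosing `q` or `-q`. -/
lemma exists_ellipticPt {x : E3} (hx : x ∈ ellipsoid a b c) :
    ∃ p q, ellipticPt a b c p q = x := by
  have hac := h.hac
  have hab := sub_pos.2 h.hab
  have hbc := sub_pos.2 h.hbc
  have ha := h.ha
  have hb := h.hb
  have hc := h.hc
  obtain ⟨X, hX⟩ : ∃ X, X = x 0 ^ 2 / a := ⟨_, rfl⟩
  obtain ⟨Y, hY⟩ : ∃ Y, Y = x 1 ^ 2 / b := ⟨_, rfl⟩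
  obtain ⟨Z, hZ⟩ : ∃ Z, Z = x 2 ^ 2 / c := ⟨_, rfl⟩
  have hX0 : 0 ≤ X := by rw [hX]; positivity
  have hY0 : 0 ≤ Y := by rw [hY]; positivity
  have hZ0 : 0 ≤ Z := by rw [hZ]; positivity
  have hsum : X + Y + Z = 1 := by rw [hX, hY, hZ]; exact hx
  obtain ⟨u, v, hcu, hub, hvb, hva, qa, qb, qc⟩ := exists_confocal h hX0 hY0 hZ0 hsum
  have hau : 0 < a - u := by linarith
  have hvc : 0 < v - c := by linarith
  have hR : 0 < √((a - u) / (a - c)) := Real.sqrt_pos.2 (div_pos hau hac)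
  have hT : 0 < √((v - c) / (a - c)) := Real.sqrt_pos.2 (div_pos hvc hac)
  have hR2 := Real.sq_sqrt (div_pos hau hac).le
  have hT2 := Real.sq_sqrt (div_pos hvc hac).le
  have hsa := Real.sqrt_pos.2 ha
  have hsc := Real.sqrt_pos.2 hc
  obtain ⟨s, hs⟩ : ∃ s, s = x 0 / (√a * √((a - u) / (a - c))) := ⟨_, rfl⟩
  obtain ⟨t, ht⟩ : ∃ t, t = x 2 / (√c * √((v - c) / (a - c))) := ⟨_, rfl⟩
  have hs2 : s ^ 2 * (a - b) = a - v := by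
    have e : s ^ 2 = X * (a - c) / (a - u) := by
      rw [hs, div_pow, mul_pow, hR2, Real.sq_sqrt ha.le, hX]
      field_simp
    rw [e]
    field_simp
    linear_combination -qa
  have ht2 : t ^ 2 * (b - c) = u - c := by
    have e : t ^ 2 = Z * (a - c) / (v - c) := by
      rw [ht, div_pow, mul_pow, hT2, Real.sq_sqrt hc.le, hZ]
      field_simp
    rw [e]
    field_simp
    linear_combination -qc
  have hs1 : |s| ≤ 1 := by
    rw [← sq_le_one_iff_abs_le_one]
    nlinarith
  have ht1 : |t| ≤ 1 := by
    rw [← sq_le_one_iff_abs_le_one]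
    nlinarith
  have cosq : Real.cos (Real.arccos s) = s := Real.cos_arccos (abs_le.1 hs1).1 (abs_le.1 hs1).2
  have cosp : Real.cos (Real.arccos t) = t := Real.cos_arccos (abs_le.1 ht1).1 (abs_le.1 ht1).2
  have confp : conf b c (Real.arccos t) = u := by
    rw [conf_eq_add', cosp]; linarith
  have confq : conf b a (Real.arccos s) = v := by
    rw [conf_eq_add', cosq]; linarith
  have confq' : conf b a (-Real.arccos s) = v := by
    rw [← confq, conf_eq_add', conf_eq_add', Real.cos_neg]
  have e0 : √a * s * √((a - u) / (a - c)) = x 0 := by rw [hs]; field_simp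
  have e2 : √c * t * √((v - c) / (a - c)) = x 2 := by rw [ht]; field_simp
  have e1 : (√b * Real.sin (Real.arccos t) * Real.sin (Real.arccos s)) ^ 2 = x 1 ^ 2 := by
    have hy : x 1 ^ 2 = b * Y := by rw [hY]; field_simp
    rw [mul_pow, mul_pow, Real.sq_sqrt hb.le, Real.sin_sq, Real.sin_sq, cosp, cosq, hy]
    have : ((1 - t ^ 2) * (1 - s ^ 2)) * ((a - b) * (b - c)) = Y * ((a - b) * (b - c)) := by
      have r1 : (1 - t ^ 2) * (b - c) = b - u := by linarith
      have r2 : (1 - s ^ 2) * (a - b) = v - b := by linarith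
      calc _ = ((1 - t ^ 2) * (b - c)) * ((1 - s ^ 2) * (a - b)) := by ring
        _ = _ := by rw [r1, r2]; linarith
    rw [mul_assoc, mul_right_cancel₀ (by positivity) this]
  rcases sq_eq_sq_iff_eq_or_eq_neg.1 e1 with e1 | e1
  · refine ⟨Real.arccos t, -Real.arccos s, ?_⟩
    apply E3.ext <;> simp [ellipticPt, scaleX, scaleZ, confp, confq', cosp, cosq, e0, e2, e1]
  · refine ⟨Real.arccos t, Real.arccos s, ?_⟩
    apply E3.ext <;> simp [ellipticPt, scaleX, scaleZ, confp, confq, cosp, cosq, e0, e2, e1]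

end

/-! ### Flat coordinates and their symmetries -/

/-- `b` lies strictly between `m` and `k`, and `b`, `m` are positive. -/
structure IsNode (b m k : ℝ) : Prop where
  hb : 0 < b
  hm : 0 < m
  hbetween : 0 < (b - m) * (k - b)

/-- The flat length of half a closed coordinate line. -/
noncomputable def halfPeriod (b m k : ℝ) : ℝ := prim (dens b m k) Real.pi

/-- The elliptic angle as a function of the flat coordinate. -/
noncomputable def ang (b m k : ℝ) : ℝ → ℝ := primInv (dens b m k)

lemma conf_add_pi (b m t : ℝ) : conf b m (t + Real.pi) = conf b m t := by simp [conf]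

lemma conf_neg (b m t : ℝ) : conf b m (-t) = conf b m t := by simp [conf]

lemma dens_periodic (b m k : ℝ) : Function.Periodic (dens b m k) Real.pi := fun t => by
  rw [dens, conf_add_pi, dens]

lemma dens_neg (b m k t : ℝ) : dens b m k (-t) = dens b m k t := by rw [dens, conf_neg, dens]

namespace IsNode

variable {b m k : ℝ} (hn : IsNode b m k)
include hn

lemma sub_ne : k - b ≠ 0 := fun h0 => by have := hn.hbetween; simp [h0] at this

lemma ne : b - m ≠ 0 := fun h0 => by have := hn.hbetween; simp [h0] at this

lemma conf_pos (t : ℝ) : 0 < conf b m t := by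
  have h1 := Real.sin_sq_add_cos_sq t
  rw [conf]
  rcases eq_or_ne (Real.sin t) 0 with h0 | h0
  · have : Real.cos t ^ 2 = 1 := by rw [h0] at h1; linarith
    rw [h0, this]; linarith [hn.hb]
  · have := hn.hb
    have := hn.hm
    positivity

lemma conf_ne (t : ℝ) : k - conf b m t ≠ 0 := by
  intro h0
  have h1 := hn.hbetween
  have h2 : (k - b) * (k - conf b m t) = (k - b) ^ 2 + (b - m) * (k - b) * Real.sin t ^ 2 := by
    rw [conf_eq_add]; ring
  have h3 : 0 < (k - b) ^ 2 := by have := hn.sub_ne; positivity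
  have h4 : 0 ≤ (b - m) * (k - b) * Real.sin t ^ 2 := mul_nonneg h1.le (sq_nonneg _)
  rw [h0] at h2
  linarith

lemma dens_pos (t : ℝ) : 0 < dens b m k t :=
  Real.sqrt_pos.2 (div_pos (hn.conf_pos t) (abs_pos.2 (hn.conf_ne t)))

lemma continuous_dens : Continuous (dens b m k) := by
  have h1 : Continuous (conf b m) := by unfold conf; fun_prop
  exact (h1.div (continuous_const.sub h1).abs fun t => abs_ne_zero.2 (hn.conf_ne t)).sqrt

lemma isClock : IsClock (dens b m k) :=
  isClock_of_le hn.continuous_dens hn.continuous_dens (fun t => (hn.dens_pos t).le)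
    (fun _ => le_rfl) Real.pi_pos (dens_periodic b m k)
    (by simp [(hn.dens_pos _).ne'])

lemma halfPeriod_pos : 0 < halfPeriod b m k := by
  have := hn.isClock.mono Real.pi_pos
  rwa [prim_zero] at this

lemma ang_zero : ang b m k 0 = 0 := hn.isClock.primInv_zero

lemma ang_strictMono : StrictMono (ang b m k) := hn.isClock.primInv_strictMono

lemma continuous_ang : Continuous (ang b m k) := hn.isClock.continuous_primInv

lemma ang_surjective : Function.Surjective (ang b m k) := hn.isClock.primInv_surjective

lemma ang_prim (t : ℝ) : ang b m k (prim (dens b m k) t) = t := hn.isClock.primInv_prim t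

lemma prim_ang (x : ℝ) : prim (dens b m k) (ang b m k x) = x := hn.isClock.prim_primInv x

lemma ang_neg (x : ℝ) : ang b m k (-x) = -ang b m k x := by
  rw [ang, hn.isClock.primInv_eq_iff, prim_even (dens_neg b m k)]
  rw [← ang, hn.prim_ang]

lemma ang_halfPeriod : ang b m k (halfPeriod b m k) = Real.pi := hn.ang_prim _

lemma ang_add_halfPeriod (x : ℝ) : ang b m k (x + halfPeriod b m k) = ang b m k x + Real.pi := by
  rw [ang, hn.isClock.primInv_eq_iff, add_comm _ Real.pi,
    prim_periodic_add hn.continuous_dens (dens_periodic b m k), ← ang, hn.prim_ang]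
  rw [halfPeriod, add_comm]

lemma ang_add_nat_mul (x : ℝ) (n : ℕ) :
    ang b m k (x + n * halfPeriod b m k) = ang b m k x + n * Real.pi := by
  induction n with
  | zero => simp
  | succ n ih =>
    rw [show x + ((n + 1 : ℕ) : ℝ) * halfPeriod b m k =
      (x + n * halfPeriod b m k) + halfPeriod b m k by push_cast; ring, hn.ang_add_halfPeriod, ih]
    push_cast; ring

lemma ang_add_int_mul (x : ℝ) (n : ℤ) :
    ang b m k (x + n * halfPeriod b m k) = ang b m k x + n * Real.pi := by
  obtain ⟨n, rfl | rfl⟩ := n.eq_nat_or_neg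
  · simpa using hn.ang_add_nat_mul x n
  · have := hn.ang_add_nat_mul (x + (-(n : ℤ) : ℤ) * halfPeriod b m k) n
    rw [show x + ((-(n : ℤ) : ℤ) : ℝ) * halfPeriod b m k + n * halfPeriod b m k = x by
      push_cast; ring] at this
    rw [this]; push_cast; ring

lemma sin_ang_eq_zero_iff {x : ℝ} :
    Real.sin (ang b m k x) = 0 ↔ ∃ n : ℤ, (n : ℝ) * halfPeriod b m k = x := by
  rw [Real.sin_eq_zero_iff]
  constructor
  · rintro ⟨n, hx⟩
    refine ⟨n, hn.ang_strictMono.injective ?_⟩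
    have := hn.ang_add_int_mul 0 n
    rw [zero_add, hn.ang_zero, zero_add] at this
    rw [this, hx]
  · rintro ⟨n, rfl⟩
    refine ⟨n, ?_⟩
    have := hn.ang_add_int_mul 0 n
    rw [zero_add, hn.ang_zero, zero_add] at this
    rw [this]

lemma countable_sin_ang : {x : ℝ | Real.sin (ang b m k x) = 0}.Countable := by
  refine (countable_range fun n : ℤ => (n : ℝ) * halfPeriod b m k).mono fun x hx => ?_
  exact hn.sin_ang_eq_zero_iff.1 hx

lemma sin_ang_pos {x : ℝ} (h0 : 0 < x) (h1 : x < halfPeriod b m k) :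
    0 < Real.sin (ang b m k x) := by
  refine Real.sin_pos_of_pos_of_lt_pi ?_ ?_
  · rw [← hn.ang_zero]; exact hn.ang_strictMono h0
  · rw [← hn.ang_halfPeriod]; exact hn.ang_strictMono h1

lemma sin_ang_neg {x : ℝ} (h0 : x < 0) (h1 : -halfPeriod b m k < x) :
    Real.sin (ang b m k x) < 0 := by
  have := hn.sin_ang_pos (x := -x) (by linarith) (by linarith)
  rw [hn.ang_neg, Real.sin_neg] at this
  linarith

lemma hasDerivAt_ang (x : ℝ) : HasDerivAt (ang b m k) (dens b m k (ang b m k x))⁻¹ x :=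
  hn.isClock.hasDerivAt_primInv (hn.dens_pos _).ne'

/-- The density is even with period `π`, so the integrals over the two halves of `[0, π]` agree. -/
lemma prim_half_pi : prim (dens b m k) (Real.pi / 2) = halfPeriod b m k / 2 := by
  have h1 := prim_periodic_add hn.continuous_dens (dens_periodic b m k) (-(Real.pi / 2))
  rw [prim_even (dens_neg b m k), show Real.pi + -(Real.pi / 2) = Real.pi / 2 by ring] at h1
  rw [halfPeriod]; linarith

end IsNode

section

variable {a b c : ℝ}

/-- The two coordinates obey one calculus with `a` and `c` exchanged; `b` is the value that both
parameters take at the umbilic points. -/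
lemma IsTriaxial.nodeP (h : IsTriaxial a b c) : IsNode b c a :=
  ⟨h.hb, h.hc, mul_pos (sub_pos.2 h.hbc) (sub_pos.2 h.hab)⟩

lemma IsTriaxial.nodeQ (h : IsTriaxial a b c) : IsNode b a c :=
  ⟨h.hb, h.ha, mul_pos_of_neg_of_neg (sub_neg.2 h.hab) (sub_neg.2 h.hbc)⟩

/-- The flat coordinates of the ellipsoid, as a branched covering by the plane. -/
noncomputable def flatPt (a b c X Y : ℝ) : E3 := ellipticPt a b c (ang b c a X) (ang b a c Y)

/-- The ratio of the length on the ellipsoid to the flat length. -/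
noncomputable def flatFactor (a b c X Y : ℝ) : ℝ := confFactor a b c (ang b c a X) (ang b a c Y)

lemma hasDerivAt_E3 {γ : ℝ → E3} {γ' : E3} {t : ℝ} :
    HasDerivAt γ γ' t ↔ ∀ i, HasDerivAt (fun s => γ s i) (γ' i) t := by
  rw [hasDerivAt_iff_hasFDerivAt, ← hasFDerivWithinAt_univ, hasFDerivWithinAt_euclidean]
  refine forall_congr' fun i => ?_
  rw [hasFDerivWithinAt_univ, hasDerivAt_iff_hasFDerivAt]
  have : PiLp.proj 2 (fun _ : Fin 3 => ℝ) i ∘SL ContinuousLinearMap.toSpanSingleton ℝ γ' =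
      ContinuousLinearMap.toSpanSingleton ℝ (γ' i) := by
    ext; simp
  rw [this]

lemma continuous_E3 {X : Type*} [TopologicalSpace X] {f : X → E3} (hf : ∀ i, Continuous fun x => f x i) :
    Continuous f :=
  (PiLp.continuous_toLp 2 _).comp (continuous_pi hf)

section
variable (h : IsTriaxial a b c)
include h

lemma contDiff_scaleX : ContDiff ℝ 1 (scaleX a b c) := by
  unfold scaleX
  refine ContDiff.sqrt ?_ fun p => (div_pos (conf_sub_pos h p) h.hac).ne'
  unfold conf
  fun_prop

lemma contDiff_scaleZ : ContDiff ℝ 1 (scaleZ a b c) := by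
  unfold scaleZ
  refine ContDiff.sqrt ?_ fun p => (div_pos (conf_sub_pos' h p) h.hac).ne'
  unfold conf
  fun_prop

omit h in
lemma hasDerivAt_conf (m t : ℝ) :
    HasDerivAt (conf b m) (-(2 * (b - m) * Real.sin t * Real.cos t)) t := by
  have := (((Real.hasDerivAt_sin t).pow 2).const_mul m).add
    (((Real.hasDerivAt_cos t).pow 2).const_mul b)
  refine this.congr_deriv ?_
  simp; ring

lemma hasDerivAt_scaleX (p : ℝ) : HasDerivAt (scaleX a b c)
    ((b - c) * Real.sin p * Real.cos p / ((a - c) * scaleX a b c p)) p := by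
  have h1 := (((hasDerivAt_conf c p).const_sub a).div_const (a - c)).sqrt
    (div_pos (conf_sub_pos h p) h.hac).ne'
  refine h1.congr_deriv ?_
  have hX := scaleX_pos h p
  have hac := h.hac
  rw [← scaleX]
  field_simp

lemma hasDerivAt_scaleZ (q : ℝ) : HasDerivAt (scaleZ a b c)
    ((a - b) * Real.sin q * Real.cos q / ((a - c) * scaleZ a b c q)) q := by
  have h1 := (((hasDerivAt_conf a q).sub_const c).div_const (a - c)).sqrt
    (div_pos (conf_sub_pos' h q) h.hac).ne'
  refine h1.congr_deriv ?_
  have hX := scaleZ_pos h q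
  have hac := h.hac
  rw [← scaleZ]
  field_simp
  ring

lemma hasDerivAt_ellipticPt {p q : ℝ → ℝ} {p' q' t : ℝ} (hp : HasDerivAt p p' t)
    (hq : HasDerivAt q q' t) : HasDerivAt (fun s => ellipticPt a b c (p s) (q s))
      (p' • ellipticPtP a b c (p t) (q t) + q' • ellipticPtQ a b c (p t) (q t)) t := by
  rw [hasDerivAt_E3]
  have hX := (hasDerivAt_scaleX h (p t)).comp t hp
  have hZ := (hasDerivAt_scaleZ h (q t)).comp t hq
  have hsp := hp.sin
  have hcp := hp.cos
  have hsq := hq.sin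
  have hcq := hq.cos
  intro i
  fin_cases i
  · refine ((hcq.const_mul √a).mul hX).congr_deriv ?_
    simp [ellipticPtP, ellipticPtQ]; ring
  · refine ((hsp.const_mul √b).mul hsq).neg.congr_deriv ?_
    simp [ellipticPtP, ellipticPtQ]; ring
  · refine ((hcp.const_mul √c).mul hZ).congr_deriv ?_
    simp [ellipticPtP, ellipticPtQ]; ring

lemma continuous_flatPt : Continuous fun z : ℝ × ℝ => flatPt a b c z.1 z.2 := by
  have h1 := (contDiff_scaleX h).continuous
  have h2 := (contDiff_scaleZ h).continuous
  have h3 := h.nodeP.continuous_ang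
  have h4 := h.nodeQ.continuous_ang
  refine continuous_E3 fun i => ?_
  fin_cases i <;> simp [flatPt, ellipticPt] <;> fun_prop

lemma continuous_flatFactor : Continuous fun z : ℝ × ℝ => flatFactor a b c z.1 z.2 := by
  have h3 := h.nodeP.continuous_ang
  have h4 := h.nodeQ.continuous_ang
  unfold flatFactor confFactor conf
  fun_prop

lemma continuous_flatPt_comp {T : Type*} [TopologicalSpace T] {X Y : T → ℝ} (hX : Continuous X)
    (hY : Continuous Y) : Continuous fun t => flatPt a b c (X t) (Y t) := by
  have h1 := Continuous.comp (g := fun z : ℝ × ℝ => flatPt a b c z.1 z.2) (continuous_flatPt h)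
    (hX.prodMk hY)
  exact h1

lemma continuous_flatFactor_comp {T : Type*} [TopologicalSpace T] {X Y : T → ℝ}
    (hX : Continuous X) (hY : Continuous Y) : Continuous fun t => flatFactor a b c (X t) (Y t) := by
  have h1 := Continuous.comp (g := fun z : ℝ × ℝ => flatFactor a b c z.1 z.2)
    (continuous_flatFactor h) (hX.prodMk hY)
  exact h1

/-- The deck transformation of the double covering of the ellipsoid by the torus: both sines change
sign in the second coordinate. It preserves the direction of every line and reverses its
orientation, which is why the foliation is well defined but unoriented. -/
lemma flatPt_neg (X Y : ℝ) : flatPt a b c (-X) (-Y) = flatPt a b c X Y := by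
  rw [flatPt, h.nodeP.ang_neg, h.nodeQ.ang_neg, flatPt]
  apply E3.ext <;> simp [ellipticPt, scaleX, scaleZ, conf_neg]

lemma flatFactor_neg (X Y : ℝ) : flatFactor a b c (-X) (-Y) = flatFactor a b c X Y := by
  rw [flatFactor, h.nodeP.ang_neg, h.nodeQ.ang_neg, flatFactor, confFactor, conf_neg, conf_neg,
    confFactor]

/-- The mirror `y ↦ -y` is `Y ↦ -Y` in the plane, so it exchanges the directions `θ` and `-θ`. -/
lemma flatPt_neg_right (X Y : ℝ) : flatPt a b c X (-Y) =
    !₂[flatPt a b c X Y 0, -flatPt a b c X Y 1, flatPt a b c X Y 2] := by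
  rw [flatPt, h.nodeQ.ang_neg, flatPt]
  apply E3.ext <;> simp [ellipticPt, scaleZ, conf_neg]

lemma flatPt_add_halfPeriods (X Y : ℝ) :
    flatPt a b c (X + halfPeriod b c a) (Y + halfPeriod b a c) =
      !₂[-flatPt a b c X Y 0, flatPt a b c X Y 1, -flatPt a b c X Y 2] := by
  rw [flatPt, h.nodeP.ang_add_halfPeriod, h.nodeQ.ang_add_halfPeriod, flatPt]
  apply E3.ext <;> simp [ellipticPt, scaleX, scaleZ, conf_add_pi]

lemma flatPt_add_periods (X Y : ℝ) (m n : ℤ) :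
    flatPt a b c (X + 2 * m * halfPeriod b c a) (Y + 2 * n * halfPeriod b a c) =
      flatPt a b c X Y := by
  have e1 : (2 : ℝ) * m = ((2 * m : ℤ) : ℝ) := by push_cast; ring
  have e2 : (2 : ℝ) * n = ((2 * n : ℤ) : ℝ) := by push_cast; ring
  have e3 : (m : ℝ) * (2 * Real.pi) = 2 * m * Real.pi := by ring
  rw [flatPt, e1, e2, h.nodeP.ang_add_int_mul, h.nodeQ.ang_add_int_mul, flatPt]
  have f1 : ∀ t, t + ((2 * m : ℤ) : ℝ) * Real.pi = t + m * (2 * Real.pi) := fun t => by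
    push_cast; ring
  have f2 : ∀ t, t + ((2 * n : ℤ) : ℝ) * Real.pi = t + n * (2 * Real.pi) := fun t => by
    push_cast; ring
  rw [f1, f2]
  apply E3.ext <;> simp [ellipticPt, scaleX, scaleZ, conf, Real.sin_add_int_mul_two_pi, Real.cos_add_int_mul_two_pi]

lemma flatFactor_eq_zero_iff {X Y : ℝ} : flatFactor a b c X Y = 0 ↔
    (∃ m : ℤ, (m : ℝ) * halfPeriod b c a = X) ∧ ∃ n : ℤ, (n : ℝ) * halfPeriod b a c = Y := by
  rw [flatFactor, confFactor_eq_zero_iff h, h.nodeP.sin_ang_eq_zero_iff,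
    h.nodeQ.sin_ang_eq_zero_iff]

lemma flatFactor_add_periods (X Y : ℝ) (m n : ℤ) :
    flatFactor a b c (X + 2 * m * halfPeriod b c a) (Y + 2 * n * halfPeriod b a c) =
      flatFactor a b c X Y := by
  have e1 : (2 : ℝ) * m = ((2 * m : ℤ) : ℝ) := by push_cast; ring
  have e2 : (2 : ℝ) * n = ((2 * n : ℤ) : ℝ) := by push_cast; ring
  rw [flatFactor, e1, e2, h.nodeP.ang_add_int_mul, h.nodeQ.ang_add_int_mul, flatFactor]
  have f1 : ∀ t, t + ((2 * m : ℤ) : ℝ) * Real.pi = t + m * (2 * Real.pi) := fun t => by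
    push_cast; ring
  have f2 : ∀ t, t + ((2 * n : ℤ) : ℝ) * Real.pi = t + n * (2 * Real.pi) := fun t => by
    push_cast; ring
  rw [f1, f2]
  simp [confFactor, conf, Real.sin_add_int_mul_two_pi, Real.cos_add_int_mul_two_pi]

lemma isUmbilic_flatPt_iff (X Y : ℝ) : IsUmbilic a b c (flatPt a b c X Y) ↔
    flatFactor a b c X Y = 0 := isUmbilic_ellipticPt_iff h _ _

lemma flatPt_mem (X Y : ℝ) : flatPt a b c X Y ∈ ellipsoid a b c := ellipticPt_mem h _ _

lemma exists_flatPt {x : E3} (hx : x ∈ ellipsoid a b c) : ∃ X Y, flatPt a b c X Y = x := by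
  obtain ⟨p, q, hpq⟩ := exists_ellipticPt h hx
  obtain ⟨X, rfl⟩ := h.nodeP.ang_surjective p
  obtain ⟨Y, rfl⟩ := h.nodeQ.ang_surjective q
  exact ⟨X, Y, hpq⟩

/-- The coordinates are isothermal: the flat velocity is carried to the frame `unitP`, `unitQ` and
scaled by `flatFactor`. -/
lemma hasDerivAt_flatPt {X Y : ℝ → ℝ} {X' Y' t : ℝ} (hX : HasDerivAt X X' t)
    (hY : HasDerivAt Y Y' t) (hF : 0 < flatFactor a b c (X t) (Y t)) :
    HasDerivAt (fun s => flatPt a b c (X s) (Y s))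
      ((X' * flatFactor a b c (X t) (Y t)) • unitP a b c (ang b c a (X t)) (ang b a c (Y t)) +
        (Y' * flatFactor a b c (X t) (Y t)) • unitQ a b c (ang b c a (X t)) (ang b a c (Y t))) t := by
  have h1 := hasDerivAt_ellipticPt h ((h.nodeP.hasDerivAt_ang (X t)).comp t hX)
    ((h.nodeQ.hasDerivAt_ang (Y t)).comp t hY)
  refine h1.congr_deriv ?_
  have d1 := h.nodeP.dens_pos (ang b c a (X t))
  have d2 := h.nodeQ.dens_pos (ang b a c (Y t))
  rw [flatFactor] at hF ⊢
  simp only [Function.comp, unitP, unitQ, norm_ellipticPtP h, norm_ellipticPtQ h, smul_smul]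
  congr 2 <;> field_simp

end

end

/-! ### Straight lines of the flat plane, run at unit speed on the ellipsoid -/

/-- The conformal ratio along a straight line of direction `θ` in the flat coordinates. -/
noncomputable def lineFactor (a b c θ X Y τ : ℝ) : ℝ :=
  flatFactor a b c (X + τ * Real.cos θ) (Y + τ * Real.sin θ)

/-- The flat length as a function of the length along such a line. -/
noncomputable def lineTime (a b c θ X Y : ℝ) : ℝ → ℝ := primInv (lineFactor a b c θ X Y)

/-- The unit speed curve that is a straight line of direction `θ` in the flat coordinates; it goes
straight on through umbilic points. -/
noncomputable def lineCurve (a b c θ X Y s : ℝ) : E3 :=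
  flatPt a b c (X + lineTime a b c θ X Y s * Real.cos θ) (Y + lineTime a b c θ X Y s * Real.sin θ)

section

variable {a b c : ℝ} (h : IsTriaxial a b c)
include h

/-- Dropping the `q` part of `v - u` leaves a lower bound that depends on `X` only. Since `cos θ >
0`, `X` runs uniformly through the line, and the bound is periodic with period `K₁ / cos θ` and
vanishes only where `sin p = 0`. -/
lemma isClock_lineFactor {θ : ℝ} (hθ : 0 < Real.cos θ) (X Y : ℝ) :
    IsClock (lineFactor a b c θ X Y) := by
  have h3 := h.nodeP.continuous_ang
  have hbc := sub_pos.2 h.hbc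
  have hab := sub_pos.2 h.hab
  have hF : Continuous (lineFactor a b c θ X Y) := by
    exact continuous_flatFactor_comp h (by fun_prop) (by fun_prop)
  refine isClock_of_le (h := fun τ => √((b - c) * Real.sin (ang b c a (X + τ * Real.cos θ)) ^ 2))
    (T := halfPeriod b c a / Real.cos θ) hF (by fun_prop) (fun τ => Real.sqrt_nonneg _)
    (fun τ => ?_) (div_pos h.nodeP.halfPeriod_pos hθ) (fun τ => ?_) ?_
  · refine Real.sqrt_le_sqrt ?_
    rw [conf_sub_conf]
    have : 0 ≤ (a - b) * Real.sin (ang b a c (Y + τ * Real.sin θ)) ^ 2 := by positivity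
    linarith
  · have : X + (τ + halfPeriod b c a / Real.cos θ) * Real.cos θ =
        X + τ * Real.cos θ + halfPeriod b c a := by field_simp; ring
    simp only [this, h.nodeP.ang_add_halfPeriod, Real.sin_add_pi, neg_sq]
  · have hinj : Function.Injective fun τ => X + τ * Real.cos θ := fun x y hxy => by
      simpa [hθ.ne'] using hxy
    refine (h.nodeP.countable_sin_ang.preimage hinj).mono fun τ hτ => ?_
    have hτ' : (b - c) * Real.sin (ang b c a (X + τ * Real.cos θ)) ^ 2 ≤ 0 := Real.sqrt_eq_zero'.1 hτ
    have : Real.sin (ang b c a (X + τ * Real.cos θ)) ^ 2 ≤ 0 := by nlinarith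
    exact pow_eq_zero_iff two_ne_zero |>.1 (le_antisymm this (sq_nonneg _))

lemma lineTime_zero {θ : ℝ} (hθ : 0 < Real.cos θ) (X Y : ℝ) : lineTime a b c θ X Y 0 = 0 :=
  (isClock_lineFactor h hθ X Y).primInv_zero

lemma lineCurve_zero {θ : ℝ} (hθ : 0 < Real.cos θ) (X Y : ℝ) :
    lineCurve a b c θ X Y 0 = flatPt a b c X Y := by
  simp [lineCurve, lineTime_zero h hθ]

lemma continuous_lineTime {θ : ℝ} (hθ : 0 < Real.cos θ) (X Y : ℝ) :
    Continuous (lineTime a b c θ X Y) := (isClock_lineFactor h hθ X Y).continuous_primInv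

lemma lineTime_strictMono {θ : ℝ} (hθ : 0 < Real.cos θ) (X Y : ℝ) :
    StrictMono (lineTime a b c θ X Y) := (isClock_lineFactor h hθ X Y).primInv_strictMono

lemma continuous_lineCurve {θ : ℝ} (hθ : 0 < Real.cos θ) (X Y : ℝ) :
    Continuous (lineCurve a b c θ X Y) := by
  have h1 := continuous_lineTime h hθ X Y
  exact continuous_flatPt_comp h (by fun_prop) (by fun_prop)

lemma lineCurve_add {θ : ℝ} (hθ : 0 < Real.cos θ) (X Y s r : ℝ) :
    lineCurve a b c θ X Y (s + r) =
      lineCurve a b c θ (X + lineTime a b c θ X Y s * Real.cos θ)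
        (Y + lineTime a b c θ X Y s * Real.sin θ) r := by
  have h1 := (isClock_lineFactor h hθ X Y).primInv_add s r
  have h2 : (fun t => lineFactor a b c θ X Y (primInv (lineFactor a b c θ X Y) s + t)) =
      lineFactor a b c θ (X + lineTime a b c θ X Y s * Real.cos θ)
        (Y + lineTime a b c θ X Y s * Real.sin θ) := by
    ext t
    simp only [lineFactor, lineTime]
    congr 1 <;> ring
  rw [h2] at h1
  rw [lineCurve, lineCurve, lineTime, h1, ← lineTime, ← lineTime]
  congr 1 <;> ring

/-- The deck transformation reverses the line, so a curve run backwards is again a `lineCurve` of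
the same `θ`. -/
lemma lineCurve_neg {θ : ℝ} (hθ : 0 < Real.cos θ) (X Y s : ℝ) :
    lineCurve a b c θ (-X) (-Y) s = lineCurve a b c θ X Y (-s) := by
  have h1 := (isClock_lineFactor h hθ X Y).primInv_comp_neg s
  have h2 : (fun t => lineFactor a b c θ X Y (-t)) = lineFactor a b c θ (-X) (-Y) := by
    ext t
    simp only [lineFactor]
    rw [← flatFactor_neg h]
    congr 1 <;> ring
  rw [h2] at h1
  rw [lineCurve, lineTime, h1, ← lineTime, ← flatPt_neg h, lineCurve]
  congr 1 <;> ring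

lemma hasDerivAt_lineCurve {θ : ℝ} (hθ : 0 < Real.cos θ) (X Y s : ℝ)
    (hF : 0 < lineFactor a b c θ X Y (lineTime a b c θ X Y s)) :
    HasDerivAt (lineCurve a b c θ X Y)
      (Real.cos θ • unitP a b c (ang b c a (X + lineTime a b c θ X Y s * Real.cos θ))
          (ang b a c (Y + lineTime a b c θ X Y s * Real.sin θ)) +
        Real.sin θ • unitQ a b c (ang b c a (X + lineTime a b c θ X Y s * Real.cos θ))
          (ang b a c (Y + lineTime a b c θ X Y s * Real.sin θ))) s := by
  have h1 := (isClock_lineFactor h hθ X Y).hasDerivAt_primInv hF.ne'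
  have h2 := hasDerivAt_flatPt h ((h1.mul_const (Real.cos θ)).const_add X)
    ((h1.mul_const (Real.sin θ)).const_add Y) hF
  refine h2.congr_deriv ?_
  rw [lineTime, lineFactor] at hF
  simp only [lineFactor, lineTime]
  congr 2 <;> field_simp

lemma isAngleCurveOn_lineCurve {θ : ℝ} (hθ : 0 < Real.cos θ) (X Y : ℝ) {t₀ : ℝ} {I : Set ℝ}
    (hI : ∀ t ∈ I, lineFactor a b c θ X Y (lineTime a b c θ X Y (t - t₀)) ≠ 0) :
    IsAngleCurveOn a b c θ (fun t => lineCurve a b c θ X Y (t - t₀)) I := by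
  intro t ht
  have hF : 0 < lineFactor a b c θ X Y (lineTime a b c θ X Y (t - t₀)) :=
    lt_of_le_of_ne (Real.sqrt_nonneg _) (hI t ht).symm
  refine ⟨flatPt_mem h _ _, ?_, _, (isFirstPrincipal_iff h hF _).2 (Or.inl rfl), ?_⟩
  · beta_reduce; rw [lineCurve, isUmbilic_flatPt_iff h]; exact hF.ne'
  · have h1 := (hasDerivAt_lineCurve h hθ X Y _ hF).comp_sub_const t t₀
    beta_reduce
    rw [lineCurve, flatPt, cross_normal_unitP h hF]
    exact h1

/-! ### Local lifts; curves of constant angle are straight lines -/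

/-- The cone over the ellipsoid, in elliptic coordinates and the radial one. -/
noncomputable def coneMap (a b c : ℝ) (z : ℝ × ℝ × ℝ) : E3 := z.2.2 • ellipticPt a b c z.1 z.2.1

omit h in
lemma smul_mem_ellipsoid {r : ℝ} {x : E3} (hx : x ∈ ellipsoid a b c)
    (hr : r • x ∈ ellipsoid a b c) : r ^ 2 = 1 := by
  simp only [ellipsoid, mem_ofPred_eq] at hx hr
  simp at hr
  linear_combination hr - r ^ 2 * hx

lemma contDiff_coneMap : ContDiff ℝ 1 (coneMap a b c) := by
  have h1 := contDiff_scaleX h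
  have h2 := contDiff_scaleZ h
  have h3 : ContDiff ℝ 1 fun z : ℝ × ℝ × ℝ => scaleX a b c z.1 := h1.comp contDiff_fst
  have h4 : ContDiff ℝ 1 fun z : ℝ × ℝ × ℝ => scaleZ a b c z.2.1 :=
    h2.comp (contDiff_fst.comp contDiff_snd)
  rw [contDiff_euclidean]
  intro i
  fin_cases i <;> simp [coneMap, ellipticPt] <;> fun_prop

lemma fderiv_coneMap (p q : ℝ) (w : ℝ × ℝ × ℝ) :
    fderiv ℝ (coneMap a b c) (p, q, 1) w = w.1 • ellipticPtP a b c p q +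
      w.2.1 • ellipticPtQ a b c p q + w.2.2 • ellipticPt a b c p q := by
  have hd : HasFDerivAt (coneMap a b c) (fderiv ℝ (coneMap a b c) (p, q, 1)) (p, q, 1) :=
    ((contDiff_coneMap h).differentiable one_ne_zero _).hasFDerivAt
  have l1 : ∀ x y : ℝ, HasDerivAt (fun t : ℝ => x + t * y) y 0 := fun x y => by
    simpa using ((hasDerivAt_id (0 : ℝ)).mul_const y).const_add x
  have hline : HasDerivAt (fun t : ℝ => (p + t * w.1, q + t * w.2.1, 1 + t * w.2.2)) w 0 :=
    (l1 p w.1).prodMk ((l1 q w.2.1).prodMk (l1 1 w.2.2))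
  have h1 := hd.comp_hasDerivAt_of_eq (0 : ℝ) hline (by simp)
  have h2 := (l1 1 w.2.2).smul (hasDerivAt_ellipticPt h (l1 p w.1) (l1 q w.2.1))
  have h3 := h1.unique h2
  rw [h3]
  simp

/-- The radial variable makes the covering a map between spaces of equal dimension, to which the
inverse function theorem applies. Pairing with the gradient separates the radial direction from the
tangent plane, where the other two derivatives are orthogonal and nonzero. -/
lemma exists_equiv_fderiv_coneMap {p q : ℝ} (hF : 0 < confFactor a b c p q) :
    ∃ f' : (ℝ × ℝ × ℝ) ≃L[ℝ] E3, HasFDerivAt (coneMap a b c) (f' : (ℝ × ℝ × ℝ) →L[ℝ] E3)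
      (p, q, 1) := by
  have hd : HasFDerivAt (coneMap a b c) (fderiv ℝ (coneMap a b c) (p, q, 1)) (p, q, 1) :=
    ((contDiff_coneMap h).differentiable one_ne_zero _).hasFDerivAt
  have hinj : Function.Injective (fderiv ℝ (coneMap a b c) (p, q, 1)).toLinearMap := by
    rw [← LinearMap.ker_eq_bot, LinearMap.ker_eq_bot']
    intro w hw
    have hw' : fderiv ℝ (coneMap a b c) (p, q, 1) w = 0 := hw
    rw [fderiv_coneMap h] at hw'
    have e1 := congrArg (fun x => inner ℝ (halfGrad a b c (ellipticPt a b c p q)) x) hw'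
    simp only [inner_add_right, inner_smul_right, inner_halfGrad_ellipticPtP h,
      inner_halfGrad_ellipticPtQ h, inner_halfGrad_self h, inner_zero_right, mul_zero, mul_one,
      zero_add] at e1
    rw [e1, zero_smul, add_zero] at hw'
    have e2 : inner ℝ (ellipticPtP a b c p q) _ = inner ℝ (ellipticPtP a b c p q) _ :=
      congrArg _ hw'
    have e3 : inner ℝ (ellipticPtQ a b c p q) _ = inner ℝ (ellipticPtQ a b c p q) _ :=
      congrArg _ hw'
    have hP := ellipticPtP_ne_zero h hF
    have hQ := ellipticPtQ_ne_zero h hF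
    rw [inner_zero_right, inner_add_right, inner_smul_right, inner_smul_right,
      inner_ellipticPtP_ellipticPtQ h, real_inner_self_eq_norm_sq, mul_zero, add_zero] at e2
    rw [inner_zero_right, inner_add_right, inner_smul_right, inner_smul_right, real_inner_comm,
      inner_ellipticPtP_ellipticPtQ h, real_inner_self_eq_norm_sq, mul_zero, zero_add] at e3
    exact Prod.ext ((mul_eq_zero.1 e2).resolve_right (pow_pos hP 2).ne')
      (Prod.ext ((mul_eq_zero.1 e3).resolve_right (pow_pos hQ 2).ne') e1)
  let e := LinearEquiv.ofInjectiveOfFinrankEq _ hinj (by simp)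
  refine ⟨e.toContinuousLinearEquiv, ?_⟩
  have : (e.toContinuousLinearEquiv : (ℝ × ℝ × ℝ) →L[ℝ] E3) =
      fderiv ℝ (coneMap a b c) (p, q, 1) := ContinuousLinearMap.ext fun _ => rfl
  rw [this]; exact hd

end

section

variable {a b c : ℝ} (h : IsTriaxial a b c)
include h

/-- Away from the umbilic points, curves on the ellipsoid lift to elliptic coordinates. -/
lemma exists_local_lift {γ : ℝ → E3} {t₁ p₀ q₀ : ℝ} (hF : 0 < confFactor a b c p₀ q₀)
    (hγ₁ : γ t₁ = ellipticPt a b c p₀ q₀)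
    (hγ : ∀ᶠ t in 𝓝 t₁, γ t ∈ ellipsoid a b c ∧ DifferentiableAt ℝ γ t) :
    ∃ p q : ℝ → ℝ, p t₁ = p₀ ∧ q t₁ = q₀ ∧ ∀ᶠ t in 𝓝 t₁,
      γ t = ellipticPt a b c (p t) (q t) ∧ DifferentiableAt ℝ p t ∧ DifferentiableAt ℝ q t := by
  obtain ⟨f', hf'⟩ := exists_equiv_fderiv_coneMap h hF
  have hC : ContDiffAt ℝ 1 (coneMap a b c) (p₀, q₀, 1) := (contDiff_coneMap h).contDiffAt
  have hz : coneMap a b c (p₀, q₀, 1) = γ t₁ := by simp [coneMap, hγ₁]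
  have hL := hC.to_localInverse hf' one_ne_zero
  have hL0 := hC.localInverse_apply_image hf' one_ne_zero
  have hR : ∀ᶠ y in 𝓝 (coneMap a b c (p₀, q₀, 1)),
      coneMap a b c (hC.localInverse hf' one_ne_zero y) = y :=
    (hC.hasStrictFDerivAt' hf' one_ne_zero).eventually_right_inverse
  set L := hC.localInverse hf' one_ne_zero with hLdef
  rw [hz] at hL hL0 hR
  have hcont : ContinuousAt γ t₁ := hγ.self_of_nhds.2.continuousAt
  have hLd : ∀ᶠ y in 𝓝 (γ t₁), DifferentiableAt ℝ L y :=
    (hL.eventually (by simp)).mono fun y hy => hy.differentiableAt one_ne_zero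
  have hLc : ContinuousAt (fun t => (L (γ t)).2.2) t₁ := by
    have := hL.continuousAt.comp hcont
    exact (continuous_snd.comp continuous_snd).continuousAt.comp this
  have hpos : ∀ᶠ t in 𝓝 t₁, 0 < (L (γ t)).2.2 :=
    hLc.eventually_const_lt (by beta_reduce; rw [hL0]; exact one_pos)
  refine ⟨fun t => (L (γ t)).1, fun t => (L (γ t)).2.1, by simp [hL0], by simp [hL0], ?_⟩
  filter_upwards [hγ, hpos, hcont.eventually hLd, hcont.eventually hR] with t ht hr hd hy
  have hdz : DifferentiableAt ℝ (fun t => L (γ t)) t := hd.comp t ht.2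
  refine ⟨?_, hdz.fst, hdz.snd.fst⟩
  have hmem := ht.1
  rw [← hy, coneMap] at hmem
  -- Staying on the ellipsoid forces `r² = 1`; continuity from `r = 1` at `t₁` excludes `r = -1`.
  have hr1 : (L (γ t)).2.2 = 1 := by
    have := smul_mem_ellipsoid (ellipticPt_mem h _ _) hmem
    nlinarith
  rw [coneMap, hr1, one_smul] at hy
  exact hy.symm

/-- The sign `ε` belongs to the single time `t`: the unit vector `e` of an angle curve is chosen at
each point, with no continuity required. -/
lemma angle_velocity {γ : ℝ → E3} {I : Set ℝ} {θ t : ℝ} (hγ : IsAngleCurveOn a b c θ γ I)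
    (ht : t ∈ I) {p q : ℝ → ℝ} (heq : ∀ᶠ s in 𝓝 t, γ s = ellipticPt a b c (p s) (q s))
    (hp : DifferentiableAt ℝ p t) (hq : DifferentiableAt ℝ q t) :
    0 < confFactor a b c (p t) (q t) ∧ ∃ ε : ℝ, (ε = 1 ∨ ε = -1) ∧
      deriv p t * (confFactor a b c (p t) (q t) * dens b c a (p t)) = ε * Real.cos θ ∧
      deriv q t * (confFactor a b c (p t) (q t) * dens b a c (q t)) = ε * Real.sin θ := by
  obtain ⟨-, hu, e, he, hd⟩ := hγ t ht
  have heqt := heq.self_of_nhds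
  rw [heqt] at hu he hd
  rw [isUmbilic_ellipticPt_iff h] at hu
  have hF : 0 < confFactor a b c (p t) (q t) := lt_of_le_of_ne (Real.sqrt_nonneg _) (Ne.symm hu)
  refine ⟨hF, ?_⟩
  have hd2 := hasDerivAt_ellipticPt h hp.hasDerivAt hq.hasDerivAt
  have hvel := hd.unique (hd2.congr_of_eventuallyEq heq)
  have hP := ellipticPtP_ne_zero h hF
  have hQ := ellipticPtQ_ne_zero h hF
  have hPe : ellipticPtP a b c (p t) (q t) =
      ‖ellipticPtP a b c (p t) (q t)‖ • unitP a b c (p t) (q t) := by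
    rw [unitP, smul_smul, mul_inv_cancel₀ hP.ne', one_smul]
  have hQe : ellipticPtQ a b c (p t) (q t) =
      ‖ellipticPtQ a b c (p t) (q t)‖ • unitQ a b c (p t) (q t) := by
    rw [unitQ, smul_smul, mul_inv_cancel₀ hQ.ne', one_smul]
  obtain ⟨ε, hε, hee⟩ : ∃ ε : ℝ, (ε = 1 ∨ ε = -1) ∧ e = ε • unitP a b c (p t) (q t) := by
    rcases (isFirstPrincipal_iff h hF e).1 he with h1 | h1
    · exact ⟨1, Or.inl rfl, by simpa using h1⟩
    · exact ⟨-1, Or.inr rfl, by simpa using h1⟩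
  have hcr : cross (normal a b c (ellipticPt a b c (p t) (q t))) e =
      ε • unitQ a b c (p t) (q t) := by
    have := cross_smul_smul 1 ε (normal a b c (ellipticPt a b c (p t) (q t)))
      (unitP a b c (p t) (q t))
    rw [one_smul, one_mul, cross_normal_unitP h hF] at this
    rw [hee, this]
  rw [hcr, hee, hPe, hQe, norm_ellipticPtP h, norm_ellipticPtQ h] at hvel
  have hPQ := inner_unitP_unitQ h (p t) (q t)
  have hQP : inner ℝ (unitQ a b c (p t) (q t)) (unitP a b c (p t) (q t)) = 0 := by
    rw [real_inner_comm]; exact hPQ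
  have e1 : inner ℝ (unitP a b c (p t) (q t)) _ = inner ℝ (unitP a b c (p t) (q t)) _ :=
    congrArg _ hvel
  have e2 : inner ℝ (unitQ a b c (p t) (q t)) _ = inner ℝ (unitQ a b c (p t) (q t)) _ :=
    congrArg _ hvel
  simp only [inner_add_right, inner_smul_right, hPQ, hQP, real_inner_self_eq_norm_sq,
    norm_unitP h hF, norm_unitQ h hF] at e1 e2
  refine ⟨ε, hε, ?_, ?_⟩
  · linear_combination -e1
  · linear_combination -e2

/-- Near any of its points, an angle curve is a straight line in the flat coordinates. -/
lemma IsAngleCurveOn.eventually_eq_lineCurve {γ : ℝ → E3} {I : Set ℝ} {θ t₁ X Y : ℝ}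
    (hθ : 0 < Real.cos θ) (hI : IsOpen I) (hγ : IsAngleCurveOn a b c θ γ I) (ht₁ : t₁ ∈ I)
    (h₁ : γ t₁ = flatPt a b c X Y) :
    ∃ ε : ℝ, (ε = 1 ∨ ε = -1) ∧
      ∀ᶠ t in 𝓝 t₁, γ t = lineCurve a b c θ X Y (ε * (t - t₁)) := by
  have hF₁ : 0 < confFactor a b c (ang b c a X) (ang b a c Y) := by
    refine lt_of_le_of_ne (Real.sqrt_nonneg _) (Ne.symm fun h0 => (hγ t₁ ht₁).2.1 ?_)
    rw [h₁, isUmbilic_flatPt_iff h]; exact h0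
  obtain ⟨p, q, hp₁, hq₁, hpq⟩ := exists_local_lift h hF₁ h₁ (by
    filter_upwards [hI.mem_nhds ht₁] with t ht
    obtain ⟨h1, -, e, -, hd⟩ := hγ t ht
    exact ⟨h1, hd.differentiableAt⟩)
  obtain ⟨δ, hδ, hball⟩ := Metric.eventually_nhds_iff_ball.1 (hpq.and (hI.mem_nhds ht₁))
  have hvel : ∀ t ∈ Metric.ball t₁ δ, 0 < confFactor a b c (p t) (q t) ∧ ∃ ε : ℝ,
      (ε = 1 ∨ ε = -1) ∧
      deriv p t * (confFactor a b c (p t) (q t) * dens b c a (p t)) = ε * Real.cos θ ∧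
      deriv q t * (confFactor a b c (p t) (q t) * dens b a c (q t)) = ε * Real.sin θ := by
    intro t ht
    refine angle_velocity h hγ (hball t ht).2 ?_ (hball t ht).1.2.1 (hball t ht).1.2.2
    filter_upwards [Metric.isOpen_ball.mem_nhds ht] with s hs using (hball s hs).1.1
  choose! hF ε hε hε1 hε2 using hvel
  have hsc := Real.sin_sq_add_cos_sq θ
  have ht₁b : t₁ ∈ Metric.ball t₁ δ := Metric.mem_ball_self hδ
  have hconvex : Convex ℝ (Metric.ball t₁ δ) := convex_ball _ _
  set x : ℝ → ℝ := fun t => prim (dens b c a) (p t) with hx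
  set y : ℝ → ℝ := fun t => prim (dens b a c) (q t) with hy
  have hangx : ∀ t, ang b c a (x t) = p t := fun t => h.nodeP.ang_prim _
  have hangy : ∀ t, ang b a c (y t) = q t := fun t => h.nodeQ.ang_prim _
  have hxd : ∀ t ∈ Metric.ball t₁ δ,
      HasDerivAt x (ε t * Real.cos θ / confFactor a b c (p t) (q t)) t := by
    intro t ht
    have := (hasDerivAt_prim h.nodeP.continuous_dens (p t)).comp t
      (hball t ht).1.2.1.hasDerivAt
    refine this.congr_deriv ?_
    rw [← hε1 t ht, eq_div_iff (hF t ht).ne']; ring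
  have hyd : ∀ t ∈ Metric.ball t₁ δ,
      HasDerivAt y (ε t * Real.sin θ / confFactor a b c (p t) (q t)) t := by
    intro t ht
    have := (hasDerivAt_prim h.nodeQ.continuous_dens (q t)).comp t
      (hball t ht).1.2.2.hasDerivAt
    refine this.congr_deriv ?_
    rw [← hε2 t ht, eq_div_iff (hF t ht).ne']; ring
  have hx₁ : x t₁ = X := by simp only [hx, hp₁]; exact h.nodeP.prim_ang X
  have hy₁ : y t₁ = Y := by simp only [hy, hq₁]; exact h.nodeQ.prim_ang Y
  have hconst : ∀ f : ℝ → ℝ, (∀ t ∈ Metric.ball t₁ δ, HasDerivAt f 0 t) →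
      ∀ t ∈ Metric.ball t₁ δ, f t = f t₁ := by
    intro f hf t ht
    exact Metric.isOpen_ball.is_const_of_deriv_eq_zero hconvex.isPreconnected
      (fun s hs => (hf s hs).differentiableAt.differentiableWithinAt)
      (fun s hs => (hf s hs).deriv) ht ht₁b
  -- The velocities of `x` and `y` are the same multiple of `cos θ` and `sin θ`, whatever the sign,
  -- so the component normal to the direction `θ` is constant.
  have hnormal : ∀ t ∈ Metric.ball t₁ δ,
      Real.cos θ * (y t - Y) - Real.sin θ * (x t - X) = 0 := by
    intro t ht
    have := hconst (fun t => Real.cos θ * (y t - Y) - Real.sin θ * (x t - X)) (fun s hs =>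
      ((((hyd s hs).sub_const Y).const_mul (Real.cos θ)).sub
        (((hxd s hs).sub_const X).const_mul (Real.sin θ))).congr_deriv (by ring)) t ht
    simpa [hx₁, hy₁] using this
  set σ : ℝ → ℝ := fun t => Real.cos θ * (x t - X) + Real.sin θ * (y t - Y) with hσ
  have hσd : ∀ t ∈ Metric.ball t₁ δ,
      HasDerivAt σ (ε t / confFactor a b c (p t) (q t)) t := by
    intro t ht
    refine ((((hxd t ht).sub_const X).const_mul (Real.cos θ)).add
      (((hyd t ht).sub_const Y).const_mul (Real.sin θ))).congr_deriv ?_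
    linear_combination (ε t / confFactor a b c (p t) (q t)) * hsc
  have hxσ : ∀ t ∈ Metric.ball t₁ δ, x t = X + σ t * Real.cos θ := by
    intro t ht
    have := hnormal t ht
    simp only [hσ]
    linear_combination -(x t - X) * hsc - Real.sin θ * this
  have hyσ : ∀ t ∈ Metric.ball t₁ δ, y t = Y + σ t * Real.sin θ := by
    intro t ht
    have := hnormal t ht
    simp only [hσ]
    linear_combination -(y t - Y) * hsc + Real.cos θ * this
  have hclock := isClock_lineFactor h hθ X Y
  -- Measured by the clock of the line, the position has derivative `ε t = ±1`.
  have hgd : ∀ t ∈ Metric.ball t₁ δ,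
      HasDerivAt (fun t => prim (lineFactor a b c θ X Y) (σ t)) (ε t) t := by
    intro t ht
    refine ((hasDerivAt_prim hclock.cont (σ t)).comp t (hσd t ht)).congr_deriv ?_
    rw [lineFactor, ← hxσ t ht, ← hyσ t ht, flatFactor, hangx, hangy]
    have := (hF t ht).ne'
    field_simp
  -- By Darboux a derivative that is never `0` has constant sign, so `ε` does not jump although no
  -- continuity of it is known.
  have hsign : ∃ ε₀ : ℝ, (ε₀ = 1 ∨ ε₀ = -1) ∧ ∀ t ∈ Metric.ball t₁ δ, ε t = ε₀ := by
    rcases hasDerivWithinAt_forall_lt_or_forall_gt_of_forall_ne hconvex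
      (fun t ht => (hgd t ht).hasDerivWithinAt) (m := 0)
      (fun t ht => by rcases hε t ht with h1 | h1 <;> rw [h1] <;> norm_num) with h1 | h1
    · refine ⟨-1, Or.inr rfl, fun t ht => ?_⟩
      rcases hε t ht with h2 | h2
      · have := h1 t ht; linarith
      · exact h2
    · refine ⟨1, Or.inl rfl, fun t ht => ?_⟩
      rcases hε t ht with h2 | h2
      · exact h2
      · have := h1 t ht; linarith
  obtain ⟨ε₀, hε₀, hεε⟩ := hsign
  refine ⟨ε₀, hε₀, ?_⟩
  filter_upwards [Metric.ball_mem_nhds t₁ hδ] with t ht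
  have hg := hconst (fun t => prim (lineFactor a b c θ X Y) (σ t) - ε₀ * (t - t₁)) (fun s hs =>
    ((hgd s hs).sub (((hasDerivAt_id s).sub_const t₁).const_mul ε₀)).congr_deriv
      (by rw [hεε s hs]; ring)) t ht
  have hσ₁ : σ t₁ = 0 := by simp [hσ, hx₁, hy₁]
  simp only [hσ₁, prim_zero, sub_self, mul_zero] at hg
  have hT : lineTime a b c θ X Y (ε₀ * (t - t₁)) = σ t := by
    rw [lineTime, hclock.primInv_eq_iff]; linarith
  rw [lineCurve, hT, ← hxσ t ht, ← hyσ t ht, flatPt, hangx, hangy]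
  exact (hball t ht).1.1

/-- The difference of the curve and its reversal has derivative twice the unit velocity at `t₁`. A
curve therefore cannot follow the line in both senses near a point that is not umbilic. -/
lemma lineCurve_eventually_ne {θ X Y t₁ : ℝ} (hθ : 0 < Real.cos θ)
    (hF : 0 < flatFactor a b c X Y) : ∀ᶠ t in 𝓝[≠] t₁,
      lineCurve a b c θ X Y (t - t₁) - lineCurve a b c θ X Y (-(t - t₁)) ≠ 0 := by
  have hT := lineTime_zero h hθ X Y
  have h0 := hasDerivAt_lineCurve h hθ X Y 0 (by rw [hT, lineFactor]; simpa using hF)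
  simp only [hT, zero_mul, add_zero] at h0
  set w := Real.cos θ • unitP a b c (ang b c a X) (ang b a c Y) +
    Real.sin θ • unitQ a b c (ang b c a X) (ang b a c Y) with hw
  have hw0 : w ≠ 0 := by
    intro hw0
    have : inner ℝ (unitP a b c (ang b c a X) (ang b a c Y)) w = 0 := by
      rw [hw0, inner_zero_right]
    rw [hw, inner_add_right, inner_smul_right, inner_smul_right, inner_unitP_unitQ h,
      real_inner_self_eq_norm_sq, norm_unitP h hF] at this
    linarith
  have hs : HasDerivAt (fun t : ℝ => t - t₁) 1 t₁ := (hasDerivAt_id t₁).sub_const t₁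
  have d1 := HasDerivAt.scomp_of_eq t₁ h0 hs (by simp)
  have d2 := HasDerivAt.scomp_of_eq t₁ h0 hs.neg (by simp)
  refine (d1.sub d2).eventually_ne ?_
  rw [one_smul, neg_smul, one_smul, sub_neg_eq_add, ← two_smul ℝ]
  exact smul_ne_zero two_ne_zero hw0

/-- An angle curve on an interval is a straight line in the flat coordinates. -/
theorem IsAngleCurveOn.exists_eq_lineCurve {γ : ℝ → E3} {I : Set ℝ} {θ t₀ : ℝ}
    (hθ : 0 < Real.cos θ) (hI : IsOpen I) (hIc : I.OrdConnected)
    (hγ : IsAngleCurveOn a b c θ γ I) (ht₀ : t₀ ∈ I) :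
    ∃ X Y, ∀ t ∈ I, γ t = lineCurve a b c θ X Y (t - t₀) := by
  obtain ⟨X, Y, h₀⟩ : ∃ X Y, ∀ᶠ t in 𝓝 t₀, γ t = lineCurve a b c θ X Y (t - t₀) := by
    obtain ⟨X, Y, hXY⟩ := exists_flatPt h (hγ t₀ ht₀).1
    obtain ⟨ε, hε, hev⟩ := hγ.eventually_eq_lineCurve h hθ hI ht₀ hXY.symm
    rcases hε with rfl | rfl
    · exact ⟨X, Y, by simpa using hev⟩
    · refine ⟨-X, -Y, ?_⟩
      filter_upwards [hev] with t ht
      rw [ht, lineCurve_neg h hθ, neg_one_mul]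
  refine ⟨X, Y, ?_⟩
  have hΓ := continuous_lineCurve h hθ X Y
  have hΓ' : Continuous fun t => lineCurve a b c θ X Y (t - t₀) := by fun_prop
  set U := {t | ∀ᶠ s in 𝓝 t, γ s = lineCurve a b c θ X Y (s - t₀)} with hU
  -- `U` is open and meets the connected set `I`, so it suffices that it is closed in `I`.
  have hsub : I ⊆ U := by
    refine hIc.isPreconnected.subset_of_closure_inter_subset
      isOpen_setOfPred_eventually_nhds ⟨t₀, ht₀, h₀⟩ ?_
    rintro t₁ ⟨hcl, ht₁⟩
    by_contra hnot
    have hfreq := mem_closure_iff_frequently.1 hcl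
    have hcont : ContinuousAt γ t₁ := by
      obtain ⟨-, -, e, -, hd⟩ := hγ t₁ ht₁
      exact hd.continuousAt
    have heq₁ : γ t₁ = lineCurve a b c θ X Y (t₁ - t₀) := by
      by_contra hne
      have := (hcont.sub hΓ'.continuousAt).eventually_ne (sub_ne_zero.2 hne)
      obtain ⟨t, ht, ht'⟩ := (hfreq.and_eventually this).exists
      exact ht' (sub_eq_zero.2 (show ∀ᶠ s in 𝓝 t, γ s = lineCurve a b c θ X Y (s - t₀) from
        ht).self_of_nhds)
    set X₁ := X + lineTime a b c θ X Y (t₁ - t₀) * Real.cos θ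
    set Y₁ := Y + lineTime a b c θ X Y (t₁ - t₀) * Real.sin θ
    have hshift : ∀ t, lineCurve a b c θ X Y (t - t₀) = lineCurve a b c θ X₁ Y₁ (t - t₁) := by
      intro t
      rw [← lineCurve_add h hθ]; congr 1; ring
    have hpt : γ t₁ = flatPt a b c X₁ Y₁ := heq₁
    have hF : 0 < flatFactor a b c X₁ Y₁ := by
      refine lt_of_le_of_ne (Real.sqrt_nonneg _) (Ne.symm fun h0 => (hγ t₁ ht₁).2.1 ?_)
      rw [hpt, isUmbilic_flatPt_iff h]; exact h0
    obtain ⟨ε, hε, hev⟩ := hγ.eventually_eq_lineCurve h hθ hI ht₁ hpt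
    rcases hε with rfl | rfl
    · refine hnot ?_
      show ∀ᶠ s in 𝓝 t₁, γ s = lineCurve a b c θ X Y (s - t₀)
      filter_upwards [hev] with t ht
      rw [ht, hshift, one_mul]
    -- Were the sense reversed at the limit point `t₁`, points of `U` close to `t₁` would lie on the
    -- line and on its reversal at the same time.
    · have hne := eventually_nhdsWithin_iff.1 (lineCurve_eventually_ne h (t₁ := t₁) hθ hF)
      obtain ⟨t, ht, hev', hne'⟩ := (hfreq.and_eventually (hev.and hne)).exists
      refine hne' (fun h0 => hnot (by rw [← show t = t₁ from h0]; exact ht)) ?_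
      rw [sub_eq_zero, ← hshift, ← neg_one_mul, ← hev']
      exact (show ∀ᶠ s in 𝓝 t, γ s = lineCurve a b c θ X Y (s - t₀) from ht).self_of_nhds.symm
  exact fun t ht => (show ∀ᶠ s in 𝓝 t, γ s = lineCurve a b c θ X Y (s - t₀) from
    hsub ht).self_of_nhds

end

/-! ### Leaves: their ends, recurrence, closedness -/

lemma atTop_le_rightEnd {I : Set ℝ} {t₀ : ℝ} (h : Ici t₀ ⊆ I) : atTop ≤ rightEnd I := by
  refine le_iInf₂ fun t _ => ?_
  rw [le_principal_iff]
  filter_upwards [eventually_ge_atTop t₀, eventually_ge_atTop t] with s hs hs'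
  exact ⟨h hs, hs'⟩

lemma atBot_le_leftEnd {I : Set ℝ} {t₀ : ℝ} (h : Iic t₀ ⊆ I) : atBot ≤ leftEnd I := by
  refine le_iInf₂ fun t _ => ?_
  rw [le_principal_iff]
  filter_upwards [eventually_le_atBot t₀, eventually_le_atBot t] with s hs hs'
  exact ⟨h hs, hs'⟩

lemma rightEnd_le_nhds {I : Set ℝ} {t₀ t₁ : ℝ} (hI : I.OrdConnected) (h01 : t₀ < t₁)
    (h : Ico t₀ t₁ ⊆ I) (h₁ : t₁ ∉ I) : rightEnd I ≤ 𝓝 t₁ ⊓ 𝓟 I := by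
  have h0 : t₀ ∈ I := h ⟨le_rfl, h01⟩
  refine le_inf (fun s hs => ?_) ?_
  · obtain ⟨l, hl, hls⟩ := exists_Ioc_subset_of_mem_nhds hs ⟨t₀, h01⟩
    obtain ⟨t, ht, ht'⟩ := exists_between (max_lt h01 hl)
    have htI : t ∈ I := h ⟨(le_max_left _ _).trans ht.le, ht'⟩
    refine mem_iInf_of_mem t (mem_iInf_of_mem htI fun r hr => hls ⟨?_, ?_⟩)
    · exact ((le_max_right _ _).trans_lt ht).trans_le hr.2
    · by_contra! hlt
      exact h₁ (hI.out h0 hr.1 ⟨h01.le, hlt.le⟩)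
  · exact iInf₂_le_of_le t₀ h0 (principal_mono.2 inter_subset_left)

lemma leftEnd_le_nhds {I : Set ℝ} {t₀ t₁ : ℝ} (hI : I.OrdConnected) (h01 : t₁ < t₀)
    (h : Ioc t₁ t₀ ⊆ I) (h₁ : t₁ ∉ I) : leftEnd I ≤ 𝓝 t₁ ⊓ 𝓟 I := by
  have h0 : t₀ ∈ I := h ⟨h01, le_rfl⟩
  refine le_inf (fun s hs => ?_) ?_
  · obtain ⟨l, hl, hls⟩ := exists_Ico_subset_of_mem_nhds hs ⟨t₀, h01⟩
    obtain ⟨t, ht', ht⟩ := exists_between (lt_min h01 hl)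
    have htI : t ∈ I := h ⟨ht', ht.le.trans (min_le_left _ _)⟩
    refine mem_iInf_of_mem t (mem_iInf_of_mem htI fun r hr => hls ⟨?_, ?_⟩)
    · by_contra! hlt
      exact h₁ (hI.out hr.1 h0 ⟨hlt.le, h01.le⟩)
    · exact lt_of_le_of_lt hr.2 (ht.trans_le (min_le_right _ _))
  · exact iInf₂_le_of_le t₀ h0 (principal_mono.2 inter_subset_left)

lemma isOpen_ordConnectedComponent {U : Set ℝ} (hU : IsOpen U) (t : ℝ) :
    IsOpen (U.ordConnectedComponent t) := by
  rw [isOpen_iff_mem_nhds]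
  intro y hy
  rw [ordConnectedComponent_eq hy, ordConnectedComponent_mem_nhds]
  exact hU.mem_nhds (ordConnectedComponent_subset hy)

/-- An initial segment of a half-line leaves an open set at a first point, if at all. -/
lemma exists_first_exit {U : Set ℝ} (hU : IsOpen U) {t₀ : ℝ} (ht₀ : t₀ ∈ U) :
    Ici t₀ ⊆ U.ordConnectedComponent t₀ ∨
      ∃ t₁, t₀ < t₁ ∧ t₁ ∉ U ∧ Ico t₀ t₁ ⊆ U.ordConnectedComponent t₀ := by
  by_cases hC : (Uᶜ ∩ Ici t₀).Nonempty
  · right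
    have hcl : IsClosed (Uᶜ ∩ Ici t₀) := hU.isClosed_compl.inter isClosed_Ici
    have hbd : BddBelow (Uᶜ ∩ Ici t₀) := ⟨t₀, fun t ht => ht.2⟩
    have hmem := hcl.csInf_mem hC hbd
    refine ⟨sInf (Uᶜ ∩ Ici t₀), lt_of_le_of_ne hmem.2 fun heq => hmem.1 (heq ▸ ht₀), hmem.1, ?_⟩
    intro t ht
    rw [mem_ordConnectedComponent, uIcc_of_le ht.1]
    intro s hs
    by_contra hsU
    exact absurd (csInf_le hbd ⟨hsU, hs.1⟩) (not_le.2 (hs.2.trans_lt ht.2))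
  · left
    intro t ht
    rw [mem_ordConnectedComponent, uIcc_of_le ht]
    intro s hs
    by_contra hsU
    exact hC ⟨s, hsU, hs.1⟩

lemma exists_last_exit {U : Set ℝ} (hU : IsOpen U) {t₀ : ℝ} (ht₀ : t₀ ∈ U) :
    Iic t₀ ⊆ U.ordConnectedComponent t₀ ∨
      ∃ t₁, t₁ < t₀ ∧ t₁ ∉ U ∧ Ioc t₁ t₀ ⊆ U.ordConnectedComponent t₀ := by
  by_cases hC : (Uᶜ ∩ Iic t₀).Nonempty
  · right
    have hcl : IsClosed (Uᶜ ∩ Iic t₀) := hU.isClosed_compl.inter isClosed_Iic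
    have hbd : BddAbove (Uᶜ ∩ Iic t₀) := ⟨t₀, fun t ht => ht.2⟩
    have hmem := hcl.csSup_mem hC hbd
    refine ⟨sSup (Uᶜ ∩ Iic t₀), lt_of_le_of_ne hmem.2 fun heq => hmem.1 (by rw [heq]; exact ht₀), hmem.1, ?_⟩
    intro t ht
    rw [mem_ordConnectedComponent, uIcc_of_ge ht.2]
    intro s hs
    by_contra hsU
    exact absurd (le_csSup hbd ⟨hsU, hs.2⟩) (not_le.2 (ht.1.trans_le hs.1))
  · left
    intro t ht
    rw [mem_ordConnectedComponent, uIcc_of_ge ht]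
    intro s hs
    by_contra hsU
    exact hC ⟨s, hsU, hs.2⟩

/-- Multiples of a real number come close to integers arbitrarily late. -/
lemma exists_int_mul_near (ξ : ℝ) {ε : ℝ} (hε : 0 < ε) (N : ℝ) :
    ∃ m n : ℤ, N ≤ m ∧ |m * ξ - n| < ε := by
  -- Dirichlet bounds the denominator from above only; multiplying the approximation by a large `M`
  -- makes it late, and `k > M / ε` absorbs the loss of precision.
  obtain ⟨M, hM⟩ := exists_nat_gt (max N 1)
  have hM1 : (1 : ℝ) < M := (le_max_right _ _).trans_lt hM
  obtain ⟨k, hk⟩ := exists_nat_gt (M / ε)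
  have hk0 : (0 : ℝ) < k := lt_trans (by positivity) hk
  obtain ⟨j, l, hl0, -, hlj⟩ := Real.exists_int_int_abs_mul_sub_le ξ (Nat.cast_pos.1 hk0)
  refine ⟨M * l, M * j, ?_, ?_⟩
  · have : (1 : ℝ) ≤ l := by exact_mod_cast hl0
    push_cast
    nlinarith [le_max_left N 1]
  · push_cast
    rw [show (M : ℝ) * l * ξ - M * j = M * (l * ξ - j) by ring, abs_mul, Nat.abs_cast]
    calc (M : ℝ) * |l * ξ - j| ≤ M * (1 / (k + 1)) := by gcongr
      _ < ε := by
        rw [mul_one_div, div_lt_iff₀ (by positivity)]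
        rw [div_lt_iff₀ hε] at hk
        nlinarith

section

variable {a b c : ℝ} (h : IsTriaxial a b c)
include h

/-- The line itself extends the leaf to the component of `t₀` in the set of times at which the line
is not umbilic; maximality says that the leaf is already all of it. -/
lemma IsLeaf.exists_eq_lineCurve {γ : ℝ → E3} {I : Set ℝ} {θ : ℝ} (hθ : 0 < Real.cos θ)
    (hγ : IsLeaf a b c θ γ I) : ∃ t₀ X Y,
      lineFactor a b c θ X Y 0 ≠ 0 ∧ (∀ t ∈ I, γ t = lineCurve a b c θ X Y (t - t₀)) ∧
      I = {t | lineFactor a b c θ X Y (lineTime a b c θ X Y (t - t₀)) ≠ 0}.ordConnectedComponent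
        t₀ := by
  obtain ⟨hI, hIc, ⟨t₀, ht₀⟩, hγI, hmax⟩ := hγ
  obtain ⟨X, Y, hXY⟩ := hγI.exists_eq_lineCurve h hθ hI hIc ht₀
  have hsub : I ⊆ {t | lineFactor a b c θ X Y (lineTime a b c θ X Y (t - t₀)) ≠ 0} := by
    intro t ht h0
    refine (hγI t ht).2.1 ?_
    rw [hXY t ht, lineCurve, isUmbilic_flatPt_iff h]
    exact h0
  have hopen : IsOpen {t | lineFactor a b c θ X Y (lineTime a b c θ X Y (t - t₀)) ≠ 0} := by
    have h1 := (isClock_lineFactor h hθ X Y).cont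
    have h2 := continuous_lineTime h hθ X Y
    exact isOpen_ne_fun (by fun_prop) continuous_const
  refine ⟨t₀, X, Y, ?_, hXY, ?_⟩
  · have := hsub ht₀
    simpa [lineTime_zero h hθ] using this
  · refine (hmax (fun t => lineCurve a b c θ X Y (t - t₀)) _
      (isOpen_ordConnectedComponent hopen t₀) inferInstance
      (subset_ordConnectedComponent ht₀ hsub) hXY ?_).symm
    exact isAngleCurveOn_lineCurve h hθ X Y fun t ht => ordConnectedComponent_subset ht

/-- Either end of a leaf is infinite, or the leaf tends there to an umbilic point. -/
lemma IsLeaf.ends {γ : ℝ → E3} {I : Set ℝ} {θ : ℝ} (hθ : 0 < Real.cos θ)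
    (hγ : IsLeaf a b c θ γ I) : ∃ t₀ X Y,
      (∀ t ∈ I, γ t = lineCurve a b c θ X Y (t - t₀)) ∧
      (Ici t₀ ⊆ I ∨ EndsAtUmbilic a b c γ (rightEnd I) ∧
        ∃ τ, 0 < τ ∧ lineFactor a b c θ X Y τ = 0) ∧
      (Iic t₀ ⊆ I ∨ EndsAtUmbilic a b c γ (leftEnd I) ∧
        ∃ τ, τ < 0 ∧ lineFactor a b c θ X Y τ = 0) := by
  obtain ⟨t₀, X, Y, h0, hXY, hIeq⟩ := hγ.exists_eq_lineCurve h hθ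
  obtain ⟨-, hIc, -, -, -⟩ := hγ
  set U := {t | lineFactor a b c θ X Y (lineTime a b c θ X Y (t - t₀)) ≠ 0} with hU
  have hopen : IsOpen U := by
    have h1 := (isClock_lineFactor h hθ X Y).cont
    have h2 := continuous_lineTime h hθ X Y
    exact isOpen_ne_fun (by fun_prop) continuous_const
  have ht₀ : t₀ ∈ U := by simpa [hU, lineTime_zero h hθ] using h0
  have hmono := lineTime_strictMono h hθ X Y
  have hT0 := lineTime_zero h hθ X Y
  have hlim : ∀ t₁, t₁ ∉ U → ∀ l : Filter ℝ, l ≤ 𝓝 t₁ ⊓ 𝓟 I → EndsAtUmbilic a b c γ l := by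
    intro t₁ ht₁ l hl
    refine ⟨lineCurve a b c θ X Y (t₁ - t₀), ?_, ?_⟩
    · rw [lineCurve, isUmbilic_flatPt_iff h]
      exact not_not.1 ht₁
    · have hc := continuous_lineCurve h hθ X Y
      have hc' : Continuous fun t => lineCurve a b c θ X Y (t - t₀) := by fun_prop
      refine (hc'.continuousAt.tendsto.mono_left (hl.trans inf_le_left)).congr' ?_
      filter_upwards [(hl.trans inf_le_right) (mem_principal_self I)] with t ht
      exact (hXY t ht).symm
  refine ⟨t₀, X, Y, hXY, ?_, ?_⟩
  · rcases exists_first_exit hopen ht₀ with h1 | ⟨t₁, h01, ht₁, hIco⟩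
    · left; rwa [hIeq]
    · right
      rw [← hIeq] at hIco
      have ht₁I : t₁ ∉ I := fun hmem => ht₁ (ordConnectedComponent_subset (hIeq ▸ hmem))
      refine ⟨hlim t₁ ht₁ _ (rightEnd_le_nhds hIc h01 hIco ht₁I), _, ?_, not_not.1 ht₁⟩
      rw [← hT0]; exact hmono (sub_pos.2 h01)
  · rcases exists_last_exit hopen ht₀ with h1 | ⟨t₁, h01, ht₁, hIco⟩
    · left; rwa [hIeq]
    · right
      rw [← hIeq] at hIco
      have ht₁I : t₁ ∉ I := fun hmem => ht₁ (ordConnectedComponent_subset (hIeq ▸ hmem))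
      refine ⟨hlim t₁ ht₁ _ (leftEnd_le_nhds hIc h01 hIco ht₁I), _, ?_, not_not.1 ht₁⟩
      rw [← hT0]; exact hmono (sub_neg.2 h01)

/-- A straight line comes back to any of its points on the torus, arbitrarily late. -/
lemma exists_return {θ : ℝ} (hθ : 0 < Real.cos θ) (X Y τ : ℝ) {V : Set E3}
    (hV : V ∈ 𝓝 (flatPt a b c (X + τ * Real.cos θ) (Y + τ * Real.sin θ))) {ε : ℝ}
    (hε : ε = 1 ∨ ε = -1) (N : ℝ) :
    ∃ r, N ≤ r ∧ flatPt a b c (X + (τ + ε * r) * Real.cos θ) (Y + (τ + ε * r) * Real.sin θ) ∈ V := by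
  have hK1 := h.nodeP.halfPeriod_pos
  have hK2 := h.nodeQ.halfPeriod_pos
  set K₁ := halfPeriod b c a with hK₁
  set K₂ := halfPeriod b a c with hK₂
  have hcont : Continuous fun y => flatPt a b c (X + τ * Real.cos θ) (Y + τ * Real.sin θ + y) :=
    continuous_flatPt_comp h (by fun_prop) (by fun_prop)
  have hV' : ∀ᶠ y in 𝓝 (0 : ℝ),
      flatPt a b c (X + τ * Real.cos θ) (Y + τ * Real.sin θ + y) ∈ V :=
    hcont.continuousAt.eventually (by simpa using hV)
  obtain ⟨δ, hδ, hball⟩ := Metric.eventually_nhds_iff_ball.1 hV'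
  -- While `X` advances by `2 m K₁`, `Y` advances by `2 m K₁ tan θ`; the number to approximate is
  -- this gain divided by `2 m K₂`. The tolerance `δ / (2 K₂)` becomes an error less than `δ` in
  -- `Y`.
  obtain ⟨m, n, hm, hmn⟩ := exists_int_mul_near (K₁ * Real.sin θ / (Real.cos θ * K₂))
    (ε := δ / (2 * K₂)) (by positivity) (N * Real.cos θ / (2 * K₁))
  refine ⟨2 * m * K₁ / Real.cos θ, ?_, ?_⟩
  · rw [div_le_iff₀ (by positivity)] at hm
    rw [le_div_iff₀ hθ]; linarith
  · obtain ⟨m', n', hm', hn'⟩ : ∃ m' n' : ℤ, (m' : ℝ) = ε * m ∧ (n' : ℝ) = ε * n := by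
      rcases hε with rfl | rfl
      · exact ⟨m, n, by simp, by simp⟩
      · exact ⟨-m, -n, by simp, by simp⟩
    have e1 : X + (τ + ε * (2 * m * K₁ / Real.cos θ)) * Real.cos θ =
        X + τ * Real.cos θ + 2 * m' * K₁ := by
      rw [hm']; field_simp; ring
    have e2 : Y + (τ + ε * (2 * m * K₁ / Real.cos θ)) * Real.sin θ =
        (Y + τ * Real.sin θ +
          ε * (2 * K₂) * (m * (K₁ * Real.sin θ / (Real.cos θ * K₂)) - n)) + 2 * n' * K₂ := by
      rw [hn']; field_simp; ring
    rw [e1, e2, flatPt_add_periods h]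
    refine hball _ ?_
    have hεabs : |ε| = 1 := by rcases hε with rfl | rfl <;> simp
    rw [mem_ball_zero_iff, Real.norm_eq_abs, abs_mul, abs_mul, hεabs, one_mul,
      abs_of_pos (by positivity : 0 < 2 * K₂)]
    rw [lt_div_iff₀ (by positivity)] at hmn
    linarith

lemma mapClusterPt_lineCurve_atTop {θ : ℝ} (hθ : 0 < Real.cos θ) (X Y s : ℝ) :
    MapClusterPt (lineCurve a b c θ X Y s) atTop (lineCurve a b c θ X Y) := by
  rw [mapClusterPt_iff_frequently]
  intro V hV
  rw [frequently_atTop]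
  intro N
  have hclock := isClock_lineFactor h hθ X Y
  obtain ⟨r, hr, hrV⟩ := exists_return h hθ X Y (lineTime a b c θ X Y s) hV (Or.inl rfl)
    (lineTime a b c θ X Y N - lineTime a b c θ X Y s)
  refine ⟨prim (lineFactor a b c θ X Y) (lineTime a b c θ X Y s + 1 * r), ?_, ?_⟩
  · rw [← hclock.prim_primInv N]
    refine hclock.mono.monotone ?_
    rw [← lineTime]; linarith
  · rw [lineCurve, lineTime, hclock.primInv_prim]; exact hrV

lemma mapClusterPt_lineCurve_atBot {θ : ℝ} (hθ : 0 < Real.cos θ) (X Y s : ℝ) :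
    MapClusterPt (lineCurve a b c θ X Y s) atBot (lineCurve a b c θ X Y) := by
  rw [mapClusterPt_iff_frequently]
  intro V hV
  rw [frequently_atBot]
  intro N
  have hclock := isClock_lineFactor h hθ X Y
  obtain ⟨r, hr, hrV⟩ := exists_return h hθ X Y (lineTime a b c θ X Y s) hV (Or.inr rfl)
    (lineTime a b c θ X Y s - lineTime a b c θ X Y N)
  refine ⟨prim (lineFactor a b c θ X Y) (lineTime a b c θ X Y s + -1 * r), ?_, ?_⟩
  · rw [← hclock.prim_primInv N]
    refine hclock.mono.monotone ?_
    rw [← lineTime]; linarith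
  · rw [lineCurve, lineTime, hclock.primInv_prim]; exact hrV

lemma isRecurrentAlong_of_atTop {γ : ℝ → E3} {I : Set ℝ} {θ t₀ X Y : ℝ} (hθ : 0 < Real.cos θ)
    (hXY : ∀ t ∈ I, γ t = lineCurve a b c θ X Y (t - t₀)) (hI : Ici t₀ ⊆ I) :
    IsRecurrentAlong γ I (rightEnd I) := by
  rintro _ ⟨t, ht, rfl⟩
  rw [hXY t ht]
  refine MapClusterPt.mono ?_ (atTop_le_rightEnd hI)
  have h1 := mapClusterPt_lineCurve_atTop h hθ X Y (t - t₀)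
  rw [mapClusterPt_iff_frequently] at h1 ⊢
  intro V hV
  have h2 := (h1 V hV)
  rw [frequently_atTop] at h2 ⊢
  intro N
  obtain ⟨r, hr, hrV⟩ := h2 (max N t₀ - t₀)
  refine ⟨r + t₀, by linarith [le_max_left N t₀], ?_⟩
  rw [hXY _ (hI (show t₀ ≤ r + t₀ by linarith [le_max_right N t₀])), add_sub_cancel_right]
  exact hrV

lemma isRecurrentAlong_of_atBot {γ : ℝ → E3} {I : Set ℝ} {θ t₀ X Y : ℝ} (hθ : 0 < Real.cos θ)
    (hXY : ∀ t ∈ I, γ t = lineCurve a b c θ X Y (t - t₀)) (hI : Iic t₀ ⊆ I) :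
    IsRecurrentAlong γ I (leftEnd I) := by
  rintro _ ⟨t, ht, rfl⟩
  rw [hXY t ht]
  refine MapClusterPt.mono ?_ (atBot_le_leftEnd hI)
  have h1 := mapClusterPt_lineCurve_atBot h hθ X Y (t - t₀)
  rw [mapClusterPt_iff_frequently] at h1 ⊢
  intro V hV
  have h2 := (h1 V hV)
  rw [frequently_atBot] at h2 ⊢
  intro N
  obtain ⟨r, hr, hrV⟩ := h2 (min N t₀ - t₀)
  refine ⟨r + t₀, by linarith [min_le_left N t₀], ?_⟩
  rw [hXY _ (hI (show r + t₀ ≤ t₀ by linarith [min_le_right N t₀])), add_sub_cancel_right]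
  exact hrV

/-- Two zeros are two points of the lattice spanned by `K₁`, `K₂` on one line, and their difference
makes the direction rational with respect to the lattice. -/
lemma lineFactor_zero_unique {θ : ℝ} (hs : Real.sin θ ≠ 0)
    (hirr : Irrational (Real.cos θ * halfPeriod b a c / (Real.sin θ * halfPeriod b c a)))
    {X Y τ τ' : ℝ} (hτ : lineFactor a b c θ X Y τ = 0) (hτ' : lineFactor a b c θ X Y τ' = 0) :
    τ = τ' := by
  by_contra hne
  obtain ⟨⟨m, hm⟩, ⟨n, hn⟩⟩ := (flatFactor_eq_zero_iff h).1 hτ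
  obtain ⟨⟨m', hm'⟩, ⟨n', hn'⟩⟩ := (flatFactor_eq_zero_iff h).1 hτ'
  have hK1 := h.nodeP.halfPeriod_pos
  have hK2 := h.nodeQ.halfPeriod_pos
  have e1 : ((m : ℝ) - m') * halfPeriod b c a = (τ - τ') * Real.cos θ := by
    linear_combination hm - hm'
  have e2 : ((n : ℝ) - n') * halfPeriod b a c = (τ - τ') * Real.sin θ := by
    linear_combination hn - hn'
  have hd : τ - τ' ≠ 0 := sub_ne_zero.2 hne
  have hn0 : (n : ℝ) - n' ≠ 0 := by
    intro h0
    rw [h0, zero_mul] at e2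
    exact mul_ne_zero hd hs e2.symm
  refine hirr ⟨((m - m' : ℤ) : ℚ) / ((n - n' : ℤ) : ℚ), ?_⟩
  push_cast
  rw [div_eq_div_iff hn0 (mul_ne_zero hs hK1.ne')]
  apply mul_left_cancel₀ hd
  linear_combination (Real.sin θ * (τ - τ')) * e1 - (τ - τ') * Real.cos θ * e2

/-- Every infinite end is recurrent for any slope. Irrationality serves only to exclude a leaf with
umbilic points at both ends. -/
theorem IsLeaf.isRecurrent {γ : ℝ → E3} {I : Set ℝ} {θ : ℝ} (hθ : 0 < Real.cos θ)
    (hs : Real.sin θ ≠ 0)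
    (hirr : Irrational (Real.cos θ * halfPeriod b a c / (Real.sin θ * halfPeriod b c a)))
    (hγ : IsLeaf a b c θ γ I) : IsRecurrent a b c γ I := by
  obtain ⟨t₀, X, Y, hXY, hR, hL⟩ := hγ.ends h hθ
  refine ⟨?_, ?_, ?_⟩
  · rcases hR with hR | ⟨-, τ, hτ, hτ0⟩
    · exact Or.inl (isRecurrentAlong_of_atTop h hθ hXY hR)
    · rcases hL with hL | ⟨-, τ', hτ', hτ0'⟩
      · exact Or.inr (isRecurrentAlong_of_atBot h hθ hXY hL)
      · have := lineFactor_zero_unique h hs hirr hτ0 hτ0'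
        linarith
  · exact hR.imp (isRecurrentAlong_of_atTop h hθ hXY) And.left
  · exact hL.imp (isRecurrentAlong_of_atBot h hθ hXY) And.left

lemma lineCurve_periodic {θ : ℝ} (hθ : 0 < Real.cos θ) {τ₀ : ℝ} {m n : ℤ}
    (h1 : τ₀ * Real.cos θ = 2 * m * halfPeriod b c a)
    (h2 : τ₀ * Real.sin θ = 2 * n * halfPeriod b a c) (X Y : ℝ) :
    Function.Periodic (lineCurve a b c θ X Y) (prim (lineFactor a b c θ X Y) τ₀) := by
  intro s
  have hf : lineFactor a b c θ (X + 2 * m * halfPeriod b c a) (Y + 2 * n * halfPeriod b a c) =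
      lineFactor a b c θ X Y := by
    ext τ
    rw [lineFactor, lineFactor, ← flatFactor_add_periods h (X + τ * Real.cos θ) (Y + τ * Real.sin θ) m n]
    congr 1 <;> ring
  rw [add_comm, lineCurve_add h hθ, lineTime, (isClock_lineFactor h hθ X Y).primInv_prim, h1, h2,
    lineCurve, lineTime, hf, ← lineTime, lineCurve, 
    ← flatPt_add_periods h (X + lineTime a b c θ X Y s * Real.cos θ)
      (Y + lineTime a b c θ X Y s * Real.sin θ) m n]
  congr 1 <;> ring

theorem IsLeaf.isClosedLeaf {γ : ℝ → E3} {I : Set ℝ} {θ : ℝ} (hθ : 0 < Real.cos θ)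
    (hs : Real.sin θ ≠ 0)
    (hrat : Real.cos θ * halfPeriod b a c / (Real.sin θ * halfPeriod b c a) ∈
      Set.range ((↑) : ℚ → ℝ))
    (hγ : IsLeaf a b c θ γ I) (hsep : ¬ IsUmbilicSeparatrix a b c γ I) : IsClosedLeaf γ I := by
  obtain ⟨t₀, X, Y, hXY, hR, hL⟩ := hγ.ends h hθ
  have hR' : Ici t₀ ⊆ I := hR.resolve_right fun h1 => hsep (Or.inl h1.1)
  have hL' : Iic t₀ ⊆ I := hL.resolve_right fun h1 => hsep (Or.inr h1.1)
  have hI : I = univ := by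
    refine eq_univ_of_forall fun t => ?_
    rcases le_total t₀ t with ht | ht
    · exact hR' ht
    · exact hL' ht
  have hK1 := h.nodeP.halfPeriod_pos
  have hK2 := h.nodeQ.halfPeriod_pos
  obtain ⟨τ₀, m, n, hτ₀, h1, h2⟩ : ∃ (τ₀ : ℝ) (m n : ℤ), 0 < τ₀ ∧
      τ₀ * Real.cos θ = 2 * m * halfPeriod b c a ∧
      τ₀ * Real.sin θ = 2 * n * halfPeriod b a c := by
    obtain ⟨r, hr⟩ := hrat
    have hden : (0 : ℝ) < r.den := by exact_mod_cast r.pos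
    have hr' : (r.num : ℝ) * (Real.sin θ * halfPeriod b c a) =
        r.den * (Real.cos θ * halfPeriod b a c) := by
      rw [Rat.cast_def, div_eq_div_iff hden.ne' (mul_ne_zero hs hK1.ne')] at hr
      linarith
    -- `τ₀` is the flat length over which `Y` gains `2 r.den K₂`, and `X` then gains `2 r.num K₁`.
    -- If `sin θ < 0`, both counts change sign to keep `τ₀` positive.
    rcases lt_or_gt_of_ne hs with hs' | hs'
    · refine ⟨-(2 * r.den * halfPeriod b a c / Real.sin θ), -r.num, -r.den, ?_, ?_, ?_⟩
      · rw [neg_pos]; exact div_neg_of_pos_of_neg (by positivity) hs'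
      · push_cast; field_simp; linarith
      · push_cast; field_simp
    · refine ⟨2 * r.den * halfPeriod b a c / Real.sin θ, r.num, r.den, by positivity, ?_, ?_⟩
      · field_simp; linarith
      · push_cast; field_simp
  refine ⟨hI, prim (lineFactor a b c θ X Y) τ₀, ?_, fun t => ?_⟩
  · have := (isClock_lineFactor h hθ X Y).mono hτ₀
    rwa [prim_zero] at this
  · rw [hXY _ (hI ▸ mem_univ _), hXY _ (hI ▸ mem_univ _), add_sub_right_comm,
      lineCurve_periodic h hθ h1 h2 X Y]

end

/-! ### The length element of the ellipse and the integrals `s₁`, `s₂` -/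

lemma image_Ioo_of_strictAntiOn {f : ℝ → ℝ} {x y : ℝ} (hxy : x ≤ y) (hc : ContinuousOn f (Icc x y))
    (hf : StrictAntiOn f (Icc x y)) : f '' Ioo x y = Ioo (f y) (f x) := by
  refine Subset.antisymm ?_ (intermediate_value_Ioo' hxy hc)
  rintro _ ⟨t, ht, rfl⟩
  exact ⟨hf (Ioo_subset_Icc_self ht) (right_mem_Icc.2 hxy) ht.2,
    hf (left_mem_Icc.2 hxy) (Ioo_subset_Icc_self ht) ht.1⟩

lemma image_Ioo_of_strictMonoOn {f : ℝ → ℝ} {x y : ℝ} (hxy : x ≤ y) (hc : ContinuousOn f (Icc x y))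
    (hf : StrictMonoOn f (Icc x y)) : f '' Ioo x y = Ioo (f x) (f y) := by
  refine Subset.antisymm ?_ (intermediate_value_Ioo hxy hc)
  rintro _ ⟨t, ht, rfl⟩
  exact ⟨hf (left_mem_Icc.2 hxy) (Ioo_subset_Icc_self ht) ht.1,
    hf (Ioo_subset_Icc_self ht) (right_mem_Icc.2 hxy) ht.2⟩

lemma continuous_conf (b m : ℝ) : Continuous (conf b m) := by unfold conf; fun_prop

lemma sin_sq_strictMonoOn : StrictMonoOn (fun t => Real.sin t ^ 2) (Icc 0 (Real.pi / 2)) := by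
  intro x hx y hy hxy
  have hpi := Real.pi_pos
  have h1 := Real.strictMonoOn_sin ⟨by linarith [hx.1], hx.2⟩ ⟨by linarith [hy.1], hy.2⟩ hxy
  have h0 := Real.sin_nonneg_of_nonneg_of_le_pi hx.1 (by linarith [hx.2])
  exact pow_lt_pow_left₀ h1 h0 two_ne_zero

lemma conf_strictMonoOn {b m : ℝ} (hbm : b < m) :
    StrictMonoOn (conf b m) (Icc 0 (Real.pi / 2)) := by
  intro x hx y hy hxy
  have := sin_sq_strictMonoOn hx hy hxy
  simp only at this
  rw [conf_eq_add, conf_eq_add]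
  nlinarith

lemma conf_strictAntiOn {b m : ℝ} (hbm : m < b) :
    StrictAntiOn (conf b m) (Icc 0 (Real.pi / 2)) := by
  intro x hx y hy hxy
  have := sin_sq_strictMonoOn hx hy hxy
  simp only at this
  rw [conf_eq_add, conf_eq_add]
  nlinarith

lemma sqrt_div_mul_sq {w D E : ℝ} (hD : 0 < D) : √(w / (D ^ 2 * E)) = √(w / E) / D := by
  rw [mul_comm, ← div_div, Real.sqrt_div' _ (sq_nonneg D), Real.sqrt_sq hD.le]

/-- Under `w = conf b m t` the factors `w - m` and `w - b` become squares of cosine and sine, whose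
roots cancel against the Jacobian. What remains is `2 * dens` on a quarter of the circle, that is,
half the circle once. -/
lemma IsNode.integral_conf {b m k : ℝ} (hn : IsNode b m k) :
    ∫ w in conf b m '' Ioo 0 (Real.pi / 2), √(w / |(w - m) * (w - b) * (w - k)|) =
      halfPeriod b m k := by
  have hpi := Real.pi_pos
  have hinj : InjOn (conf b m) (Ioo 0 (Real.pi / 2)) := by
    rcases lt_or_gt_of_ne (sub_ne_zero.1 hn.ne) with h1 | h1
    · exact (conf_strictMonoOn h1).injOn.mono Ioo_subset_Icc_self
    · exact (conf_strictAntiOn h1).injOn.mono Ioo_subset_Icc_self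
  rw [MeasureTheory.integral_image_eq_integral_abs_deriv_smul measurableSet_Ioo
    (fun t _ => (hasDerivAt_conf m t).hasDerivWithinAt) hinj]
  have h2 : halfPeriod b m k = ∫ t in Ioo 0 (Real.pi / 2), 2 * dens b m k t := by
    rw [MeasureTheory.integral_const_mul, ← MeasureTheory.integral_Ioc_eq_integral_Ioo,
      ← intervalIntegral.integral_of_le (by positivity)]
    have := hn.prim_half_pi
    rw [prim] at this
    rw [this]; ring
  rw [h2]
  refine MeasureTheory.setIntegral_congr_fun measurableSet_Ioo fun t ht => ?_
  have hs : 0 < Real.sin t := Real.sin_pos_of_pos_of_lt_pi ht.1 (by linarith [ht.2])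
  have hc : 0 < Real.cos t := Real.cos_pos_of_mem_Ioo ⟨by linarith [ht.1], ht.2⟩
  have hbm : 0 < |b - m| := abs_pos.2 hn.ne
  have e1 : |(conf b m t - m) * (conf b m t - b) * (conf b m t - k)| =
      (|b - m| * (Real.sin t * Real.cos t)) ^ 2 * |k - conf b m t| := by
    have f1 : conf b m t - m = (b - m) * Real.cos t ^ 2 := by rw [conf_eq_add']; ring
    have f2 : conf b m t - b = (m - b) * Real.sin t ^ 2 := by rw [conf_eq_add]; ring
    rw [abs_mul, f1, f2, abs_sub_comm _ k, ← sq_abs, mul_pow, sq_abs, abs_mul,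
      abs_mul, abs_mul, abs_sub_comm m b, abs_of_pos (pow_pos hs 2), abs_of_pos (pow_pos hc 2)]
    ring
  have e2 : |-(2 * (b - m) * Real.sin t * Real.cos t)| =
      2 * (|b - m| * (Real.sin t * Real.cos t)) := by
    rw [abs_neg, abs_mul, abs_mul, abs_mul, abs_of_pos hs, abs_of_pos hc, abs_two]; ring
  have hD : 0 < |b - m| * (Real.sin t * Real.cos t) := by positivity
  simp only [smul_eq_mul]
  rw [e1, e2, sqrt_div_mul_sq hD, dens]
  field_simp

/-- The coefficient of the length element on the ellipse, without the factor `sin α` or `cos α`. -/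
noncomputable def arcDens (b m k φ : ℝ) : ℝ :=
  √(conf m k φ / |(conf m k φ - m) * (conf m k φ - b) * (conf m k φ - k)|) *
    |2 * (k - m) * Real.sin φ * Real.cos φ|

/-- The angle on the ellipse, as a function of the elliptic angle. -/
noncomputable def arcAngle (b m k p : ℝ) : ℝ :=
  Real.arcsin (√((b - m) / (k - m)) * Real.cos p)

namespace IsNode

variable {b m k : ℝ} (hn : IsNode b m k)
include hn

lemma ratio_pos : 0 < (b - m) / (k - m) := by
  have h1 := hn.hbetween
  have h2 : 0 < (b - m) * (k - m) := by nlinarith [sq_nonneg (b - m)]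
  have h3 : k - m ≠ 0 := fun h0 => by simp [h0] at h2
  have : (b - m) / (k - m) = (b - m) * (k - m) / (k - m) ^ 2 := by field_simp
  rw [this]
  positivity

lemma km_ne : k - m ≠ 0 := fun h0 => by
  have := hn.ratio_pos
  simp [h0] at this

lemma ratio_lt_one : (b - m) / (k - m) < 1 := by
  have h1 := hn.hbetween
  have h3 := hn.km_ne
  have h5 := hn.sub_ne
  have h2 : 0 < (k - b) * (k - m) := by
    have : 0 < (k - b) ^ 2 := by positivity
    nlinarith
  have : 1 - (b - m) / (k - m) = (k - b) * (k - m) / (k - m) ^ 2 := by field_simp; ring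
  have h4 : 0 < 1 - (b - m) / (k - m) := by rw [this]; positivity
  linarith

lemma sqrt_ratio_lt_one : √((b - m) / (k - m)) < 1 := by
  rw [Real.sqrt_lt' one_pos]; simpa using hn.ratio_lt_one

lemma sqrt_ratio_pos : 0 < √((b - m) / (k - m)) := Real.sqrt_pos.2 hn.ratio_pos

lemma ratio_mul_cos_mem (p : ℝ) : √((b - m) / (k - m)) * Real.cos p ∈ Ioo (-1 : ℝ) 1 := by
  rw [mem_Ioo, ← abs_lt, abs_mul, abs_of_pos hn.sqrt_ratio_pos]
  have := hn.sqrt_ratio_pos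
  calc _ ≤ √((b - m) / (k - m)) * 1 := by gcongr; exact Real.abs_cos_le_one p
    _ < 1 := by rw [mul_one]; exact hn.sqrt_ratio_lt_one

lemma sin_arcAngle (p : ℝ) :
    Real.sin (arcAngle b m k p) = √((b - m) / (k - m)) * Real.cos p :=
  Real.sin_arcsin (hn.ratio_mul_cos_mem p).1.le (hn.ratio_mul_cos_mem p).2.le

omit hn in
lemma cos_arcAngle (p : ℝ) :
    Real.cos (arcAngle b m k p) = √(1 - (√((b - m) / (k - m)) * Real.cos p) ^ 2) :=
  Real.cos_arcsin _

lemma cos_arcAngle_pos (p : ℝ) : 0 < Real.cos (arcAngle b m k p) := by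
  rw [cos_arcAngle]
  refine Real.sqrt_pos.2 ?_
  have := hn.ratio_mul_cos_mem p
  nlinarith [this.1, this.2]

/-- The two descriptions of a point of an arc agree: `arcAngle` carries the elliptic angle to the
eccentric angle with the same confocal parameter. -/
lemma conf_arcAngle (p : ℝ) : conf m k (arcAngle b m k p) = conf b m p := by
  have := hn.km_ne
  rw [conf_eq_add, hn.sin_arcAngle, mul_pow, Real.sq_sqrt hn.ratio_pos.le, conf_eq_add']
  field_simp

lemma hasDerivAt_arcAngle (p : ℝ) : HasDerivAt (arcAngle b m k)
    (-(√((b - m) / (k - m)) * Real.sin p) / Real.cos (arcAngle b m k p)) p := by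
  have h1 := Real.hasDerivAt_arcsin (hn.ratio_mul_cos_mem p).1.ne' (hn.ratio_mul_cos_mem p).2.ne
  have h2 := h1.comp p ((Real.hasDerivAt_cos p).const_mul √((b - m) / (k - m)))
  refine h2.congr_deriv ?_
  rw [cos_arcAngle]; ring

omit hn in
lemma continuous_arcAngle : Continuous (arcAngle b m k) := by
  unfold arcAngle; fun_prop

lemma arcAngle_strictAntiOn : StrictAntiOn (arcAngle b m k) (Icc 0 Real.pi) := by
  intro x hx y hy hxy
  have h1 := Real.strictAntiOn_cos hx hy hxy
  exact Real.strictMonoOn_arcsin (Ioo_subset_Icc_self (hn.ratio_mul_cos_mem y))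
    (Ioo_subset_Icc_self (hn.ratio_mul_cos_mem x))
    (mul_lt_mul_of_pos_left h1 hn.sqrt_ratio_pos)

/-- The factors `w - m` and `w - k` are squares that cancel against the derivative of `w`. At `p = π
/ 2` the left side is `√(w / 0) * 0 = 0` in Lean, so this one point is excluded; it has measure
zero. -/
lemma arcDens_arcAngle {p : ℝ} (hp : p ∈ Ioo 0 Real.pi) (hp2 : p ≠ Real.pi / 2) :
    |-(√((b - m) / (k - m)) * Real.sin p) / Real.cos (arcAngle b m k p)| *
      arcDens b m k (arcAngle b m k p) = 2 * dens b m k p := by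
  have hs : 0 < Real.sin p := Real.sin_pos_of_pos_of_lt_pi hp.1 hp.2
  have hcp : Real.cos p ≠ 0 := by
    intro h0
    have h1 : Real.cos p = Real.cos (Real.pi / 2) := by rw [h0, Real.cos_pi_div_two]
    have hpi := Real.pi_pos
    exact hp2 (Real.injOn_cos (Ioo_subset_Icc_self hp) ⟨by linarith, by linarith⟩ h1)
  have hC := hn.cos_arcAngle_pos p
  have hκ := hn.sqrt_ratio_pos
  have hS : 0 < |Real.sin (arcAngle b m k p)| := by
    rw [abs_pos, hn.sin_arcAngle]; exact mul_ne_zero hκ.ne' hcp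
  have hkm : 0 < |k - m| := abs_pos.2 hn.km_ne
  have hbm : 0 < |b - m| := abs_pos.2 hn.ne
  have hw := hn.conf_arcAngle p
  have g1 : conf m k (arcAngle b m k p) - m = (k - m) * Real.sin (arcAngle b m k p) ^ 2 := by
    rw [conf_eq_add]; ring
  have g2 : conf m k (arcAngle b m k p) - k = -((k - m) * Real.cos (arcAngle b m k p) ^ 2) := by
    rw [conf_eq_add']; ring
  have g3 : conf m k (arcAngle b m k p) - b = (m - b) * Real.sin p ^ 2 := by
    rw [hw, conf_eq_add]; ring
  have e1 : |(conf m k (arcAngle b m k p) - m) * (conf m k (arcAngle b m k p) - b) *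
      (conf m k (arcAngle b m k p) - k)| =
      (|k - m| * (|Real.sin (arcAngle b m k p)| * Real.cos (arcAngle b m k p)) * Real.sin p) ^ 2 *
        |b - m| := by
    rw [g1, g2, g3, abs_mul, abs_mul, abs_mul, abs_mul, abs_neg, abs_mul, abs_sub_comm m b,
      abs_of_pos (pow_pos hs 2), abs_of_pos (pow_pos hC 2), abs_pow]
    ring
  have e2 : |k - conf b m p| = Real.cos (arcAngle b m k p) ^ 2 * |k - m| := by
    rw [← hw, ← abs_neg, neg_sub, g2, abs_neg, abs_mul, abs_of_pos (pow_pos hC 2), mul_comm]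
  have e3 : √((b - m) / (k - m)) = √|b - m| / √|k - m| := by
    rw [← Real.sqrt_div hbm.le, ← abs_div, abs_of_pos hn.ratio_pos]
  have hsb := Real.sqrt_pos.2 hbm
  have hsk := Real.sqrt_pos.2 hkm
  have hsk2 := Real.mul_self_sqrt hkm.le
  rw [arcDens, e1, sqrt_div_mul_sq (by positivity), dens, e2, hw,
    sqrt_div_mul_sq hC, Real.sqrt_div' _ hbm.le, Real.sqrt_div' _ hkm.le, abs_div, abs_neg, abs_mul,
    abs_mul, abs_mul, abs_mul, abs_of_pos hs, abs_of_pos hC, abs_of_pos hκ, e3, abs_two]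
  field_simp

/-- The length element is unbounded near the umbilic points, so integrability is obtained from the
change of variables too, as integrability of the continuous density. -/
lemma arcDens_integral {p : ℝ} (hp : p ∈ Icc 0 Real.pi) :
    IntervalIntegrable (arcDens b m k) MeasureTheory.volume (arcAngle b m k p)
      (arcAngle b m k 0) ∧
    ∫ φ in (arcAngle b m k p)..(arcAngle b m k 0), arcDens b m k φ =
      2 * prim (dens b m k) p := by
  have hanti := hn.arcAngle_strictAntiOn.mono (Icc_subset_Icc_right hp.2)
  have hcont := continuous_arcAngle (b := b) (m := m) (k := k)
  have himg := image_Ioo_of_strictAntiOn hp.1 hcont.continuousOn hanti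
  have hle : arcAngle b m k p ≤ arcAngle b m k 0 :=
    hn.arcAngle_strictAntiOn.antitoneOn ⟨le_rfl, Real.pi_pos.le⟩ hp hp.1
  have hinj := hanti.injOn.mono (Ioo_subset_Icc_self)
  have hder : ∀ t ∈ Ioo 0 p, HasDerivWithinAt (arcAngle b m k)
      (-(√((b - m) / (k - m)) * Real.sin t) / Real.cos (arcAngle b m k t)) (Ioo 0 p) t :=
    fun t _ => (hn.hasDerivAt_arcAngle t).hasDerivWithinAt
  have hae : ∀ᵐ t, t ∈ Ioo 0 p → 2 * dens b m k t =
      |-(√((b - m) / (k - m)) * Real.sin t) / Real.cos (arcAngle b m k t)| •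
        arcDens b m k (arcAngle b m k t) := by
    filter_upwards [(countable_singleton (Real.pi / 2)).ae_notMem MeasureTheory.volume] with t ht ht'
    rw [smul_eq_mul, hn.arcDens_arcAngle ⟨ht'.1, ht'.2.trans_le hp.2⟩ ht]
  have hcd := hn.continuous_dens
  constructor
  · rw [intervalIntegrable_iff_integrableOn_Ioo_of_le hle, ← himg,
      MeasureTheory.integrableOn_image_iff_integrableOn_abs_deriv_smul measurableSet_Ioo hder hinj]
    refine MeasureTheory.IntegrableOn.congr_fun_ae (f := fun t => 2 * dens b m k t) ?_
      ((MeasureTheory.ae_restrict_iff' measurableSet_Ioo).2 hae)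
    have : IntervalIntegrable (fun t => 2 * dens b m k t) MeasureTheory.volume 0 p :=
      (continuous_const.mul hcd).intervalIntegrable _ _
    exact (intervalIntegrable_iff_integrableOn_Ioo_of_le hp.1).1 this
  · rw [intervalIntegral.integral_of_le hle, MeasureTheory.integral_Ioc_eq_integral_Ioo, ← himg,
      MeasureTheory.integral_image_eq_integral_abs_deriv_smul measurableSet_Ioo hder hinj,
      ← MeasureTheory.setIntegral_congr_ae measurableSet_Ioo hae,
      ← MeasureTheory.integral_Ioc_eq_integral_Ioo, ← intervalIntegral.integral_of_le hp.1, prim,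
      intervalIntegral.integral_const_mul]

end IsNode

section

variable {a b c : ℝ} (h : IsTriaxial a b c)
include h

lemma s₁_eq (α : ℝ) : s₁ a b c α = 2 * Real.sin α * halfPeriod b c a := by
  rw [s₁, intervalIntegral.integral_const_mul, mul_assoc]
  congr 2
  have hpi := Real.pi_pos
  rw [← h.nodeP.integral_conf, image_Ioo_of_strictAntiOn (by positivity)
    (continuous_conf b c).continuousOn (conf_strictAntiOn h.hbc),
    intervalIntegral.integral_of_le h.hbc.le, MeasureTheory.integral_Ioc_eq_integral_Ioo]
  simp only [conf, Real.sin_zero, Real.cos_zero, Real.sin_pi_div_two, Real.cos_pi_div_two]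
  norm_num
  refine MeasureTheory.setIntegral_congr_fun measurableSet_Ioo fun w hw => ?_
  have hab := h.hab
  have : 0 ≤ (w - a) * (w - b) * (w - c) :=
    mul_nonneg (mul_nonneg_of_nonpos_of_nonpos (by linarith [hw.2]) (by linarith [hw.2]))
      (by linarith [hw.1])
  simp only [H]
  rw [← abs_mul, ← abs_mul, abs_of_nonneg (by linarith)]
  congr 2; ring

lemma s₂_eq (α : ℝ) : s₂ a b c α = 2 * Real.cos α * halfPeriod b a c := by
  rw [s₂, intervalIntegral.integral_const_mul, mul_assoc]
  congr 2
  have hpi := Real.pi_pos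
  rw [← h.nodeQ.integral_conf, image_Ioo_of_strictMonoOn (by positivity)
    (continuous_conf b a).continuousOn (conf_strictMonoOn h.hab),
    intervalIntegral.integral_of_le h.hab.le, MeasureTheory.integral_Ioc_eq_integral_Ioo]
  simp only [conf, Real.sin_zero, Real.cos_zero, Real.sin_pi_div_two, Real.cos_pi_div_two]
  norm_num
  refine MeasureTheory.setIntegral_congr_fun measurableSet_Ioo fun w hw => ?_
  have hbc := h.hbc
  have : (w - a) * (w - b) * (w - c) ≤ 0 :=
    mul_nonpos_of_nonpos_of_nonneg (mul_nonpos_of_nonpos_of_nonneg (by linarith [hw.2])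
      (by linarith [hw.1])) (by linarith [hw.1])
  simp only [H]
  rw [← abs_mul, ← abs_mul, abs_of_nonpos (by linarith)]

/-- This identifies `ρ` with the inverse slope of the leaves measured in the lattice of half
periods; its rationality decides the dynamics of the lines. -/
lemma rho_eq (α : ℝ) : rho a b c α =
    Real.cos α * halfPeriod b a c / (Real.sin α * halfPeriod b c a) := by
  rw [rho, s₁_eq h, s₂_eq h, mul_assoc, mul_assoc, mul_div_mul_left _ _ two_ne_zero]

end

section

variable {a b c : ℝ}

lemma ellCoord_eq (a c φ : ℝ) : ellCoord a c φ = conf c a φ := by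
  rw [ellCoord, conf]; ring

lemma deriv_ellCoord (a c φ : ℝ) :
    deriv (ellCoord a c) φ = 2 * (a - c) * Real.sin φ * Real.cos φ := by
  rw [show ellCoord a c = conf c a from funext (ellCoord_eq a c), (hasDerivAt_conf a φ).deriv]
  ring

lemma lengthElement_eq (α φ : ℝ) : lengthElement a b c α φ =
    (if conf c a φ < b then Real.sin α * √(conf c a φ / H a b c (conf c a φ))
      else Real.cos α * √(conf c a φ / (-H a b c (conf c a φ)))) *
    |2 * (a - c) * Real.sin φ * Real.cos φ| := by
  rw [lengthElement, deriv_ellCoord, ellCoord_eq]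

lemma lengthElement_periodic (α : ℝ) : Function.Periodic (lengthElement a b c α) Real.pi := by
  intro φ
  rw [lengthElement_eq, lengthElement_eq, conf_add_pi, Real.sin_add_pi, Real.cos_add_pi]
  congr 2; ring

variable (h : IsTriaxial a b c)
include h

lemma conf_mem_Icc (φ : ℝ) : conf c a φ ∈ Icc c a := by
  have hac := h.hac
  have h1 := Real.sin_sq_le_one φ
  constructor
  · rw [conf_eq_add]; nlinarith [sq_nonneg (Real.sin φ)]
  · rw [conf_eq_add]; nlinarith [sq_nonneg (Real.sin φ)]

lemma lengthElement_of_lt (α : ℝ) {φ : ℝ} (hφ : conf c a φ < b) :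
    lengthElement a b c α φ = Real.sin α * arcDens b c a φ := by
  have hmem := conf_mem_Icc h φ
  have hab := h.hab
  have : 0 ≤ H a b c (conf c a φ) :=
    mul_nonneg (mul_nonneg_of_nonpos_of_nonpos (by linarith) (by linarith)) (by linarith [hmem.1])
  rw [lengthElement_eq, if_pos hφ, arcDens, ← abs_of_nonneg this, H, mul_assoc]
  congr 5
  ring

/-- Passing to the complementary angle exchanges `a` and `c`, so these arcs reduce to the same
`arcDens`. -/
lemma lengthElement_of_gt (α : ℝ) {φ : ℝ} (hφ : b ≤ conf c a φ) :
    lengthElement a b c α φ = Real.cos α * arcDens b a c (Real.pi / 2 - φ) := by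
  have hmem := conf_mem_Icc h φ
  have hbc := h.hbc
  have hH : H a b c (conf c a φ) ≤ 0 :=
    mul_nonpos_of_nonpos_of_nonneg (mul_nonpos_of_nonpos_of_nonneg (by linarith [hmem.2])
      (by linarith)) (by linarith)
  have hw : conf a c (Real.pi / 2 - φ) = conf c a φ := by
    rw [conf, conf, Real.sin_pi_div_two_sub, Real.cos_pi_div_two_sub]; ring
  rw [lengthElement_eq, if_neg (not_lt.2 hφ), arcDens, hw, ← abs_of_nonpos hH, H, mul_assoc,
    Real.sin_pi_div_two_sub, Real.cos_pi_div_two_sub]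
  congr 2
  rw [← abs_neg]
  congr 1; ring

lemma conf_arcAngle_lt {t : ℝ} (ht : t ∈ Ioo 0 Real.pi) :
    conf c a (arcAngle b c a t) < b := by
  rw [h.nodeP.conf_arcAngle, conf_eq_add]
  have hs := Real.sin_pos_of_pos_of_lt_pi ht.1 ht.2
  have := h.hbc
  have : 0 < Real.sin t ^ 2 := by positivity
  nlinarith

lemma lt_conf_arcAngle {t : ℝ} (ht : t ∈ Ioo 0 Real.pi) :
    b < conf a c (arcAngle b a c t) := by
  rw [h.nodeQ.conf_arcAngle, conf_eq_add]
  have hs := Real.sin_pos_of_pos_of_lt_pi ht.1 ht.2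
  have := h.hab
  have : 0 < Real.sin t ^ 2 := by positivity
  nlinarith

/-- The length of the arcs of the ellipse on which `v = b`. -/
lemma lengthElement_integral_u (α : ℝ) {p : ℝ} (hp : p ∈ Icc 0 Real.pi) :
    IntervalIntegrable (lengthElement a b c α) MeasureTheory.volume (arcAngle b c a p)
      (arcAngle b c a 0) ∧
    ∫ φ in (arcAngle b c a p)..(arcAngle b c a 0), lengthElement a b c α φ =
      2 * Real.sin α * prim (dens b c a) p := by
  have hn := h.nodeP
  obtain ⟨hi, hv⟩ := hn.arcDens_integral hp
  have hle : arcAngle b c a p ≤ arcAngle b c a 0 :=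
    hn.arcAngle_strictAntiOn.antitoneOn ⟨le_rfl, Real.pi_pos.le⟩ hp hp.1
  have himg := image_Ioo_of_strictAntiOn hp.1
    (IsNode.continuous_arcAngle (b := b) (m := c) (k := a)).continuousOn
    (hn.arcAngle_strictAntiOn.mono (Icc_subset_Icc_right hp.2))
  have heq : EqOn (fun φ => Real.sin α * arcDens b c a φ) (lengthElement a b c α)
      (Ioo (arcAngle b c a p) (arcAngle b c a 0)) := by
    rw [← himg]
    rintro _ ⟨t, ht, rfl⟩
    exact (lengthElement_of_lt h α (conf_arcAngle_lt h ⟨ht.1, ht.2.trans_le hp.2⟩)).symm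
  constructor
  · rw [intervalIntegrable_iff_integrableOn_Ioo_of_le hle]
    exact ((intervalIntegrable_iff_integrableOn_Ioo_of_le hle).1 (hi.const_mul _)).congr_fun heq
      measurableSet_Ioo
  · rw [intervalIntegral.integral_of_le hle, MeasureTheory.integral_Ioc_eq_integral_Ioo,
      ← MeasureTheory.setIntegral_congr_fun measurableSet_Ioo heq,
      ← MeasureTheory.integral_Ioc_eq_integral_Ioo, ← intervalIntegral.integral_of_le hle,
      intervalIntegral.integral_const_mul, hv]
    ring

/-- Both describe the eccentric angle of the umbilic point `p₁`, once from each axis; there the two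
kinds of arcs join. -/
lemma arcAngle_zero_add : arcAngle b c a 0 + arcAngle b a c 0 = Real.pi / 2 := by
  have h1 := h.nodeQ.ratio_pos
  have hac := h.hac
  have hca : c - a ≠ 0 := by linarith
  simp only [arcAngle, Real.cos_zero, mul_one]
  have e : (b - c) / (a - c) = 1 - √((b - a) / (c - a)) ^ 2 := by
    rw [Real.sq_sqrt h1.le, ← neg_div_neg_eq (b - a), neg_sub, neg_sub]
    field_simp; ring
  rw [e, ← Real.arccos_eq_arcsin (Real.sqrt_nonneg _), Real.arccos]
  ring

/-- The length of the arcs of the ellipse on which `u = b`. -/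
lemma lengthElement_integral_v (α : ℝ) {q : ℝ} (hq : q ∈ Icc 0 Real.pi) :
    IntervalIntegrable (lengthElement a b c α) MeasureTheory.volume (arcAngle b c a 0)
      (Real.pi / 2 - arcAngle b a c q) ∧
    ∫ φ in (arcAngle b c a 0)..(Real.pi / 2 - arcAngle b a c q), lengthElement a b c α φ =
      2 * Real.cos α * prim (dens b a c) q := by
  have hn := h.nodeQ
  obtain ⟨hi, hv⟩ := hn.arcDens_integral hq
  have hle : arcAngle b a c q ≤ arcAngle b a c 0 :=
    hn.arcAngle_strictAntiOn.antitoneOn ⟨le_rfl, Real.pi_pos.le⟩ hq hq.1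
  have himg := image_Ioo_of_strictAntiOn hq.1
    (IsNode.continuous_arcAngle (b := b) (m := a) (k := c)).continuousOn
    (hn.arcAngle_strictAntiOn.mono (Icc_subset_Icc_right hq.2))
  have h0 : arcAngle b c a 0 = Real.pi / 2 - arcAngle b a c 0 := by
    linarith [arcAngle_zero_add h]
  have heq : EqOn (fun φ => Real.cos α * arcDens b a c φ)
      (fun φ => lengthElement a b c α (Real.pi / 2 - φ))
      (Ioo (arcAngle b a c q) (arcAngle b a c 0)) := by
    rw [← himg]
    rintro _ ⟨t, ht, rfl⟩
    have hlt := lt_conf_arcAngle h (t := t) ⟨ht.1, ht.2.trans_le hq.2⟩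
    have hw : conf c a (Real.pi / 2 - arcAngle b a c t) = conf a c (arcAngle b a c t) := by
      rw [conf, conf, Real.sin_pi_div_two_sub, Real.cos_pi_div_two_sub]; ring
    have := lengthElement_of_gt h α (φ := Real.pi / 2 - arcAngle b a c t) (by rw [hw]; exact hlt.le)
    rw [sub_sub_cancel] at this
    exact this.symm
  constructor
  · have h1 : IntervalIntegrable (fun φ => lengthElement a b c α (Real.pi / 2 - φ))
        MeasureTheory.volume (arcAngle b a c q) (arcAngle b a c 0) := by
      rw [intervalIntegrable_iff_integrableOn_Ioo_of_le hle]
      exact ((intervalIntegrable_iff_integrableOn_Ioo_of_le hle).1 (hi.const_mul _)).congr_fun heq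
        measurableSet_Ioo
    have h2 := (h1.comp_sub_left (Real.pi / 2)).symm
    simp only [sub_sub_cancel] at h2
    rw [h0]
    exact h2
  · rw [h0, ← intervalIntegral.integral_comp_sub_left, intervalIntegral.integral_of_le hle,
      MeasureTheory.integral_Ioc_eq_integral_Ioo,
      ← MeasureTheory.setIntegral_congr_fun measurableSet_Ioo heq,
      ← MeasureTheory.integral_Ioc_eq_integral_Ioo, ← intervalIntegral.integral_of_le hle,
      intervalIntegral.integral_const_mul, hv]
    ring

omit h in
lemma arcAngle_pi (b m k : ℝ) : arcAngle b m k Real.pi = -arcAngle b m k 0 := by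
  simp [arcAngle, Real.arcsin_neg]

lemma lengthElement_integrable (α x y : ℝ) :
    IntervalIntegrable (lengthElement a b c α) MeasureTheory.volume x y := by
  have hpi := Real.pi_pos
  have h1 := (lengthElement_integral_u h α (p := Real.pi) ⟨hpi.le, le_rfl⟩).1
  have h2 := (lengthElement_integral_v h α (q := Real.pi) ⟨hpi.le, le_rfl⟩).1
  refine (lengthElement_periodic α).intervalIntegrable hpi.ne' (t := arcAngle b c a Real.pi) ?_ x y
  convert h1.trans h2 using 1
  rw [arcAngle_pi, arcAngle_pi]
  linarith [arcAngle_zero_add h]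

/-- The length coordinate on the ellipse, with origin the umbilic point `p₁`, as a function of the
eccentric angle. -/
noncomputable def arcLength (a b c α φ : ℝ) : ℝ :=
  ∫ τ in (arcAngle b c a 0)..φ, lengthElement a b c α τ

lemma integral_lengthElement (α φ ψ : ℝ) :
    ∫ τ in φ..ψ, lengthElement a b c α τ = arcLength a b c α ψ - arcLength a b c α φ :=
  (intervalIntegral.integral_interval_sub_left (lengthElement_integrable h α _ _)
    (lengthElement_integrable h α _ _)).symm

lemma arcLength_arcAngle_u (α : ℝ) {p : ℝ} (hp : p ∈ Icc 0 Real.pi) :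
    arcLength a b c α (arcAngle b c a p) = -(2 * Real.sin α * prim (dens b c a) p) := by
  rw [arcLength, intervalIntegral.integral_symm, (lengthElement_integral_u h α hp).2]

lemma arcLength_arcAngle_v (α : ℝ) {q : ℝ} (hq : q ∈ Icc 0 Real.pi) :
    arcLength a b c α (Real.pi / 2 - arcAngle b a c q) =
      2 * Real.cos α * prim (dens b a c) q :=
  (lengthElement_integral_v h α hq).2

lemma arcLength_add_pi (α φ : ℝ) : arcLength a b c α (φ + Real.pi) =
    arcLength a b c α φ + (s₁ a b c α + s₂ a b c α) := by
  have hpi := Real.pi_pos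
  have h1 := integral_lengthElement h α φ (φ + Real.pi)
  rw [(lengthElement_periodic α).intervalIntegral_add_eq φ (arcAngle b c a Real.pi),
    integral_lengthElement h, show arcAngle b c a Real.pi + Real.pi =
      Real.pi / 2 - arcAngle b a c Real.pi by
        rw [arcAngle_pi, arcAngle_pi]; linarith [arcAngle_zero_add h],
    arcLength_arcAngle_v h α ⟨hpi.le, le_rfl⟩, arcLength_arcAngle_u h α ⟨hpi.le, le_rfl⟩,
    ← halfPeriod, ← halfPeriod, ← s₁_eq h, ← s₂_eq h] at h1
  linarith

lemma continuous_arcLength (α : ℝ) : Continuous (arcLength a b c α) :=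
  intervalIntegral.continuous_primitive (lengthElement_integrable h α) _

omit h in
lemma lengthElement_nonneg {α : ℝ} (hs : 0 < Real.sin α) (hc : 0 < Real.cos α) (φ : ℝ) :
    0 ≤ lengthElement a b c α φ := by
  rw [lengthElement_eq]
  split_ifs <;> positivity

lemma lengthElement_pos {α : ℝ} (hs : 0 < Real.sin α) (hc : 0 < Real.cos α) {φ : ℝ}
    (h1 : Real.sin φ * Real.cos φ ≠ 0) (h2 : conf c a φ ≠ b) : 0 < lengthElement a b c α φ := by
  have hac := h.hac
  have hmem := conf_mem_Icc h φ
  have hs1 : Real.sin φ ≠ 0 := left_ne_zero_of_mul h1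
  have hc1 : Real.cos φ ≠ 0 := right_ne_zero_of_mul h1
  have hw : 0 < conf c a φ := h.hc.trans_le hmem.1
  have hd : 0 < |2 * (a - c) * Real.sin φ * Real.cos φ| := by
    rw [abs_pos]; exact mul_ne_zero (mul_ne_zero (by positivity) hs1) hc1
  have g1 : 0 < conf c a φ - c := by
    rw [conf_eq_add]
    have : 0 < Real.sin φ ^ 2 := by positivity
    nlinarith
  have g2 : conf c a φ - a < 0 := by
    rw [conf_eq_add']
    have : 0 < Real.cos φ ^ 2 := by positivity
    nlinarith
  rw [lengthElement_eq]
  refine mul_pos ?_ hd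
  split_ifs with hlt
  · refine mul_pos hs (Real.sqrt_pos.2 (div_pos hw ?_))
    exact mul_pos (mul_pos_of_neg_of_neg g2 (by linarith)) g1
  · refine mul_pos hc (Real.sqrt_pos.2 (div_pos hw (neg_pos.2 ?_)))
    have : 0 < conf c a φ - b := sub_pos.2 (lt_of_le_of_ne (not_lt.1 hlt) h2.symm)
    exact mul_neg_of_neg_of_pos (mul_neg_of_neg_of_pos g2 this) g1

omit h in
lemma countable_cos_eq (x : ℝ) : {t : ℝ | Real.cos t = x}.Countable := by
  rcases eq_empty_or_nonempty {t : ℝ | Real.cos t = x} with h0 | ⟨y, hy⟩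
  · rw [h0]; exact countable_empty
  · refine ((countable_range fun k : ℤ => 2 * k * Real.pi + y).union
      (countable_range fun k : ℤ => 2 * k * Real.pi - y)).mono fun t ht => ?_
    have : Real.cos y = Real.cos t := hy.trans (Eq.symm ht)
    obtain ⟨k, hk | hk⟩ := Real.cos_eq_cos_iff.1 this
    · exact Or.inl ⟨k, hk.symm⟩
    · exact Or.inr ⟨k, hk.symm⟩

lemma countable_lengthElement_eq_zero {α : ℝ} (hs : 0 < Real.sin α) (hc : 0 < Real.cos α) :
    {φ | lengthElement a b c α φ = 0}.Countable := by
  have hinj : Function.Injective fun t : ℝ => 2 * t := mul_right_injective₀ two_ne_zero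
  have key : ∀ x, {t : ℝ | Real.cos (2 * t) = x}.Countable := fun x =>
    (countable_cos_eq x).preimage hinj
  refine (((key 1).union (key (-1))).union (key ((a + c - 2 * b) / (a - c)))).mono fun φ hφ => ?_
  by_contra hnot
  simp only [mem_union, mem_ofPred_eq, not_or] at hnot
  obtain ⟨⟨n1, n2⟩, n3⟩ := hnot
  refine (lengthElement_pos h hs hc (φ := φ) ?_ ?_).ne' hφ
  · refine mul_ne_zero (fun h0 => n1 ?_) fun h0 => n2 ?_
    · rw [Real.cos_two_mul', h0]
      have := Real.sin_sq_add_cos_sq φ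
      rw [h0] at this
      linarith
    · rw [Real.cos_two_mul, h0]; ring
  · intro h0
    refine n3 ?_
    rw [conf_eq_add'] at h0
    rw [eq_div_iff h.hac.ne', Real.cos_two_mul]
    linarith

/-- The length element is nonnegative and vanishes only on a countable set. The default value of the
root makes it vanish at the axes and at the umbilic points, where the formula divides by zero. -/
lemma arcLength_strictMono {α : ℝ} (hs : 0 < Real.sin α) (hc : 0 < Real.cos α) :
    StrictMono (arcLength a b c α) := by
  intro x y hxy
  have h1 := integral_lengthElement h α x y
  have h2 : 0 < ∫ τ in x..y, lengthElement a b c α τ := by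
    rw [intervalIntegral.integral_pos_iff_support_of_nonneg_ae
      (Eventually.of_forall (lengthElement_nonneg hs hc)) (lengthElement_integrable h α x y)]
    refine ⟨hxy, ?_⟩
    have hZ := (countable_lengthElement_eq_zero h hs hc).measure_zero MeasureTheory.volume
    have : Ioc x y \ {φ | lengthElement a b c α φ = 0} ⊆
        Function.support (lengthElement a b c α) ∩ Ioc x y := fun t ht => ⟨ht.2, ht.1⟩
    refine lt_of_lt_of_le ?_ (MeasureTheory.measure_mono this)
    rw [MeasureTheory.measure_sdiff_null hZ, Real.volume_Ioc]
    simpa using hxy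
  linarith

end

/-! ### The length coordinate as a homeomorphism of the ellipse with the circle -/

section

/-- The induced map is a continuous bijection from a compact space to a Hausdorff one. -/
lemma exists_homeomorph_addCircle {T : Type*} [TopologicalSpace T] [T2Space T] {p : ℝ} (hp : 0 < p)
    {f : ℝ → T} (hf : Continuous f) (hsurj : Function.Surjective f)
    (hiff : ∀ x y, f x = f y ↔ ∃ n : ℤ, x - y = n * p) :
    ∃ e : AddCircle p ≃ₜ T, ∀ x : ℝ, e (x : AddCircle p) = f x := by
  have : Fact (0 < p) := ⟨hp⟩
  have hper : Function.Periodic f p := fun x => (hiff _ _).2 ⟨1, by simp⟩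
  have hc : Continuous hper.lift := hf.quotient_lift _
  have hb : Function.Bijective hper.lift := by
    constructor
    · intro u v
      induction u using QuotientAddGroup.induction_on with | H x =>
      induction v using QuotientAddGroup.induction_on with | H y =>
      intro huv
      obtain ⟨n, hn⟩ := (hiff x y).1 huv
      rw [← sub_eq_zero, ← QuotientAddGroup.mk_sub]
      exact (AddCircle.coe_eq_zero_iff p).2 ⟨n, by rw [hn]; simp⟩
    · intro t
      obtain ⟨x, rfl⟩ := hsurj t
      exact ⟨x, rfl⟩
  refine ⟨Continuous.homeoOfEquivCompactToT2 (f := Equiv.ofBijective _ hb) hc, fun x => rfl⟩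

lemma map_add_int_mul {L : ℝ → ℝ} {p : ℝ} (hp : 0 < p) (hper : ∀ x, L (x + p) = L x + 1) (x : ℝ)
    (n : ℤ) : L (x + n * p) = L x + n := by
  have h1 : Function.Periodic (fun x => L x - x / p) p := fun x => by
    simp only [hper]; field_simp; ring
  have h2 := h1.int_mul n x
  field_simp at h2
  refine mul_left_cancel₀ hp.ne' ?_
  linarith

lemma exists_homeomorph_unitAddCircle {L : ℝ → ℝ} {p : ℝ} (hp : 0 < p) (hc : Continuous L)
    (hm : StrictMono L) (hper : ∀ x, L (x + p) = L x + 1) :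
    ∃ e : AddCircle p ≃ₜ UnitAddCircle, ∀ x : ℝ, e (x : AddCircle p) = ((L x : ℝ) : UnitAddCircle) := by
  refine exists_homeomorph_addCircle hp (f := fun x => ((L x : ℝ) : UnitAddCircle))
    ((AddCircle.continuous_mk' 1).comp hc) ?_ ?_
  · intro u
    induction u using QuotientAddGroup.induction_on with | H y =>
    have hL : L p = L 0 + 1 := by rw [← hper, zero_add]
    obtain ⟨x, -, hx⟩ := intermediate_value_Icc hp.le hc.continuousOn
      (show L 0 + Int.fract (y - L 0) ∈ Icc (L 0) (L p) from
        ⟨by linarith [Int.fract_nonneg (y - L 0)], by linarith [Int.fract_lt_one (y - L 0)]⟩)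
    refine ⟨x, ?_⟩
    change ((L x : ℝ) : UnitAddCircle) = ((y : ℝ) : UnitAddCircle)
    rw [← sub_eq_zero, ← AddCircle.coe_sub, AddCircle.coe_eq_zero_iff]
    refine ⟨-⌊y - L 0⌋, ?_⟩
    have := Int.self_sub_floor (y - L 0)
    simp only [zsmul_eq_mul, Int.cast_neg, mul_one]
    linarith
  · intro x y
    rw [← sub_eq_zero, ← AddCircle.coe_sub, AddCircle.coe_eq_zero_iff]
    refine exists_congr fun n => ?_
    rw [zsmul_eq_mul, mul_one]
    constructor
    · intro h1
      have : L x = L (y + n * p) := by rw [map_add_int_mul hp hper]; linarith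
      linarith [hm.injective this]
    · intro h1
      rw [show x = y + n * p by linarith, map_add_int_mul hp hper]; ring

lemma ellipsePt_eq_iff {a c : ℝ} (ha : 0 < a) (hc : 0 < c) (x y : ℝ) :
    ellipsePt a c x = ellipsePt a c y ↔ ∃ n : ℤ, x - y = n * (2 * Real.pi) := by
  have h1 : ellipsePt a c x = ellipsePt a c y ↔
      Real.cos x = Real.cos y ∧ Real.sin x = Real.sin y := by
    have ha' := (Real.sqrt_pos.2 ha).ne'
    have hc' := (Real.sqrt_pos.2 hc).ne'
    constructor
    · intro h0
      have e0 := congrFun (congrArg WithLp.ofLp h0) 0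
      have e2 := congrFun (congrArg WithLp.ofLp h0) 2
      simp [ellipsePt] at e0 e2
      exact ⟨e0.resolve_right ha', e2.resolve_right hc'⟩
    · rintro ⟨e0, e2⟩
      rw [ellipsePt, e0, e2, ellipsePt]
  rw [h1]
  constructor
  · rintro ⟨e1, e2⟩
    obtain ⟨n, hn⟩ := Real.Angle.angle_eq_iff_two_pi_dvd_sub.1 (Real.Angle.cos_sin_inj e1 e2)
    exact ⟨n, by rw [hn]; ring⟩
  · rintro ⟨n, hn⟩
    rw [show x = y + n * (2 * Real.pi) by linarith]
    exact ⟨Real.cos_add_int_mul_two_pi _ _, Real.sin_add_int_mul_two_pi _ _⟩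

lemma ellipsePt_mem {a b c : ℝ} (h : IsTriaxial a b c) (φ : ℝ) :
    ellipsePt a c φ ∈ sigmaXZ a b c := by
  refine ⟨?_, by simp [ellipsePt]⟩
  have ha := h.ha
  have hc := h.hc
  simp [ellipsoid, ellipsePt, mul_pow, Real.sq_sqrt ha.le, Real.sq_sqrt hc.le]
  field_simp
  exact Real.cos_sq_add_sin_sq φ

lemma exists_ellipsePt {a b c : ℝ} (h : IsTriaxial a b c) {q : E3} (hq : q ∈ sigmaXZ a b c) :
    ∃ φ, ellipsePt a c φ = q := by
  have ha := Real.sqrt_pos.2 h.ha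
  have hc := Real.sqrt_pos.2 h.hc
  obtain ⟨h1, h2⟩ := hq
  have h3 : (q 0 / √a) ^ 2 + (q 2 / √c) ^ 2 = 1 := by
    rw [div_pow, div_pow, Real.sq_sqrt h.ha.le, Real.sq_sqrt h.hc.le]
    simpa [ellipsoid, h2] using h1
  have hn : ‖(⟨q 0 / √a, q 2 / √c⟩ : ℂ)‖ = 1 := by
    rw [← sq_eq_sq₀ (norm_nonneg _) zero_le_one, ← Complex.normSq_eq_norm_sq, Complex.normSq_mk]
    linarith
  refine ⟨Complex.arg ⟨q 0 / √a, q 2 / √c⟩, ?_⟩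
  have hne : (⟨q 0 / √a, q 2 / √c⟩ : ℂ) ≠ 0 := by
    rw [← norm_ne_zero_iff, hn]; exact one_ne_zero
  apply E3.ext
  · simp [ellipsePt, Complex.cos_arg hne, hn]; field_simp
  · simp [ellipsePt, h2]
  · simp [ellipsePt, Complex.sin_arg, hn]; field_simp

variable {a b c : ℝ} (h : IsTriaxial a b c)
include h

lemma s₁_pos {α : ℝ} (hs : 0 < Real.sin α) : 0 < s₁ a b c α := by
  have := h.nodeP.halfPeriod_pos
  rw [s₁_eq h]; positivity

lemma s₂_pos {α : ℝ} (hc : 0 < Real.cos α) : 0 < s₂ a b c α := by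
  have := h.nodeQ.halfPeriod_pos
  rw [s₂_eq h]; positivity

/-- The length coordinate of the ellipse. -/
lemma exists_lengthCoord {α : ℝ} (hs : 0 < Real.sin α) (hc : 0 < Real.cos α) :
    ∃ χ : sigmaXZ a b c ≃ₜ UnitAddCircle, ∀ (q : sigmaXZ a b c) (φ : ℝ),
      (q : E3) = ellipsePt a c φ →
      χ q = ((arcLength a b c α φ / (2 * (s₁ a b c α + s₂ a b c α)) : ℝ) : UnitAddCircle) := by
  have h1 := s₁_pos h hs
  have h2 := s₂_pos h hc
  obtain ⟨e, he⟩ := exists_homeomorph_addCircle (T := sigmaXZ a b c) Real.two_pi_pos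
    (f := fun φ => ⟨ellipsePt a c φ, ellipsePt_mem h φ⟩) (by
      refine Continuous.subtype_mk (continuous_E3 fun i => ?_) _
      fin_cases i <;> simp [ellipsePt] <;> fun_prop)
    (fun q => by
      obtain ⟨φ, hφ⟩ := exists_ellipsePt h q.2
      exact ⟨φ, Subtype.ext hφ⟩)
    (fun x y => by rw [Subtype.mk.injEq, ellipsePt_eq_iff h.ha h.hc])
  obtain ⟨e', he'⟩ := exists_homeomorph_unitAddCircle Real.two_pi_pos
    (L := fun φ => arcLength a b c α φ / (2 * (s₁ a b c α + s₂ a b c α)))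
    ((continuous_arcLength h α).div_const _)
    (fun x y hxy => by
      have := arcLength_strictMono h hs hc hxy
      simp only; gcongr)
    (fun x => by
      rw [show x + 2 * Real.pi = x + Real.pi + Real.pi by ring, arcLength_add_pi h,
        arcLength_add_pi h]
      field_simp; ring)
  refine ⟨e.symm.trans e', fun q φ hq => ?_⟩
  have : e.symm q = (φ : AddCircle (2 * Real.pi)) := by
    rw [Homeomorph.symm_apply_eq, he]; exact Subtype.ext hq
  rw [Homeomorph.trans_apply, this, he']

omit h in
lemma lengthTotal_half {S₁ S₂ : ℝ} (h0 : S₁ + S₂ ≠ 0) :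
    (S₁ + S₂) / (2 * (S₁ + S₂)) = 1 / 2 := by field_simp

/-- Links the sides of the rectangle to the eccentric angle: `Y = 0` traces the arc on which `v =
b`. -/
lemma flatPt_zero_right (X : ℝ) :
    flatPt a b c X 0 = ellipsePt a c (arcAngle b c a (ang b c a X)) := by
  have hac := h.hac
  rw [flatPt, h.nodeQ.ang_zero]
  apply E3.ext
  · simp only [ellipticPt, ellipsePt, IsNode.cos_arcAngle, scaleX, conf_eq_add', mul_pow,
      Real.sq_sqrt h.nodeP.ratio_pos.le]
    simp
    left; congr 1; field_simp; ring
  · simp [ellipticPt, ellipsePt]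
  · simp [ellipticPt, ellipsePt, h.nodeP.sin_arcAngle, scaleZ, conf]
    ring

lemma flatPt_zero_left (Y : ℝ) :
    flatPt a b c 0 Y = ellipsePt a c (Real.pi / 2 - arcAngle b a c (ang b a c Y)) := by
  have hac := h.hac
  have hca : c - a ≠ 0 := by linarith
  rw [flatPt, h.nodeP.ang_zero]
  apply E3.ext
  · simp only [ellipticPt, ellipsePt, Real.cos_pi_div_two_sub, h.nodeQ.sin_arcAngle, scaleX, conf]
    rw [← neg_div_neg_eq (b - a)]
    simp
    ring
  · simp [ellipticPt, ellipsePt]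
  · simp only [ellipticPt, ellipsePt, Real.sin_pi_div_two_sub, IsNode.cos_arcAngle, scaleZ,
      conf_eq_add', mul_pow, Real.sq_sqrt h.nodeQ.ratio_pos.le]
    simp
    left; congr 1; field_simp; ring

/-- `χ` is the length coordinate of the ellipse given by `arcLength`. -/
def IsArcCoord (a b c α : ℝ) (χ : sigmaXZ a b c → UnitAddCircle) : Prop :=
  ∀ (q : sigmaXZ a b c) (φ : ℝ), (q : E3) = ellipsePt a c φ →
    χ q = ((arcLength a b c α φ / (2 * (s₁ a b c α + s₂ a b c α)) : ℝ) : UnitAddCircle)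

variable {α : ℝ} {χ : sigmaXZ a b c → UnitAddCircle} (hχ : IsArcCoord a b c α χ)
include hχ

/-- On the four sides of `[0, K₁] × [0, K₂]` the coordinate `χ` is affine, of slope `2 sin α` in `X`
and `2 cos α` in `Y` up to sign and the total length. These are twice the coefficients of the
invariant `sin α X - cos α Y`, which is why this length is the right one. -/
lemma IsArcCoord.bottom {X : ℝ} (hX : X ∈ Icc 0 (halfPeriod b c a)) {q : sigmaXZ a b c}
    (hq : (q : E3) = flatPt a b c X 0) :
    χ q = ((-(2 * Real.sin α * X) / (2 * (s₁ a b c α + s₂ a b c α)) : ℝ) : UnitAddCircle) := by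
  have hn := h.nodeP
  rw [hχ q _ (hq.trans (flatPt_zero_right h X)), arcLength_arcAngle_u h, hn.prim_ang]
  rw [← hn.ang_zero, ← hn.ang_halfPeriod]
  exact ⟨hn.ang_strictMono.monotone hX.1, hn.ang_strictMono.monotone hX.2⟩

lemma IsArcCoord.left {Y : ℝ} (hY : Y ∈ Icc 0 (halfPeriod b a c)) {q : sigmaXZ a b c}
    (hq : (q : E3) = flatPt a b c 0 Y) :
    χ q = ((2 * Real.cos α * Y / (2 * (s₁ a b c α + s₂ a b c α)) : ℝ) : UnitAddCircle) := by
  have hn := h.nodeQ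
  rw [hχ q _ (hq.trans (flatPt_zero_left h Y)), arcLength_arcAngle_v h, hn.prim_ang]
  rw [← hn.ang_zero, ← hn.ang_halfPeriod]
  exact ⟨hn.ang_strictMono.monotone hY.1, hn.ang_strictMono.monotone hY.2⟩

variable (hs : 0 < Real.sin α) (hc : 0 < Real.cos α)
include hs hc

/-- The rotation by `π` about the `y` axis adds half the total length. It exchanges opposite sides
of the rectangle, so the top and right sides follow from the bottom and left ones. -/
lemma IsArcCoord.antipode {q r : sigmaXZ a b c}
    (hqr : (r : E3) = !₂[-(q : E3) 0, (q : E3) 1, -(q : E3) 2]) :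
    χ r = χ q + ((1 / 2 : ℝ) : UnitAddCircle) := by
  obtain ⟨φ, hφ⟩ := exists_ellipsePt h q.2
  have hr : (r : E3) = ellipsePt a c (φ + Real.pi) := by
    rw [hqr, ← hφ]
    apply E3.ext <;> simp [ellipsePt]
  rw [hχ q φ hφ.symm, hχ r _ hr, ← AddCircle.coe_add, arcLength_add_pi h, add_div,
    lengthTotal_half (add_pos (s₁_pos h hs) (s₂_pos h hc)).ne']

lemma IsArcCoord.top {X : ℝ} (hX : X ∈ Icc 0 (halfPeriod b c a)) {q : sigmaXZ a b c}
    (hq : (q : E3) = flatPt a b c X (halfPeriod b a c)) :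
    χ q = (((s₂ a b c α + 2 * Real.sin α * X) / (2 * (s₁ a b c α + s₂ a b c α)) : ℝ) :
      UnitAddCircle) := by
  have h1 := flatPt_add_halfPeriods h (X - halfPeriod b c a) 0
  have h2 := flatPt_neg h (halfPeriod b c a - X) 0
  rw [neg_sub, neg_zero] at h2
  rw [sub_add_cancel, zero_add, h2] at h1
  let r : sigmaXZ a b c := ⟨flatPt a b c (halfPeriod b c a - X) 0, by
    rw [flatPt_zero_right h]; exact ellipsePt_mem h _⟩
  rw [hχ.antipode h hs hc (q := r) (hq.trans h1),
    hχ.bottom h (q := r) ⟨by linarith [hX.2], by linarith [hX.1]⟩ rfl, ← AddCircle.coe_add,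
    ← lengthTotal_half (add_pos (s₁_pos h hs) (s₂_pos h hc)).ne', ← add_div, s₁_eq h]
  congr 2; ring

lemma IsArcCoord.right {Y : ℝ} (hY : Y ∈ Icc 0 (halfPeriod b a c)) {q : sigmaXZ a b c}
    (hq : (q : E3) = flatPt a b c (halfPeriod b c a) Y) :
    χ q = ((-(s₁ a b c α + 2 * Real.cos α * Y) / (2 * (s₁ a b c α + s₂ a b c α)) : ℝ) :
      UnitAddCircle) := by
  have h1 := flatPt_add_halfPeriods h 0 (Y - halfPeriod b a c)
  have h2 := flatPt_neg h 0 (halfPeriod b a c - Y)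
  rw [neg_sub, neg_zero] at h2
  rw [sub_add_cancel, zero_add, h2] at h1
  let r : sigmaXZ a b c := ⟨flatPt a b c 0 (halfPeriod b a c - Y), by
    rw [flatPt_zero_left h]; exact ellipsePt_mem h _⟩
  have h3 : ((1 : ℝ) : UnitAddCircle) = 0 := AddCircle.coe_period 1
  have h4 := (add_pos (s₁_pos h hs) (s₂_pos h hc)).ne'
  rw [hχ.antipode h hs hc (q := r) (hq.trans h1),
    hχ.left h (q := r) ⟨by linarith [hY.2], by linarith [hY.1]⟩ rfl, ← AddCircle.coe_add,
    ← sub_zero (((_ : ℝ) : UnitAddCircle)), ← h3, ← AddCircle.coe_sub]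
  congr 1
  field_simp
  rw [s₂_eq h, s₁_eq h]
  ring

omit hs hc hχ in
lemma umbilicPt_eq_flatPt : umbilicPt a b c 1 1 = flatPt a b c 0 0 ∧
    umbilicPt a b c (-1) 1 = flatPt a b c 0 (halfPeriod b a c) ∧
    umbilicPt a b c (-1) (-1) = flatPt a b c (halfPeriod b c a) (halfPeriod b a c) ∧
    umbilicPt a b c 1 (-1) = flatPt a b c (halfPeriod b c a) 0 := by
  have e1 : √(a * (a - b) / (a - c)) = √a * √((a - b) / (a - c)) := by
    rw [mul_div_assoc, Real.sqrt_mul h.ha.le]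
  have e2 : √(c * (b - c) / (a - c)) = √c * √((b - c) / (a - c)) := by
    rw [mul_div_assoc, Real.sqrt_mul h.hc.le]
  simp only [flatPt, h.nodeP.ang_zero, h.nodeQ.ang_zero, h.nodeP.ang_halfPeriod,
    h.nodeQ.ang_halfPeriod, umbilicPt, e1, e2]
  refine ⟨?_, ?_, ?_, ?_⟩ <;> apply E3.ext <;> simp [ellipticPt, scaleX, scaleZ, conf]

lemma IsArcCoord.isLengthCoord : IsLengthCoord a b c α χ := by
  obtain ⟨u1, u2, u3, u4⟩ := umbilicPt_eq_flatPt h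
  have hK1 := h.nodeP.halfPeriod_pos.le
  have hK2 := h.nodeQ.halfPeriod_pos.le
  refine ⟨fun q r φ ψ hq hr => ?_, fun q => ⟨fun hq => ?_, fun hq => ?_, fun hq => ?_, fun hq => ?_⟩⟩
  · rw [hχ q φ hq, hχ r ψ hr, integral_lengthElement h, ← AddCircle.coe_sub, sub_div]
  · rw [hχ.bottom h ⟨le_rfl, hK1⟩ (hq.trans u1)]; simp
  · rw [hχ.left h ⟨hK2, le_rfl⟩ (hq.trans u2), s₂_eq h]
  · rw [hχ.top h hs hc ⟨hK1, le_rfl⟩ (hq.trans u3), s₁_eq h]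
  · have h3 : ((1 : ℝ) : UnitAddCircle) = 0 := AddCircle.coe_period 1
    have h4 := (add_pos (s₁_pos h hs) (s₂_pos h hc)).ne'
    rw [hχ.right h hs hc ⟨le_rfl, hK2⟩ (hq.trans u4), ← add_zero (((_ : ℝ) : UnitAddCircle)),
      ← h3, ← AddCircle.coe_add]
    congr 1
    field_simp
    ring

end

/-! ### Crossing a half of the ellipsoid: reflections of the ellipse -/

/-- There is a segment of direction `θ` from `q` to `q'` in the flat coordinates that runs in the
half of the ellipsoid given by `s`. -/
def FlatArc (a b c θ s : ℝ) (q q' : E3) : Prop :=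
  ∃ X Y T : ℝ, 0 < T ∧ q = flatPt a b c X Y ∧
    q' = flatPt a b c (X + T * Real.cos θ) (Y + T * Real.sin θ) ∧
    ∀ τ ∈ Ioo 0 T, 0 < s * flatPt a b c (X + τ * Real.cos θ) (Y + τ * Real.sin θ) 1

section

variable {a b c : ℝ} (h : IsTriaxial a b c)

lemma flatPt_one (X Y : ℝ) : flatPt a b c X Y 1 =
    -(√b * Real.sin (ang b c a X) * Real.sin (ang b a c Y)) := rfl

include h

lemma flatFactor_ne_zero {X Y : ℝ} (hy : flatPt a b c X Y 1 ≠ 0) : flatFactor a b c X Y ≠ 0 := by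
  intro h0
  refine hy ?_
  rw [flatPt_one, h.nodeP.sin_ang_eq_zero_iff.2 ((flatFactor_eq_zero_iff h).1 h0).1]
  simp

/-- The change of time `lineTime` passes between length and flat length. An arc is a line on the
open interval and, by continuity, also at its ends, which may be umbilic. -/
lemma leafArc_iff_flatArc {θ s : ℝ} (hθ : 0 < Real.cos θ) {q q' : E3} :
    LeafArc a b c θ s q q' ↔ FlatArc a b c θ s q q' := by
  constructor
  · rintro ⟨T, γ, hT, hcont, rfl, rfl, hγ, hy⟩
    obtain ⟨X, Y, hXY⟩ := hγ.exists_eq_lineCurve h hθ isOpen_Ioo ordConnected_Ioo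
      (t₀ := T / 2) ⟨by linarith, by linarith⟩
    have heq : EqOn γ (fun t => lineCurve a b c θ X Y (t - T / 2)) (Icc 0 T) := by
      refine EqOn.of_subset_closure (s := Ioo 0 T) hXY hcont ?_ Ioo_subset_Icc_self ?_
      · exact ((continuous_lineCurve h hθ X Y).comp (continuous_id.sub continuous_const)).continuousOn
      · rw [closure_Ioo hT.ne]
    have hlt := lineTime_strictMono h hθ X Y
    set τ₀ := lineTime a b c θ X Y (0 - T / 2) with hτ₀
    set τ₁ := lineTime a b c θ X Y (T - T / 2) with hτ₁
    have h01 : τ₀ < τ₁ := hlt (by linarith)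
    refine ⟨X + τ₀ * Real.cos θ, Y + τ₀ * Real.sin θ, τ₁ - τ₀, sub_pos.2 h01,
      heq ⟨le_rfl, hT.le⟩, ?_, ?_⟩
    · rw [heq ⟨hT.le, le_rfl⟩]
      simp only [lineCurve, ← hτ₁]
      congr 1 <;> ring
    · intro τ hτ
      obtain ⟨t, ht, htτ⟩ := intermediate_value_Ioo hT.le
        (f := fun t => lineTime a b c θ X Y (t - T / 2))
        ((continuous_lineTime h hθ X Y).comp (continuous_id.sub continuous_const)).continuousOn
        (show τ + τ₀ ∈ Ioo τ₀ τ₁ from ⟨by linarith [hτ.1], by linarith [hτ.2]⟩)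
      have h1 := hy t ht
      simp only at htτ
      rw [hXY t ht, lineCurve, htτ] at h1
      rwa [show X + τ₀ * Real.cos θ + τ * Real.cos θ = X + (τ + τ₀) * Real.cos θ by ring,
        show Y + τ₀ * Real.sin θ + τ * Real.sin θ = Y + (τ + τ₀) * Real.sin θ by ring]
  · rintro ⟨X, Y, T, hT, rfl, rfl, hy⟩
    obtain ⟨T', hT'⟩ := (isClock_lineFactor h hθ X Y).primInv_surjective T
    have hlt := lineTime_strictMono h hθ X Y
    have h0 := lineTime_zero h hθ X Y
    change lineTime a b c θ X Y T' = T at hT'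
    have hT0 : 0 < T' := by rw [← hlt.lt_iff_lt, h0, hT']; exact hT
    have hmem : ∀ t ∈ Ioo 0 T', lineTime a b c θ X Y t ∈ Ioo 0 T := fun t ht =>
      ⟨h0 ▸ hlt ht.1, by have := hlt ht.2; rwa [hT'] at this⟩
    refine ⟨T', lineCurve a b c θ X Y, hT0, (continuous_lineCurve h hθ X Y).continuousOn,
      lineCurve_zero h hθ X Y, ?_, ?_, fun t ht => hy _ (hmem t ht)⟩
    · rw [lineCurve, hT']
    · have := isAngleCurveOn_lineCurve h hθ X Y (t₀ := 0) (I := Ioo 0 T') fun t ht => by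
        rw [sub_zero]
        exact flatFactor_ne_zero h (right_ne_zero_of_mul (hy _ (hmem t ht)).ne')
      simpa only [sub_zero] using this

/-- The deck transformation turns the reversed segment into one of the same direction. -/
lemma FlatArc.symm {θ s : ℝ} {q q' : E3} (hq : FlatArc a b c θ s q q') :
    FlatArc a b c θ s q' q := by
  obtain ⟨X, Y, T, hT, rfl, rfl, hy⟩ := hq
  refine ⟨-(X + T * Real.cos θ), -(Y + T * Real.sin θ), T, hT, (flatPt_neg h _ _).symm, ?_, ?_⟩
  · rw [← flatPt_neg h]; congr 1 <;> ring
  · intro τ hτ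
    have h1 := hy (T - τ) ⟨by linarith [hτ.2], by linarith [hτ.1]⟩
    rw [← flatPt_neg h] at h1
    rwa [show -(X + T * Real.cos θ) + τ * Real.cos θ = -(X + (T - τ) * Real.cos θ) by ring,
      show -(Y + T * Real.sin θ) + τ * Real.sin θ = -(Y + (T - τ) * Real.sin θ) by ring]

lemma FlatArc.mirror {θ s : ℝ} {q q' : E3} (hq : q 1 = 0) (hq' : q' 1 = 0)
    (ha : FlatArc a b c θ s q q') : FlatArc a b c (-θ) (-s) q q' := by
  obtain ⟨X, Y, T, hT, rfl, rfl, hy⟩ := ha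
  have e : ∀ τ, flatPt a b c (X + τ * Real.cos (-θ)) (-Y + τ * Real.sin (-θ)) =
      flatPt a b c (X + τ * Real.cos θ) (-(Y + τ * Real.sin θ)) := fun τ => by
    rw [Real.cos_neg, Real.sin_neg]; congr 1; ring
  refine ⟨X, -Y, T, hT, ?_, ?_, fun τ hτ => ?_⟩
  · rw [flatPt_neg_right h, hq]; apply E3.ext <;> simp [hq]
  · rw [e, flatPt_neg_right h, hq']; apply E3.ext <;> simp [hq']
  · rw [e, flatPt_neg_right h]
    simpa using hy τ hτ

lemma IsHalfReturn.mirror {θ s : ℝ} (hθ : 0 < Real.cos θ) {σ : sigmaXZ a b c → sigmaXZ a b c}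
    (hσ : IsHalfReturn a b c θ s σ) : IsHalfReturn a b c (-θ) (-s) σ := by
  have hθ' : 0 < Real.cos (-θ) := by rwa [Real.cos_neg]
  have key : ∀ q q' : sigmaXZ a b c, LeafArc a b c (-θ) (-s) q q' ↔ LeafArc a b c θ s q q' := by
    intro q q'
    rw [leafArc_iff_flatArc h hθ, leafArc_iff_flatArc h hθ']
    refine ⟨fun ha => ?_, fun ha => ha.mirror h q.2.2 q'.2.2⟩
    simpa using ha.mirror h q.2.2 q'.2.2
  refine ⟨fun q q' ha => hσ.1 q q' ((key q q').1 ha), fun q hq => hσ.2 q ?_⟩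
  rintro ⟨q', hq'⟩
  exact hq ⟨q', (key q q').2 hq'⟩

/-- In the flat coordinates, the half of the ellipsoid given by `s` is the rectangle of sides
`halfPeriod b c a`, `halfPeriod b a c` with the corner `(ξ, 0)`. -/
structure IsSide (a b c s ξ : ℝ) : Prop where
  neg : ∀ X ∈ Ioo ξ (ξ + halfPeriod b c a), s * Real.sin (ang b c a X) < 0
  zero : Real.sin (ang b c a ξ) = 0

lemma isSide_one : IsSide a b c 1 (-halfPeriod b c a) := by
  have hn := h.nodeP
  refine ⟨fun X hX => ?_, ?_⟩
  · rw [one_mul]; exact hn.sin_ang_neg (by linarith [hX.2]) hX.1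
  · rw [hn.ang_neg, hn.ang_halfPeriod]; simp

lemma isSide_neg_one : IsSide a b c (-1) 0 := by
  have hn := h.nodeP
  refine ⟨fun X hX => ?_, ?_⟩
  · have := hn.sin_ang_pos hX.1 (by linarith [hX.2]); linarith
  · rw [hn.ang_zero]; simp

namespace IsSide

variable {s ξ : ℝ} (hξ : IsSide a b c s ξ)
include hξ

lemma pos {X Y : ℝ} (hX : X ∈ Ioo ξ (ξ + halfPeriod b c a)) (hY : Y ∈ Ioo 0 (halfPeriod b a c)) :
    0 < s * flatPt a b c X Y 1 := by
  have h1 := hξ.neg X hX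
  have h2 := h.nodeQ.sin_ang_pos hY.1 hY.2
  have h3 := Real.sqrt_pos.2 h.hb
  rw [flatPt_one]
  nlinarith [mul_pos h3 (mul_pos (neg_pos.2 h1) h2)]

/-- The rectangle covers the half of the ellipsoid. -/
lemma exists_mem {X Y : ℝ} (hXY : 0 < s * flatPt a b c X Y 1) :
    ∃ (ε : ℝ) (m n : ℤ), (ε = 1 ∨ ε = -1) ∧
      ε * (X + 2 * m * halfPeriod b c a) ∈ Ioo ξ (ξ + halfPeriod b c a) ∧
      ε * (Y + 2 * n * halfPeriod b a c) ∈ Ioo 0 (halfPeriod b a c) := by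
  have hP := h.nodeP
  have hQ := h.nodeQ
  have hK1 := hP.halfPeriod_pos
  have hK2 := hQ.halfPeriod_pos
  have h3 := Real.sqrt_pos.2 h.hb
  have key : ∀ X' Y', 0 < s * flatPt a b c X' Y' 1 → Y' ∈ Ioo 0 (halfPeriod b a c) →
      ∃ m : ℤ, X' + 2 * m * halfPeriod b c a ∈ Ioo ξ (ξ + halfPeriod b c a) := by
    intro X' Y' hXY' hY'
    -- A translation brings `X'` into a full period starting at `ξ`; in its second half `sin (x + π)
    -- = -sin x` gives the wrong sign.
    obtain ⟨m, hm, -⟩ := existsUnique_add_zsmul_mem_Ico (show 0 < 2 * halfPeriod b c a by linarith)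
      X' ξ
    rw [zsmul_eq_mul] at hm
    have e : X' + (m : ℝ) * (2 * halfPeriod b c a) = X' + 2 * m * halfPeriod b c a := by ring
    rw [e] at hm
    have h4 := flatPt_add_periods h X' Y' m 0
    rw [← h4, flatPt_one] at hXY'
    simp only [Int.cast_zero, mul_zero, zero_mul, add_zero] at hXY'
    have h5 := hQ.sin_ang_pos hY'.1 hY'.2
    have h6 : s * Real.sin (ang b c a (X' + 2 * m * halfPeriod b c a)) < 0 := by
      by_contra hcon
      have := mul_nonneg (mul_nonneg h3.le (not_lt.1 hcon)) h5.le
      nlinarith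
    refine ⟨m, lt_of_le_of_ne hm.1 fun h0 => ?_, ?_⟩
    · rw [← h0, hξ.zero] at h6; simp at h6
    · by_contra hcon
      have h7 : X' + 2 * m * halfPeriod b c a =
        (X' + 2 * m * halfPeriod b c a - halfPeriod b c a) + halfPeriod b c a := by ring
      rw [h7, hP.ang_add_halfPeriod, Real.sin_add_pi] at h6
      rcases eq_or_lt_of_le (not_lt.1 hcon) with h8 | h8
      · rw [← h8, add_sub_cancel_right, hξ.zero] at h6; simp at h6
      · have := hξ.neg (X' + 2 * m * halfPeriod b c a - halfPeriod b c a)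
          ⟨by linarith, by linarith [hm.2]⟩
        linarith
  obtain ⟨n, hn, -⟩ := existsUnique_add_zsmul_mem_Ico (show 0 < 2 * halfPeriod b a c by linarith)
    Y (-halfPeriod b a c)
  rw [zsmul_eq_mul] at hn
  have e : Y + (n : ℝ) * (2 * halfPeriod b a c) = Y + 2 * n * halfPeriod b a c := by ring
  rw [e] at hn
  have h4 := flatPt_add_periods h X Y 0 n
  simp only [Int.cast_zero, mul_zero, zero_mul, add_zero] at h4
  rw [← h4] at hXY
  have hne : Real.sin (ang b a c (Y + 2 * n * halfPeriod b a c)) ≠ 0 := by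
    intro h0
    rw [flatPt_one, h0] at hXY
    simp at hXY
  rcases lt_trichotomy 0 (Y + 2 * n * halfPeriod b a c) with h5 | h5 | h5
  · have hY' : Y + 2 * n * halfPeriod b a c ∈ Ioo 0 (halfPeriod b a c) := by
      refine ⟨h5, by linarith [hn.2]⟩
    obtain ⟨m, hm⟩ := key X _ hXY hY'
    exact ⟨1, m, n, Or.inl rfl, by rwa [one_mul], by rwa [one_mul]⟩
  · rw [← h5, hQ.ang_zero] at hne; simp at hne
  · have hY' : -(Y + 2 * n * halfPeriod b a c) ∈ Ioo 0 (halfPeriod b a c) := by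
      refine ⟨by linarith, ?_⟩
      have : -halfPeriod b a c ≠ Y + 2 * n * halfPeriod b a c := fun h0 => hne (by
        rw [← h0, hQ.ang_neg, hQ.ang_halfPeriod]; simp)
      linarith [lt_of_le_of_ne hn.1 this]
    rw [← flatPt_neg h] at hXY
    obtain ⟨m, hm⟩ := key (-X) _ hXY hY'
    refine ⟨-1, -m, n, Or.inr rfl, ?_, by rwa [neg_one_mul]⟩
    convert hm using 1
    push_cast; ring

end IsSide

end

section

lemma segment_mem_Ioo {x k T u v : ℝ} (hk : 0 < k) {τ₀ : ℝ} (hτ₀ : τ₀ ∈ Ioo 0 T)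
    (hmem : x + τ₀ * k ∈ Ioo u v) (hne : ∀ τ ∈ Ioo 0 T, x + τ * k ≠ u ∧ x + τ * k ≠ v) :
    ∀ τ ∈ Ioo 0 T, x + τ * k ∈ Ioo u v := by
  intro τ hτ
  constructor
  · by_contra hcon
    refine (hne ((u - x) / k) ⟨?_, ?_⟩).1 (by field_simp; ring)
    · exact hτ.1.trans_le ((le_div_iff₀ hk).2 (by linarith))
    · exact lt_trans ((div_lt_iff₀ hk).2 (by linarith [hmem.1])) hτ₀.2
  · by_contra hcon
    refine (hne ((v - x) / k) ⟨?_, ?_⟩).2 (by field_simp; ring)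
    · exact hτ₀.1.trans ((lt_div_iff₀ hk).2 (by linarith [hmem.2]))
    · exact lt_of_le_of_lt ((div_le_iff₀ hk).2 (by linarith)) hτ.2

lemma segment_start_mem {x k T u v : ℝ} (hk : 0 < k) (hT : 0 < T)
    (hmem : ∀ τ ∈ Ioo 0 T, x + τ * k ∈ Ioo u v) : x ∈ Ico u v := by
  constructor
  · by_contra hcon
    have hpos : 0 < (u - x) / k := div_pos (by linarith) hk
    have h1 := (hmem (min (T / 2) ((u - x) / k)) ⟨by positivity,
      (min_le_left _ _).trans_lt (by linarith)⟩).1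
    have h2 : min (T / 2) ((u - x) / k) * k ≤ u - x :=
      (le_div_iff₀ hk).1 (min_le_right _ _)
    linarith
  · have := (hmem (T / 2) ⟨by linarith, by linarith⟩).2
    nlinarith

lemma segment_end_mem {x k T u v : ℝ} (hk : 0 < k) (hT : 0 < T)
    (hmem : ∀ τ ∈ Ioo 0 T, x + τ * k ∈ Ioo u v) : x + T * k ∈ Ioc u v := by
  have := segment_start_mem (x := -(x + T * k)) (u := -v) (v := -u) hk hT fun τ hτ => by
    have := hmem (T - τ) ⟨by linarith [hτ.2], by linarith [hτ.1]⟩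
    constructor <;> nlinarith [this.1, this.2]
  exact ⟨by linarith [this.2], by linarith [this.1]⟩

variable {a b c : ℝ} (h : IsTriaxial a b c)
include h

namespace IsSide

variable {s ξ : ℝ} (hξ : IsSide a b c s ξ)
include hξ

omit h in
lemma sin_ne {X : ℝ} (hX : X ∈ Ioo ξ (ξ + halfPeriod b c a)) : Real.sin (ang b c a X) ≠ 0 :=
  right_ne_zero_of_mul (hξ.neg X hX).ne

lemma zero_right : Real.sin (ang b c a (ξ + halfPeriod b c a)) = 0 := by
  rw [h.nodeP.ang_add_halfPeriod, Real.sin_add_pi, hξ.zero, neg_zero]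

lemma flatPt_one_eq_zero {X Y : ℝ} (hXY : (X = ξ ∨ X = ξ + halfPeriod b c a) ∨
    (Y = 0 ∨ Y = halfPeriod b a c)) : flatPt a b c X Y 1 = 0 := by
  rw [flatPt_one]
  rcases hXY with (rfl | rfl) | (rfl | rfl)
  · rw [hξ.zero]; simp
  · rw [hξ.zero_right h]; simp
  · rw [h.nodeQ.ang_zero]; simp
  · rw [h.nodeQ.ang_halfPeriod]; simp

lemma of_flatPt_one_eq_zero {X Y : ℝ} (hX : X ∈ Icc ξ (ξ + halfPeriod b c a))
    (hY : Y ∈ Icc 0 (halfPeriod b a c)) (h0 : flatPt a b c X Y 1 = 0) :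
    (X = ξ ∨ X = ξ + halfPeriod b c a) ∨ (Y = 0 ∨ Y = halfPeriod b a c) := by
  by_contra! hcon
  have := hξ.pos h (X := X) (Y := Y) ⟨lt_of_le_of_ne hX.1 hcon.1.1.symm,
    lt_of_le_of_ne hX.2 hcon.1.2⟩ ⟨lt_of_le_of_ne hY.1 hcon.2.1.symm, lt_of_le_of_ne hY.2 hcon.2.2⟩
  rw [h0] at this
  simp at this

/-- The coordinate `y` vanishes on the lines bounding the rectangle and not along the arc, so an arc
with one point inside never leaves. -/
lemma mem_of_mem {α X Y T τ₀ : ℝ} (hs : 0 < Real.sin α) (hc : 0 < Real.cos α)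
    (hpos : ∀ τ ∈ Ioo 0 T, 0 < s * flatPt a b c (X + τ * Real.cos α) (Y + τ * Real.sin α) 1)
    (hτ₀ : τ₀ ∈ Ioo 0 T) (hX : X + τ₀ * Real.cos α ∈ Ioo ξ (ξ + halfPeriod b c a))
    (hY : Y + τ₀ * Real.sin α ∈ Ioo 0 (halfPeriod b a c)) :
    ∀ τ ∈ Ioo 0 T, X + τ * Real.cos α ∈ Ioo ξ (ξ + halfPeriod b c a) ∧
      Y + τ * Real.sin α ∈ Ioo 0 (halfPeriod b a c) := by
  have hne : ∀ τ ∈ Ioo 0 T, ¬ ((X + τ * Real.cos α = ξ ∨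
      X + τ * Real.cos α = ξ + halfPeriod b c a) ∨
      (Y + τ * Real.sin α = 0 ∨ Y + τ * Real.sin α = halfPeriod b a c)) := fun τ hτ h0 => by
    have h1 := hpos τ hτ
    rw [hξ.flatPt_one_eq_zero h h0] at h1
    simp at h1
  simp only [not_or] at hne
  exact fun τ hτ => ⟨segment_mem_Ioo hc hτ₀ hX (fun τ hτ => (hne τ hτ).1) τ hτ,
    segment_mem_Ioo hs hτ₀ hY (fun τ hτ => (hne τ hτ).2) τ hτ⟩

/-- An arc that runs in a half of the ellipsoid is a segment that runs in the rectangle. -/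
lemma exists_segment {α : ℝ} (hs : 0 < Real.sin α) (hc : 0 < Real.cos α) {q q' : E3}
    (ha : FlatArc a b c α s q q') : ∃ X Y T, 0 < T ∧
      (∀ τ ∈ Ioo 0 T, X + τ * Real.cos α ∈ Ioo ξ (ξ + halfPeriod b c a) ∧
        Y + τ * Real.sin α ∈ Ioo 0 (halfPeriod b a c)) ∧
      ((q = flatPt a b c X Y ∧ q' = flatPt a b c (X + T * Real.cos α) (Y + T * Real.sin α)) ∨
        (q' = flatPt a b c X Y ∧
          q = flatPt a b c (X + T * Real.cos α) (Y + T * Real.sin α))) := by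
  obtain ⟨X, Y, T, hT, rfl, rfl, hy⟩ := ha
  have hmid : T / 2 ∈ Ioo 0 T := ⟨by linarith, by linarith⟩
  obtain ⟨ε, m, n, hε, hX, hY⟩ := hξ.exists_mem h (hy _ hmid)
  rcases hε with rfl | rfl
  · have e : ∀ τ, flatPt a b c (X + 2 * m * halfPeriod b c a + τ * Real.cos α)
        (Y + 2 * n * halfPeriod b a c + τ * Real.sin α) =
        flatPt a b c (X + τ * Real.cos α) (Y + τ * Real.sin α) := fun τ => by
      rw [← flatPt_add_periods h (X + τ * Real.cos α) _ m n]; congr 1 <;> ring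
    refine ⟨X + 2 * m * halfPeriod b c a, Y + 2 * n * halfPeriod b a c, T, hT,
      hξ.mem_of_mem h hs hc (fun τ hτ => ?_) hmid ?_ ?_,
      Or.inl ⟨(flatPt_add_periods h _ _ m n).symm, (e T).symm⟩⟩
    · rw [e]; exact hy τ hτ
    · convert hX using 1; ring
    · convert hY using 1; ring
  · have e : ∀ τ, flatPt a b c (-(X + 2 * m * halfPeriod b c a + T * Real.cos α) + τ * Real.cos α)
        (-(Y + 2 * n * halfPeriod b a c + T * Real.sin α) + τ * Real.sin α) =
        flatPt a b c (X + (T - τ) * Real.cos α) (Y + (T - τ) * Real.sin α) := fun τ => by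
      rw [← flatPt_add_periods h (X + (T - τ) * Real.cos α) _ m n, ← flatPt_neg h]
      congr 1 <;> ring
    have e0 := e 0
    have eT := e T
    rw [zero_mul, add_zero, zero_mul, add_zero, sub_zero] at e0
    rw [sub_self, zero_mul, add_zero, zero_mul, add_zero] at eT
    refine ⟨-(X + 2 * m * halfPeriod b c a + T * Real.cos α),
      -(Y + 2 * n * halfPeriod b a c + T * Real.sin α), T, hT,
      hξ.mem_of_mem h hs hc (fun τ hτ => ?_) hmid ?_ ?_, Or.inr ⟨e0.symm, eT.symm⟩⟩
    · rw [e]; exact hy _ ⟨by linarith [hτ.2], by linarith [hτ.1]⟩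
    · convert hX using 1; ring
    · convert hY using 1; ring

/-- The closed rectangle covers the ellipse. -/
lemma exists_eq_flatPt {q : E3} (hq : q ∈ sigmaXZ a b c) :
    ∃ X ∈ Icc ξ (ξ + halfPeriod b c a), ∃ Y ∈ Icc 0 (halfPeriod b a c), q = flatPt a b c X Y := by
  have hP := h.nodeP
  have hQ := h.nodeQ
  have hK1 := hP.halfPeriod_pos
  have hK2 := hQ.halfPeriod_pos
  obtain ⟨X, Y, hY, rfl⟩ : ∃ X, ∃ Y ∈ Icc 0 (halfPeriod b a c), flatPt a b c X Y = q := by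
    obtain ⟨X, Y, rfl⟩ := exists_flatPt h hq.1
    obtain ⟨n, hn, -⟩ := existsUnique_add_zsmul_mem_Ico
      (show 0 < 2 * halfPeriod b a c by linarith) Y (-halfPeriod b a c)
    rw [zsmul_eq_mul, show Y + (n : ℝ) * (2 * halfPeriod b a c) =
      Y + 2 * n * halfPeriod b a c by ring] at hn
    have h4 := flatPt_add_periods h X Y 0 n
    simp only [Int.cast_zero, mul_zero, zero_mul, add_zero] at h4
    rcases le_total 0 (Y + 2 * n * halfPeriod b a c) with h5 | h5
    · exact ⟨X, _, ⟨h5, by linarith [hn.2]⟩, h4⟩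
    · exact ⟨-X, -(Y + 2 * n * halfPeriod b a c), ⟨by linarith, by linarith [hn.1]⟩, by
        rw [flatPt_neg h, h4]⟩
  obtain ⟨m, hm, -⟩ := existsUnique_add_zsmul_mem_Ico
    (show 0 < 2 * halfPeriod b c a by linarith) X ξ
  rw [zsmul_eq_mul, show X + (m : ℝ) * (2 * halfPeriod b c a) =
    X + 2 * m * halfPeriod b c a by ring] at hm
  have h4 := flatPt_add_periods h X Y m 0
  simp only [Int.cast_zero, mul_zero, zero_mul, add_zero] at h4
  set X₁ := X + 2 * m * halfPeriod b c a
  rw [← h4] at hq ⊢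
  rcases le_or_gt X₁ (ξ + halfPeriod b c a) with h5 | h5
  · exact ⟨X₁, ⟨hm.1, h5⟩, Y, hY, rfl⟩
  -- In the second half of the period `sin p ≠ 0`, so `y = 0` places the point on a horizontal side.
  -- There `-Y` and `Y` agree modulo a period, and the deck transformation with the shift `2 (k + 1)
  -- K₁`, where `ξ = k K₁`, brings it into the rectangle.
  obtain ⟨k, hk⟩ := hP.sin_ang_eq_zero_iff.1 hξ.zero
  have hX1 : Real.sin (ang b c a X₁) ≠ 0 := by
    have h6 := hξ.sin_ne (X := X₁ - halfPeriod b c a) ⟨by linarith, by linarith [hm.2]⟩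
    rw [← sub_add_cancel X₁ (halfPeriod b c a), hP.ang_add_halfPeriod, Real.sin_add_pi]
    exact neg_ne_zero.2 h6
  have hY0 : Real.sin (ang b a c Y) = 0 := by
    have h7 := hq.2
    rw [flatPt_one, neg_eq_zero, mul_assoc] at h7
    exact ((mul_eq_zero.1 ((mul_eq_zero.1 h7).resolve_left (Real.sqrt_pos.2 h.hb).ne')).resolve_left
      hX1)
  obtain ⟨l, hl⟩ : ∃ l : ℤ, -Y + 2 * l * halfPeriod b a c = Y := by
    obtain ⟨l, hl⟩ := hQ.sin_ang_eq_zero_iff.1 hY0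
    exact ⟨l, by rw [← hl]; ring⟩
  refine ⟨-X₁ + 2 * (k + 1 : ℤ) * halfPeriod b c a, ⟨?_, ?_⟩, Y, hY, ?_⟩
  · push_cast; linarith [hm.2]
  · push_cast; linarith
  · have h6 := flatPt_add_periods h (-X₁) (-Y) (k + 1) l
    rw [hl, flatPt_neg h] at h6
    exact h6.symm

lemma flatPt_mem_sigmaXZ {X Y : ℝ} (hXY : (X = ξ ∨ X = ξ + halfPeriod b c a) ∨
    (Y = 0 ∨ Y = halfPeriod b a c)) : flatPt a b c X Y ∈ sigmaXZ a b c :=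
  ⟨flatPt_mem h X Y, hξ.flatPt_one_eq_zero h hXY⟩

omit h hξ in
/-- From every point of the closed rectangle that is not on its two exit sides, a segment of
positive slope runs to one of these. -/
lemma exists_exit {α X Y : ℝ} (hs : 0 < Real.sin α) (hc : 0 < Real.cos α)
    (hX : X ∈ Ico ξ (ξ + halfPeriod b c a)) (hY : Y ∈ Ico 0 (halfPeriod b a c)) :
    ∃ T, 0 < T ∧ (∀ τ ∈ Ioo 0 T, X + τ * Real.cos α ∈ Ioo ξ (ξ + halfPeriod b c a) ∧
      Y + τ * Real.sin α ∈ Ioo 0 (halfPeriod b a c)) ∧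
      (X + T * Real.cos α = ξ + halfPeriod b c a ∨ Y + T * Real.sin α = halfPeriod b a c) := by
  have h1 : 0 < (ξ + halfPeriod b c a - X) / Real.cos α := div_pos (by linarith [hX.2]) hc
  have h2 : 0 < (halfPeriod b a c - Y) / Real.sin α := div_pos (by linarith [hY.2]) hs
  refine ⟨min ((ξ + halfPeriod b c a - X) / Real.cos α) ((halfPeriod b a c - Y) / Real.sin α),
    lt_min h1 h2, fun τ hτ => ?_, ?_⟩
  · have h3 := (lt_div_iff₀ hc).1 (hτ.2.trans_le (min_le_left _ _))
    have h4 := (lt_div_iff₀ hs).1 (hτ.2.trans_le (min_le_right _ _))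
    have h5 := mul_pos hτ.1 hc
    have h6 := mul_pos hτ.1 hs
    exact ⟨⟨by linarith [hX.1], by linarith⟩, ⟨by linarith [hY.1], by linarith⟩⟩
  · rcases min_choice ((ξ + halfPeriod b c a - X) / Real.cos α)
      ((halfPeriod b a c - Y) / Real.sin α) with h3 | h3
    · left; rw [h3]; field_simp; ring
    · right; rw [h3]; field_simp; ring

lemma exists_flatArc {α X Y : ℝ} (hs : 0 < Real.sin α) (hc : 0 < Real.cos α)
    (hX : X ∈ Ico ξ (ξ + halfPeriod b c a)) (hY : Y ∈ Ico 0 (halfPeriod b a c)) :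
    ∃ q' : sigmaXZ a b c, FlatArc a b c α s (flatPt a b c X Y) q' := by
  obtain ⟨T, hT, hmem, hend⟩ := exists_exit hs hc hX hY
  exact ⟨⟨_, hξ.flatPt_mem_sigmaXZ h (hend.imp Or.inr Or.inr)⟩, X, Y, T, hT, rfl, rfl,
    fun τ hτ => hξ.pos h (hmem τ hτ).1 (hmem τ hτ).2⟩

/-- The central symmetry of the rectangle exchanges entry and exit sides, so the segment is
constructed backwards and then reversed by `FlatArc.symm`. -/
lemma exists_flatArc_of_exit {α X Y : ℝ} (hs : 0 < Real.sin α) (hc : 0 < Real.cos α)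
    (hX : X ∈ Ioc ξ (ξ + halfPeriod b c a)) (hY : Y ∈ Ioc 0 (halfPeriod b a c)) :
    ∃ q' : sigmaXZ a b c, FlatArc a b c α s (flatPt a b c X Y) q' := by
  obtain ⟨T, hT, hmem, hend⟩ := exists_exit (X := 2 * ξ + halfPeriod b c a - X)
    (Y := halfPeriod b a c - Y) hs hc (ξ := ξ)
    ⟨by linarith [hX.2], by linarith [hX.1]⟩ ⟨by linarith [hY.2], by linarith [hY.1]⟩
  refine ⟨⟨flatPt a b c (X - T * Real.cos α) (Y - T * Real.sin α), hξ.flatPt_mem_sigmaXZ h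
    (hend.imp (fun h1 => Or.inl ?_) fun h1 => Or.inl ?_)⟩, FlatArc.symm h
    ⟨X - T * Real.cos α, Y - T * Real.sin α, T, hT, rfl, ?_, fun τ hτ => ?_⟩⟩
  · linarith
  · linarith
  · rw [sub_add_cancel, sub_add_cancel]
  · obtain ⟨h1, h2⟩ := hmem (T - τ) ⟨by linarith [hτ.2], by linarith [hτ.1]⟩
    exact hξ.pos h ⟨by linarith [h1.2], by linarith [h1.1]⟩ ⟨by linarith [h2.2], by linarith [h2.1]⟩

/-- If the invariant `sin α * X - cos α * Y` of the segments determines the coordinate `χ` on the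
entry sides of the rectangle by a function `e` and on its exit sides by `k - e`, then the leaves
induce the reflection `χ ↦ k - χ` of the ellipse. -/
theorem isHalfReturn {α : ℝ} (hs : 0 < Real.sin α) (hc : 0 < Real.cos α)
    (χ : sigmaXZ a b c ≃ₜ UnitAddCircle) (e : ℝ → UnitAddCircle) (k : UnitAddCircle)
    (hin : ∀ X ∈ Icc ξ (ξ + halfPeriod b c a), ∀ Y ∈ Icc 0 (halfPeriod b a c),
      (X = ξ ∨ Y = 0) → ∀ q : sigmaXZ a b c, (q : E3) = flatPt a b c X Y →
      χ q = e (Real.sin α * X - Real.cos α * Y))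
    (hout : ∀ X ∈ Icc ξ (ξ + halfPeriod b c a), ∀ Y ∈ Icc 0 (halfPeriod b a c),
      (X = ξ + halfPeriod b c a ∨ Y = halfPeriod b a c) → ∀ q : sigmaXZ a b c,
      (q : E3) = flatPt a b c X Y → χ q = k - e (Real.sin α * X - Real.cos α * Y)) :
    IsHalfReturn a b c α s fun q => χ.symm (k - χ q) := by
  constructor
  · intro q q' ha
    rw [leafArc_iff_flatArc h hc] at ha
    obtain ⟨X, Y, T, hT, hmem, hqq⟩ := hξ.exists_segment h hs hc ha
    have hX := segment_start_mem hc hT fun τ hτ => (hmem τ hτ).1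
    have hY := segment_start_mem hs hT fun τ hτ => (hmem τ hτ).2
    have hX' := segment_end_mem hc hT fun τ hτ => (hmem τ hτ).1
    have hY' := segment_end_mem hs hT fun τ hτ => (hmem τ hτ).2
    have einv : Real.sin α * (X + T * Real.cos α) - Real.cos α * (Y + T * Real.sin α) =
        Real.sin α * X - Real.cos α * Y := by ring
    have key : ∀ r r' : sigmaXZ a b c, (r : E3) = flatPt a b c X Y →
        (r' : E3) = flatPt a b c (X + T * Real.cos α) (Y + T * Real.sin α) →
        χ r' = k - χ r := by
      intro r r' hr hr'
      have h1 := hξ.of_flatPt_one_eq_zero h (Ico_subset_Icc_self hX) (Ico_subset_Icc_self hY)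
        (hr ▸ r.2.2)
      have h2 := hξ.of_flatPt_one_eq_zero h (Ioc_subset_Icc_self hX') (Ioc_subset_Icc_self hY')
        (hr' ▸ r'.2.2)
      rw [hin X (Ico_subset_Icc_self hX) Y (Ico_subset_Icc_self hY)
        (h1.imp (fun h0 => h0.resolve_right hX.2.ne) fun h0 => h0.resolve_right hY.2.ne) r hr,
        hout _ (Ioc_subset_Icc_self hX') _ (Ioc_subset_Icc_self hY')
        (h2.imp (fun h0 => h0.resolve_left hX'.1.ne') fun h0 => h0.resolve_left hY'.1.ne') r' hr',
        einv]
    change χ.symm (k - χ q) = q'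
    rw [Homeomorph.symm_apply_eq]
    -- A reflection is an involution, so the sense in which the arc runs does not matter.
    rcases hqq with ⟨h1, h2⟩ | ⟨h1, h2⟩
    · exact (key q q' h1 h2).symm
    · rw [key q' q h1 h2, sub_sub_cancel]
  · intro q hq
    have hq' : ¬ ∃ q' : sigmaXZ a b c, FlatArc a b c α s q q' := fun ⟨q', h1⟩ =>
      hq ⟨q', (leafArc_iff_flatArc h hc).2 h1⟩
    obtain ⟨X, hX, Y, hY, hXY⟩ := hξ.exists_eq_flatPt h q.2
    rw [hXY] at hq'
    -- A point with no arc lies on an exit side and on an entry side: it is one of the corners `(ξ +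
    -- K₁, 0)`, `(ξ, K₂)`. These are umbilic, and equating the two formulas for `χ` shows that the
    -- reflection fixes them.
    have h1 : X = ξ + halfPeriod b c a ∨ Y = halfPeriod b a c := by
      by_contra! hcon
      exact hq' (hξ.exists_flatArc h hs hc ⟨hX.1, lt_of_le_of_ne hX.2 hcon.1⟩
        ⟨hY.1, lt_of_le_of_ne hY.2 hcon.2⟩)
    have h2 : X = ξ ∨ Y = 0 := by
      by_contra! hcon
      exact hq' (hξ.exists_flatArc_of_exit h hs hc ⟨lt_of_le_of_ne hX.1 hcon.1.symm, hX.2⟩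
        ⟨lt_of_le_of_ne hY.1 hcon.2.symm, hY.2⟩)
    have hK1 := h.nodeP.halfPeriod_pos
    have hK2 := h.nodeQ.halfPeriod_pos
    constructor
    · rw [hXY, isUmbilic_flatPt_iff h, flatFactor_eq_zero_iff h, ← h.nodeP.sin_ang_eq_zero_iff,
        ← h.nodeQ.sin_ang_eq_zero_iff]
      constructor
      · rcases h1 with rfl | rfl
        · exact hξ.zero_right h
        · rcases h2 with rfl | h2
          · exact hξ.zero
          · exact absurd h2 hK2.ne'
      · rcases h2 with rfl | rfl
        · rcases h1 with h1 | rfl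
          · linarith
          · rw [h.nodeQ.ang_halfPeriod, Real.sin_pi]
        · rw [h.nodeQ.ang_zero, Real.sin_zero]
    · change χ.symm (k - χ q) = q
      rw [Homeomorph.symm_apply_eq]
      nth_rewrite 1 [hin X hX Y hY h2 q hXY]
      exact (hout X hX Y hY h1 q hXY).symm

end IsSide

end

/-! ### The two reflections and the return maps -/

section

variable {a b c : ℝ} (h : IsTriaxial a b c)
include h

variable {α : ℝ} {χ : sigmaXZ a b c ≃ₜ UnitAddCircle} (hχ : IsArcCoord a b c α χ)
  (hs : 0 < Real.sin α) (hc : 0 < Real.cos α)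
include hχ hs hc

/-- For `y > 0` the rectangle is `[-K₁, 0] × [0, K₂]`; its corners without arcs are `p₁` and `p₃`,
at `χ = 0` and `χ = 1/2`, the fixed points of `χ ↦ -χ`. -/
lemma IsArcCoord.isHalfReturn_one :
    IsHalfReturn a b c α 1 fun q => χ.symm (0 - χ q) := by
  have ht := (add_pos (s₁_pos h hs) (s₂_pos h hc)).ne'
  refine (isSide_one h).isHalfReturn h hs hc χ
    (fun x => ((2 * x / (2 * (s₁ a b c α + s₂ a b c α)) : ℝ) : UnitAddCircle)) 0 ?_ ?_
  · rintro X hX Y hY (rfl | rfl) q hq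
    · have h1 := flatPt_add_periods h (-halfPeriod b c a) Y 1 0
      simp only [Int.cast_zero, mul_zero, zero_mul, add_zero, Int.cast_one, mul_one] at h1
      rw [show -halfPeriod b c a + 2 * halfPeriod b c a = halfPeriod b c a by ring] at h1
      rw [hχ.right h hs hc hY (hq.trans h1.symm), s₁_eq h]
      congr 2; ring
    · have h1 := flatPt_neg h X 0
      rw [neg_zero] at h1
      rw [hχ.bottom h (X := -X) ⟨by linarith [hX.2], by linarith [hX.1]⟩ (hq.trans h1.symm)]
      congr 2; ring
  · rintro X hX Y hY (rfl | rfl) q hq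
    · rw [neg_add_cancel] at hq ⊢
      rw [hχ.left h hY hq, zero_sub, ← AddCircle.coe_neg]
      congr 1; field_simp; ring
    · have h1 := flatPt_add_periods h (-X) (-halfPeriod b a c) 0 1
      rw [flatPt_neg h] at h1
      simp only [Int.cast_zero, mul_zero, zero_mul, add_zero, Int.cast_one, mul_one] at h1
      rw [show -halfPeriod b a c + 2 * halfPeriod b a c = halfPeriod b a c by ring] at h1
      rw [hχ.top h hs hc (X := -X) ⟨by linarith [hX.2], by linarith [hX.1]⟩ (hq.trans h1.symm),
        s₂_eq h, zero_sub, ← AddCircle.coe_neg]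
      congr 1; ring

/-- For `y < 0` the rectangle is `[0, K₁] × [0, K₂]`; its corners without arcs are `p₂` and `p₄`,
and twice the coordinate of `p₂` is the constant of the reflection. -/
lemma IsArcCoord.isHalfReturn_neg_one : IsHalfReturn a b c α (-1) fun q =>
    χ.symm (((s₂ a b c α / (s₁ a b c α + s₂ a b c α) : ℝ) : UnitAddCircle) - χ q) := by
  have ht := (add_pos (s₁_pos h hs) (s₂_pos h hc)).ne'
  refine (isSide_neg_one h).isHalfReturn h hs hc χ
    (fun x => ((-(2 * x) / (2 * (s₁ a b c α + s₂ a b c α)) : ℝ) : UnitAddCircle)) _ ?_ ?_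
  · rintro X hX Y hY (rfl | rfl) q hq
    · rw [hχ.left h hY hq]
      congr 2; ring
    · rw [zero_add] at hX
      rw [hχ.bottom h hX hq]
      congr 2; ring
  · rintro X hX Y hY (rfl | rfl) q hq
    · have h3 : ((1 : ℝ) : UnitAddCircle) = 0 := AddCircle.coe_period 1
      rw [zero_add] at hq ⊢
      rw [hχ.right h hs hc hY hq, ← add_zero (((_ : ℝ) : UnitAddCircle)), ← h3,
        ← AddCircle.coe_add, ← AddCircle.coe_sub]
      congr 1
      field_simp
      rw [s₁_eq h]
      ring
    · rw [zero_add] at hX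
      rw [hχ.top h hs hc hX hq, ← AddCircle.coe_sub]
      congr 1
      field_simp
      rw [s₂_eq h]
      ring

theorem IsArcCoord.isPoincareMap :
    (∃ π, IsPoincareMap a b c α 1 π ∧ ∀ q, χ (π q) =
      χ q + ((s₂ a b c α / (s₁ a b c α + s₂ a b c α) : ℝ) : UnitAddCircle)) ∧
    ∃ π, IsPoincareMap a b c (-α) (-1) π ∧ ∀ q, χ (π q) =
      χ q + ((s₂ a b c α / (s₁ a b c α + s₂ a b c α) : ℝ) : UnitAddCircle) := by
  have h1 := hχ.isHalfReturn_one h hs hc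
  have h2 := hχ.isHalfReturn_neg_one h hs hc
  refine ⟨⟨_, ⟨_, _, h1, h2, rfl⟩, fun q => ?_⟩, ⟨_, ⟨_, _, h1.mirror h hc, h2.mirror h hc, rfl⟩,
    fun q => ?_⟩⟩ <;>
  · simp only [Function.comp_apply, Homeomorph.apply_symm_apply]
    abel

end

end EllipsoidFoliation

theorem proposition5 (a b c : ℝ) (hab : b < a) (hbc : c < b) (hc : 0 < c)
    (α : ℝ) (hα : α ∈ Set.Ioo (-(Real.pi / 2)) (Real.pi / 2)) (hα0 : α ≠ 0) :
    -- the four umbilic points, and the two distances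
    {p | IsUmbilic a b c p} = {umbilicPt a b c 1 1, umbilicPt a b c (-1) 1,
      umbilicPt a b c (-1) (-1), umbilicPt a b c 1 (-1)} ∧
    0 < s₁ a b c |α| ∧ 0 < s₂ a b c |α| ∧
    -- in the length coordinate of the ellipse, the return maps of both foliations are rotations
    (∃ χ : sigmaXZ a b c ≃ₜ UnitAddCircle, IsLengthCoord a b c |α| χ ∧
      (∃ π, IsPoincareMap a b c |α| 1 π ∧ ∀ q, χ (π q) =
        χ q + ((s₂ a b c |α| / (s₁ a b c |α| + s₂ a b c |α|) : ℝ) : UnitAddCircle)) ∧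
      (∃ π, IsPoincareMap a b c (-|α|) (-1) π ∧ ∀ q, χ (π q) =
        χ q + ((s₂ a b c |α| / (s₁ a b c |α| + s₂ a b c |α|) : ℝ) : UnitAddCircle))) ∧
    -- recurrent leaves
    (Irrational (rho a b c α) → ∀ θ ∈ ({α, -α} : Set ℝ), ∀ (γ : ℝ → E3) (I : Set ℝ),
      IsLeaf a b c θ γ I → IsRecurrent a b c γ I) ∧
    -- closed leaves
    (rho a b c α ∈ Set.range ((↑) : ℚ → ℝ) → ∀ θ ∈ ({α, -α} : Set ℝ),
      ∀ (γ : ℝ → E3) (I : Set ℝ), IsLeaf a b c θ γ I →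
        ¬ IsUmbilicSeparatrix a b c γ I → IsClosedLeaf γ I) := by
  have h : IsTriaxial a b c := ⟨hab, hbc, hc⟩
  have hcos : 0 < Real.cos α := Real.cos_pos_of_mem_Ioo hα
  have hcos' : 0 < Real.cos |α| := by rwa [Real.cos_abs]
  have hlt : |α| < Real.pi / 2 := abs_lt.2 hα
  have hsin' : 0 < Real.sin |α| :=
    Real.sin_pos_of_pos_of_lt_pi (abs_pos.2 hα0) (by linarith [Real.pi_pos])
  have hsin : Real.sin α ≠ 0 := by
    rcases abs_choice α with h1 | h1
    · rw [← h1]; exact hsin'.ne'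
    · rw [h1, Real.sin_neg] at hsin'
      exact (neg_pos.1 hsin').ne
  refine ⟨setOf_isUmbilic h, s₁_pos h hsin', s₂_pos h hcos', ?_, fun hirr θ hθ γ I hγ => ?_,
    fun hrat θ hθ γ I hγ hsep => ?_⟩
  · obtain ⟨χ, hχ⟩ := exists_lengthCoord h hsin' hcos'
    have hχ' : IsArcCoord a b c |α| χ := hχ
    exact ⟨χ, hχ'.isLengthCoord h hsin' hcos', hχ'.isPoincareMap h hsin' hcos'⟩
  · rw [rho_eq h] at hirr
    rcases hθ with rfl | rfl
    · exact hγ.isRecurrent h hcos hsin hirr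
    -- Replacing `α` by `-α` changes only the sign of the lattice ratio, which keeps it irrational.
    · refine hγ.isRecurrent h (by rwa [Real.cos_neg]) (by rwa [Real.sin_neg, neg_ne_zero]) ?_
      rw [Real.cos_neg, Real.sin_neg, neg_mul, div_neg]
      exact hirr.neg
  · rw [rho_eq h] at hrat
    rcases hθ with rfl | rfl
    · exact hγ.isClosedLeaf h hcos hsin hrat hsep
    · refine hγ.isClosedLeaf h (by rwa [Real.cos_neg]) (by rwa [Real.sin_neg, neg_ne_zero]) ?_ hsep
      obtain ⟨r, hr⟩ := hrat
      refine ⟨-r, ?_⟩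
      rw [Real.cos_neg, Real.sin_neg, neg_mul, div_neg, ← hr, Rat.cast_neg]
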